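/- Let $E:\mathbb R\to\mathbb R$ be even, Lipschitz continuous, decreasing on $[0,\infty)$, with support $[-1,1]$ and $E(0)=1$, and such that $E,E',E''$ are absolutely continuous and $E'''$ is (almost everywhere equal to a function) of bounded variation. Let $\lambda>0$, $E^\lambda(\nu)=E(\nu/\lambda)$, $\hat E^\lambda(t)=\int_{\mathbb R}E^\lambda(\nu)\cos(\nu t)\,d\nu$, and $$M^\lambda(z)=\frac1\pi\int_0^\infty \hat E^\lambda(t)\,t^{-z}\,dt\qquad(-3<\mathrm{Re}\,z<1).$$ Let $-3/2<c_1<0<c_2<1/2$ and $B>0$. Let $L(c,B)$ be the path consisting of the half-line $\{x=c_1,\ y\le -B\}$, the segments from $c_1-iB$ to $c_2-iB$, from $c_2-iB$ to $c_2+iB$ and from $c_2+iB$ to $c_1+iB$, and the half-line $\{x=c_1,\ y\ge B\}$, traversed upwards, and write $\int_{L(c,B)}f(z)\,dz$ for $1/(2\pi i)$ times the usual contour integral. Write $s=\sigma+i\tau$ and consider $$I(s)=\int_{L(c,B)}\Gamma(z)\frac{\zeta'(z+s)}{\zeta(z+s)}\,dz\int_{L(c,B)}\Gamma(w)\frac{\zeta'(w+s)}{\zeta(w+s)}\,M^\lambda(z+w)\cos\{\pi(z-w)/2\}\,dw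 .$$ (i) For $\sigma>1-c_1$ the repeated integral converges absolutely, and $I(s)$ is a holomorphic function of $s$ there. (ii) If the Riemann Hypothesis holds, then the repeated integral also converges absolutely, and $I(s)$ is holomorphic, in the region $\sigma>\max\{1/2-c_1,\,1-c_2\}$, $|\tau|<B$. (iii) The double series $$T^\lambda(s)=\sum_{k,l\ge1}\Lambda(k)\Lambda(l)\,k^{-s}l^{-s}E^\lambda(k-l)$$ ($\Lambda$ the von Mangoldt function) converges absolutely for $\sigma>1/2$ to a holomorphic function; $T^\lambda(s)=I(s)$ for $\sigma>1-c_1$, so that $T^\lambda$ is the analytic continuation of $I$ to $\{\sigma>1/2\}$; and under the Riemann Hypothesis $T^\lambda(s)=I(s)$ also in the region of (ii). -/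

import Mathlib

open MeasureTheory Set

noncomputable section

namespace PrimePairs

/-- A smooth sieving function: an even function `E`, Lipschitz, decreasing on `[0, ∞)`, with support
`[-1, 1]` and `E 0 = 1`, such that `E`, `E'`, `E''` are absolutely continuous and `E'''` (which exists
almost everywhere) is of bounded variation. -/
structure IsSmoothSieve (E : ℝ → ℝ) : Prop where
  even : ∀ x, E (-x) = E x
  lipschitz : ∃ K, LipschitzWith K E
  antitone : AntitoneOn E (Ici 0)
  support : tsupport E = Icc (-1) 1
  zero : E 0 = 1
  differentiable : Differentiable ℝ E
  differentiable_deriv : Differentiable ℝ (deriv E)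
  ac : ∀ a b, AbsolutelyContinuousOnInterval E a b
  ac_deriv : ∀ a b, AbsolutelyContinuousOnInterval (deriv E) a b
  ac_deriv_deriv : ∀ a b, AbsolutelyContinuousOnInterval (deriv (deriv E)) a b
  bv : ∃ g : ℝ → ℝ, BoundedVariationOn g univ ∧ deriv (deriv (deriv E)) =ᵐ[volume] g

/-- `E^lam(ν) = E(ν / lam)`. -/
def scaled (E : ℝ → ℝ) (lam ν : ℝ) : ℝ := E (ν / lam)

/-- The Fourier transform of `E^lam` (no normalizing factor). Since `E^lam` is even, it is the cosine
transform `∫ E^lam(ν) cos(ν t) dν` over the real line. -/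
def fourierE (E : ℝ → ℝ) (lam t : ℝ) : ℝ := ∫ ν : ℝ, scaled E lam ν * Real.cos (ν * t)

/-- The Mellin transform `M^lam(z) = (1/π) ∫_0^∞ (Fourier transform of E^lam)(t) t^(-z) dt`.
For a smooth sieving function the Fourier transform is `O((|t|+1)^(-4))`, so that the integral converges
absolutely for `-3 < Re z < 1`; it is holomorphic there, hence equal on this strip to the analytic
continuation of its restriction to `-1 < Re z < 1`. Only values in this strip are used. -/
def mellinM (E : ℝ → ℝ) (lam : ℝ) (z : ℂ) : ℂ :=
  (1 / (Real.pi : ℂ)) * ∫ t : ℝ in Ioi 0, (fourierE E lam t : ℂ) * (t : ℂ) ^ (-z)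

/-- The path `L(c, B) = L(c₁, c₂, B)`, parametrized by arc length and traversed upwards:
the half-line `x = c₁, y ≤ -B`, the segment from `c₁ - iB` to `c₂ - iB`, the segment from `c₂ - iB` to
`c₂ + iB`, the segment from `c₂ + iB` to `c₁ + iB`, and the half-line `x = c₁, y ≥ B`. -/
def pathL (c₁ c₂ B t : ℝ) : ℂ :=
  if t ≤ -B - (c₂ - c₁) then ⟨c₁, t + (c₂ - c₁)⟩
  else if t ≤ -B then ⟨c₂ + (t + B), -B⟩
  else if t ≤ B then ⟨c₂, t⟩
  else if t ≤ B + (c₂ - c₁) then ⟨c₂ - (t - B), B⟩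
  else ⟨c₁, t - (c₂ - c₁)⟩

/-- The contour integral `(1 / (2πi)) ∫_{L(c₁, c₂, B)} f(z) dz`. -/
def contourL (c₁ c₂ B : ℝ) (f : ℂ → ℂ) : ℂ :=
  (1 / (2 * (Real.pi : ℂ) * Complex.I)) *
    ∫ t : ℝ, f (pathL c₁ c₂ B t) * deriv (pathL c₁ c₂ B) t

/-- `ζ'(Z) / ζ(Z)`. -/
def zetaLogDeriv (Z : ℂ) : ℂ := deriv riemannZeta Z / riemannZeta Z

/-- The `w`-integrand `Γ(w) (ζ'/ζ)(w+s) M^lam(z+w) cos(π(z-w)/2)`. -/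
def innerIntegrand (E : ℝ → ℝ) (lam : ℝ) (s z w : ℂ) : ℂ :=
  Complex.Gamma w * zetaLogDeriv (w + s) * mellinM E lam (z + w) *
    Complex.cos ((Real.pi : ℂ) * (z - w) / 2)

/-- The repeated complex integral
`∫_L Γ(z) (ζ'/ζ)(z+s) dz ∫_L Γ(w) (ζ'/ζ)(w+s) M^lam(z+w) cos(π(z-w)/2) dw`. -/
def integralT (E : ℝ → ℝ) (lam c₁ c₂ B : ℝ) (s : ℂ) : ℂ :=
  contourL c₁ c₂ B fun z =>
    Complex.Gamma z * zetaLogDeriv (z + s) *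
      contourL c₁ c₂ B fun w => innerIntegrand E lam s z w

/-- Absolute convergence of the repeated integral at `s`: for every `z` on the path the `w`-integral
converges absolutely, and the whole integrand is absolutely integrable with respect to `|dz| |dw|`. -/
def IntegralTConverges (E : ℝ → ℝ) (lam c₁ c₂ B : ℝ) (s : ℂ) : Prop :=
  (∀ t : ℝ, Integrable fun u : ℝ =>
    innerIntegrand E lam s (pathL c₁ c₂ B t) (pathL c₁ c₂ B u) * deriv (pathL c₁ c₂ B) u) ∧
  Integrable fun p : ℝ × ℝ =>
    Complex.Gamma (pathL c₁ c₂ B p.1) * zetaLogDeriv (pathL c₁ c₂ B p.1 + s) *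
      innerIntegrand E lam s (pathL c₁ c₂ B p.1) (pathL c₁ c₂ B p.2) *
      deriv (pathL c₁ c₂ B) p.1 * deriv (pathL c₁ c₂ B) p.2

/-- The term `Λ(k) Λ(l) k^(-s) l^(-s) E^lam(k - l)`; it vanishes if `k = 0` or `l = 0`. -/
def termT (E : ℝ → ℝ) (lam : ℝ) (s : ℂ) (p : ℕ × ℕ) : ℂ :=
  (ArithmeticFunction.vonMangoldt p.1 : ℂ) * (ArithmeticFunction.vonMangoldt p.2 : ℂ) *
    (p.1 : ℂ) ^ (-s) * (p.2 : ℂ) ^ (-s) * (scaled E lam ((p.1 : ℝ) - (p.2 : ℝ)) : ℂ)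

/-- The half-plane `σ > 1 - c₁`. -/
def halfPlane (c₁ : ℝ) : Set ℂ := {s | 1 - c₁ < s.re}

/-- The region `σ > max {1/2 - c₁, 1 - c₂}, |τ| < B`. -/
def halfStrip (c₁ c₂ B : ℝ) : Set ℂ := {s | max (1 / 2 - c₁) (1 - c₂) < s.re ∧ |s.im| < B}

end PrimePairs

end

/-!
The sum and the integral are linked by one evaluation: for positive `x`, `y`, the double contour
integral of `Γ(z) Γ(w) M^lam(z + w) cos(π(z - w)/2) x^(-z) y^(-w)` is `E^lam(x - y)`
(`integral_cosKernel_mul_cpow`). Formally, one inserts the definition of `M^lam` as an integral over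
`t` and integrates over `z` and `w` first. Since `exp(-r)` is the inverse Mellin transform of `Γ`
(`contourL_Gamma_mul_cpow`; the path crosses the real axis to the right of the poles of `Γ`, as
`c₂ > 0`), writing the cosine as a half sum of exponentials `exp(iθ(z - w))` with `θ = ± π/2` leaves
`(1/π) ∫ (Fourier transform of E^lam)(t) cos((x - y) t) dt`, which is Fourier inversion. For
`θ = ± π/2` the triple integral need not converge absolutely. It does for `|θ| < π/2`, where the
rotated exponentials decay, and both sides are continuous in `θ` up to the endpoints, because
`exists_expKernel_majorant` gives an integrable majorant of the kernel that is uniform in `θ`.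

That majorant also gives the absolute convergence. On the path `Γ` has the size
`|y|^(c₁ - 1/2) exp(-π|y|/2)` (`exists_norm_Gamma_le`), and the exponential is cancelled by the
cosine. What remains is a double integral of `(1 + |t|)^(c₁ - 1/2) (1 + |u|)^(c₁ - 1/2)` times
`M^lam` at a point with imaginary part near `t + u`. If `c₁` is close to `0`, one needs that `M^lam`
decays like the inverse of the imaginary part, which follows from an integration by parts and the
decay `O(t⁻⁴)` of the Fourier transform of `E^lam` and of its derivative
(`IsCompactSmooth.exists_abs_integral_mul_cos_le`). The majorant leaves a small power of
`1 + |t|` and of `1 + |u|` to spare. So the repeated integral converges and is holomorphic in `s`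
as soon as `ζ'/ζ` is regular on the translated path and grows at most like a small power
(`IsZetaRegion.integralTConverges`, `IsZetaRegion.differentiableOn_integralT`). In the half-plane
`ζ'/ζ` is bounded; in the half-strip, under the Riemann hypothesis, the growth condition is obtained
from the Borel–Carathéodory theorem (`exists_norm_zetaLogDeriv_le_of_RH`).

In the half-plane both factors `ζ'/ζ` are expanded into Dirichlet series and integrated termwise,
which gives the double series (`hasSum_termT_integralT`). Only terms with `|k - l| ≤ lam` contribute
to it, so `2ab ≤ a² + b²` gives its convergence for `σ > 1/2` (`exists_termT_majorant`). The
half-strip meets the half-plane and is convex, and the identity theorem concludes.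
-/

noncomputable section

namespace PrimePairs

/-! ### Holomorphy of parameter integrals and a complex Gamma integral -/

section

open Filter Topology Complex

/-- Holomorphy of a parameter integral, assuming domination of the integrand only: by Cauchy's
estimate on a slightly smaller disc this dominates the derivative as well. -/
theorem differentiableOn_integral_of_dominated {α : Type*} [MeasurableSpace α] {μ : Measure α}
    {U : Set ℂ} (hU : IsOpen U) {F : ℂ → α → ℂ}
    (hmeas : ∀ s ∈ U, AEStronglyMeasurable (F s) μ)
    (hdiff : ∀ᵐ a ∂μ, DifferentiableOn ℂ (fun s => F s a) U)
    (hbound : ∀ s₀ ∈ U, ∃ r > 0, ∃ g : α → ℝ, Integrable g μ ∧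
      ∀ᵐ a ∂μ, ∀ s ∈ Metric.ball s₀ r, ‖F s a‖ ≤ g a) :
    DifferentiableOn ℂ (fun s => ∫ a, F s a ∂μ) U := by
  intro s₀ hs₀
  obtain ⟨r₁, hr₁, g, hg, hFg⟩ := hbound s₀ hs₀
  obtain ⟨r₂, hr₂, hUr⟩ := Metric.isOpen_iff.mp hU s₀ hs₀
  obtain ⟨r, hr, hrr₁, hrr₂⟩ : ∃ r > 0, 2 * r < r₁ ∧ 2 * r < r₂ :=
    ⟨min r₁ r₂ / 3, by positivity, by linarith [min_le_left r₁ r₂, hr₁, lt_min hr₁ hr₂],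
      by linarith [min_le_right r₁ r₂, hr₂, lt_min hr₁ hr₂]⟩
  have hball : Metric.ball s₀ r ⊆ U := (Metric.ball_subset_ball (by linarith)).trans hUr
  have hsub : ∀ s ∈ Metric.ball s₀ r, Metric.closedBall s r ⊆ Metric.ball s₀ (min r₁ r₂) := by
    intro s hs z hz
    rw [Metric.mem_ball] at hs ⊢
    rw [Metric.mem_closedBall] at hz
    have := dist_triangle z s s₀
    exact lt_min (by linarith) (by linarith)
  -- the derivative is a limit of difference quotients, hence measurable
  have hderiv_meas : AEStronglyMeasurable (fun a => deriv (fun s => F s a) s₀) μ := by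
    let h : ℕ → ℂ := fun n => ((r / (n + 2) : ℝ) : ℂ)
    have hpos : ∀ n : ℕ, 0 < r / ((n : ℝ) + 2) := fun n => by positivity
    have hh : Tendsto h atTop (𝓝[≠] 0) := by
      refine tendsto_nhdsWithin_iff.mpr ⟨?_, Eventually.of_forall fun n => ?_⟩
      · have : Tendsto (fun n : ℕ => r / ((n : ℝ) + 2)) atTop (𝓝 0) :=
          tendsto_const_nhds.div_atTop
            (tendsto_atTop_add_const_right _ _ tendsto_natCast_atTop_atTop)
        rw [← ofReal_zero]
        exact (continuous_ofReal.tendsto 0).comp this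
      · simpa [h] using (ofReal_ne_zero.mpr (hpos n).ne')
    have hmem : ∀ n, s₀ + h n ∈ U := fun n => hball (by
      have h2 : r / ((n : ℝ) + 2) < r :=
        div_lt_self hr (by linarith [(Nat.cast_nonneg n : (0 : ℝ) ≤ n)])
      simp only [h, Metric.mem_ball, dist_self_add_left, Complex.norm_real, Real.norm_eq_abs,
        abs_of_pos (hpos n)]
      exact h2)
    refine aestronglyMeasurable_of_tendsto_ae atTop
      (f := fun n a => (h n)⁻¹ • (F (s₀ + h n) a - F s₀ a)) (fun n => ?_) ?_
    · exact ((hmeas _ (hmem n)).sub (hmeas _ hs₀)).const_smul (h n)⁻¹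
    · filter_upwards [hdiff] with a ha
      have := ((ha s₀ hs₀).differentiableAt (hU.mem_nhds hs₀)).hasDerivAt
      exact (hasDerivAt_iff_tendsto_slope_zero.mp this).comp hh
  have key := hasDerivAt_integral_of_dominated_loc_of_deriv_le (μ := μ) (F := F)
    (F' := fun s a => deriv (fun s => F s a) s) (x₀ := s₀) (s := Metric.ball s₀ r)
    (bound := fun a => g a / r)
    (Metric.ball_mem_nhds s₀ hr)
    (by filter_upwards [hU.mem_nhds hs₀] with s hs using hmeas s hs)
    (hg.mono' (hmeas s₀ hs₀) (by
      filter_upwards [hFg] with a ha using ha s₀ (Metric.mem_ball_self hr₁)))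
    hderiv_meas
    (by
      filter_upwards [hdiff, hFg] with a ha hag s hs
      have hd : DifferentiableOn ℂ (fun s => F s a) (Metric.closedBall s r) :=
        ha.mono fun z hz => hUr (Metric.ball_subset_ball (min_le_right _ _) (hsub s hs hz))
      refine Complex.norm_deriv_le_of_forall_mem_sphere_norm_le hr
        (hd.diffContOnCl_ball le_rfl) fun z hz => hag z ?_
      exact Metric.ball_subset_ball (min_le_left _ _)
        (hsub s hs (Metric.sphere_subset_closedBall hz)))
    (hg.div_const r)
    (by
      filter_upwards [hdiff] with a ha s hs
      exact ((ha s (hball hs)).differentiableAt (hU.mem_nhds (hball hs))).hasDerivAt)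
  exact key.2.differentiableAt.differentiableWithinAt

/-- Mellin transform of `t ↦ exp (-r t)` for complex `r` in the right half-plane, by analytic
continuation in `r` from the positive real axis. -/
theorem integral_cpow_mul_exp_neg_complex_mul_Ioi {a r : ℂ} (ha : 0 < a.re) (hr : 0 < r.re) :
    ∫ t : ℝ in Ioi 0, (t : ℂ) ^ (a - 1) * cexp (-(r * t)) = r ^ (-a) * Gamma a := by
  have hUo : IsOpen {r : ℂ | 0 < r.re} := isOpen_lt continuous_const continuous_re
  have hconv : IsPreconnected {r : ℂ | 0 < r.re} := (convex_halfSpace_re_gt 0).isPreconnected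
  have hL : DifferentiableOn ℂ
      (fun r : ℂ => ∫ t : ℝ in Ioi 0, (t : ℂ) ^ (a - 1) * cexp (-(r * t))) {r : ℂ | 0 < r.re} := by
    refine differentiableOn_integral_of_dominated hUo (fun s _ => ?_) ?_ fun s₀ hs₀ => ?_
    · exact Measurable.aestronglyMeasurable (by fun_prop)
    · exact Eventually.of_forall fun t => by fun_prop
    · have hs₀' : 0 < s₀.re := hs₀
      refine ⟨s₀.re / 2, by positivity,
        fun t => t ^ (a.re - 1) * Real.exp (-(s₀.re / 2 * t)), ?_, ?_⟩
      · have := integrableOn_rpow_mul_exp_neg_mul_rpow (s := a.re - 1) (p := 1) (b := s₀.re / 2)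
          (by linarith) (by norm_num) (by positivity)
        simpa [IntegrableOn] using this
      · refine (ae_restrict_iff' measurableSet_Ioi).mpr (Eventually.of_forall fun t ht s hs => ?_)
        have ht' : 0 < t := ht
        rw [norm_mul, norm_cpow_eq_rpow_re_of_pos ht', norm_exp]
        have hre : |(s - s₀).re| < s₀.re / 2 :=
          (abs_re_le_norm _).trans_lt (by simpa [dist_eq_norm] using hs)
        rw [sub_re, abs_lt] at hre
        have : -(s * (t:ℂ)).re ≤ -(s₀.re / 2 * t) := by
          simp only [re_mul_ofReal]
          nlinarith
        simp only [sub_re, one_re, neg_re]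
        gcongr
  have hR : DifferentiableOn ℂ (fun r : ℂ => r ^ (-a) * Gamma a) {r : ℂ | 0 < r.re} := by
    intro s hs
    exact ((differentiableAt_id.cpow_const (Or.inl hs)).mul_const _).differentiableWithinAt
  have hE := (hL.analyticOnNhd hUo).eqOn_of_preconnected_of_frequently_eq
    (hR.analyticOnNhd hUo) hconv (z₀ := 1) (by simp) ?_
  · exact hE hr
  · have hsub : Tendsto (fun n : ℕ => ((1 + 1 / ((n : ℝ) + 1) : ℝ) : ℂ)) atTop (𝓝[≠] 1) := by
      refine tendsto_nhdsWithin_iff.mpr ⟨?_, Eventually.of_forall fun n => ?_⟩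
      · have := tendsto_one_div_add_atTop_nhds_zero_nat (𝕜 := ℝ)
        simpa [Function.comp_def] using
          (continuous_ofReal.tendsto (1 + 0)).comp (tendsto_const_nhds.add this)
      · have : (1 / ((n : ℝ) + 1)) ≠ 0 := by positivity
        rw [mem_compl_iff, mem_singleton_iff, ← ofReal_one, ofReal_inj]
        simpa using this
    refine hsub.frequently (Frequently.of_forall fun n => ?_)
    have hp : 0 < 1 + 1 / ((n : ℝ) + 1) := by positivity
    rw [integral_cpow_mul_exp_neg_mul_Ioi ha hp, one_div, cpow_neg,
      inv_cpow _ _ (by rw [arg_ofReal_of_nonneg hp.le]; exact Real.pi_pos.ne)]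

end

/-! ### Decay of the Gamma function on vertical lines -/

section

open Filter Topology Complex

/-- The function `a ↦ a ^ 2 / (a ^ 2 + y ^ 2)` is logarithmically concave. These are the factors of
the Euler product of `(|Γ(x + iy)| / Γ(x)) ^ 2`. -/
theorem sq_div_sq_add_logConcave {a b l : ℝ} (y : ℝ) (ha : 0 < a) (hb : 0 < b) (hl₀ : 0 ≤ l)
    (hl₁ : l ≤ 1) :
    (a ^ 2 / (a ^ 2 + y ^ 2)) ^ l * (b ^ 2 / (b ^ 2 + y ^ 2)) ^ (1 - l) ≤
      (l * a + (1 - l) * b) ^ 2 / ((l * a + (1 - l) * b) ^ 2 + y ^ 2) := by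
  have hl₂ : 0 ≤ 1 - l := by linarith
  set u := l * a + (1 - l) * b with hu
  have hgm : a ^ l * b ^ (1 - l) ≤ u :=
    Real.geom_mean_le_arith_mean2_weighted hl₀ hl₂ ha.le hb.le (by ring)
  have hgm0 : 0 < a ^ l * b ^ (1 - l) := by positivity
  have hu0 : 0 < u := hgm0.trans_le hgm
  set P := a ^ 2 / (a ^ 2 + y ^ 2) with hP
  set Q := b ^ 2 / (b ^ 2 + y ^ 2) with hQ
  have hP0 : 0 ≤ P := by positivity
  have hQ0 : 0 ≤ Q := by positivity
  set X := P ^ l * Q ^ (1 - l) with hX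
  have hX0 : 0 ≤ X := by positivity
  have h1 : X ≤ l * P + (1 - l) * Q :=
    Real.geom_mean_le_arith_mean2_weighted hl₀ hl₂ hP0 hQ0 (by ring)
  have hP1 : 1 - P = P * (y ^ 2 / a ^ 2) := by rw [hP]; field_simp; ring
  have hQ1 : 1 - Q = Q * (y ^ 2 / b ^ 2) := by rw [hQ]; field_simp; ring
  have h2 : (P * (y ^ 2 / a ^ 2)) ^ l * (Q * (y ^ 2 / b ^ 2)) ^ (1 - l) ≤
      l * (1 - P) + (1 - l) * (1 - Q) := by
    rw [hP1, hQ1]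
    exact Real.geom_mean_le_arith_mean2_weighted hl₀ hl₂ (by positivity) (by positivity) (by ring)
  have h3 : (P * (y ^ 2 / a ^ 2)) ^ l * (Q * (y ^ 2 / b ^ 2)) ^ (1 - l) =
      X * (y ^ 2 / (a ^ l * b ^ (1 - l)) ^ 2) := by
    have e : ∀ w r : ℝ, 0 ≤ w → (w ^ 2) ^ r = (w ^ r) ^ 2 := fun w r hw => by
      rw [← Real.rpow_natCast_mul hw, ← Real.rpow_mul_natCast hw, mul_comm]
    have : (y ^ 2) ^ l * (y ^ 2) ^ (1 - l) = y ^ 2 := by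
      rw [← Real.rpow_add_of_nonneg (by positivity) hl₀ hl₂]; simp
    rw [Real.mul_rpow hP0 (by positivity), Real.mul_rpow hQ0 (by positivity),
      Real.div_rpow (sq_nonneg y) (sq_nonneg a), Real.div_rpow (sq_nonneg y) (sq_nonneg b),
      e a l ha.le, e b (1 - l) hb.le, mul_pow]
    calc _ = X * (((y ^ 2) ^ l * (y ^ 2) ^ (1 - l)) / ((a ^ l) ^ 2 * (b ^ (1 - l)) ^ 2)) := by
          rw [hX]; ring
      _ = _ := by rw [this]
  have h4 : X * (y ^ 2 / u ^ 2) ≤ X * (y ^ 2 / (a ^ l * b ^ (1 - l)) ^ 2) := by gcongr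
  have h5 : X * (1 + y ^ 2 / u ^ 2) ≤ 1 := by nlinarith
  rw [le_div_iff₀ (by positivity)]
  have : X * (u ^ 2 + y ^ 2) = X * (1 + y ^ 2 / u ^ 2) * u ^ 2 := by field_simp
  rw [this]
  nlinarith [sq_nonneg u]

/-- The Euler product of `(|Γ(x + iy)| / Γ(x)) ^ 2`, from Euler's limit formula for `Γ`. -/
theorem tendsto_prod_sq_div_Gamma {x : ℝ} (hx : 0 < x) (y : ℝ) :
    Tendsto (fun n : ℕ => ∏ j ∈ Finset.range (n + 1), ((x + j) ^ 2 / ((x + j) ^ 2 + y ^ 2)))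
      atTop (𝓝 ((‖Gamma (x + y * I)‖ / Real.Gamma x) ^ 2)) := by
  have h1 := (GammaSeq_tendsto_Gamma (x + y * I)).norm
  have h2 := Real.GammaSeq_tendsto_Gamma x
  refine ((h1.div h2 (Real.Gamma_pos_of_pos hx).ne').pow 2).congr' ?_
  filter_upwards [eventually_gt_atTop 0] with n hn
  have hn' : (0 : ℝ) < n := by exact_mod_cast hn
  rw [Pi.div_apply, Complex.GammaSeq, Real.GammaSeq, norm_div, norm_mul, norm_prod,
    ← ofReal_natCast n, norm_cpow_eq_rpow_re_of_pos hn']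
  have hj : ∀ j : ℕ, 0 < x + j := fun j => by positivity
  have hnorm : ∀ j : ℕ, ‖(x : ℂ) + y * I + j‖ ^ 2 = (x + j) ^ 2 + y ^ 2 := by
    intro j
    rw [← normSq_eq_norm_sq, normSq_apply]
    simp
    ring
  have hnorm0 : ∀ j : ℕ, 0 < ‖(x : ℂ) + y * I + j‖ := by
    intro j
    have h0 := hj j
    exact (norm_nonneg _).lt_of_ne' (sq_pos_iff.mp (by rw [hnorm j]; positivity))
  simp only [Finset.prod_div_distrib, ← hnorm, Finset.prod_pow]
  have hp1 : ∏ j ∈ Finset.range (n + 1), ‖(x : ℂ) + y * I + j‖ ≠ 0 :=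
    Finset.prod_ne_zero_iff.mpr fun j _ => (hnorm0 j).ne'
  have hp2 : ∏ j ∈ Finset.range (n + 1), (x + j) ≠ 0 :=
    Finset.prod_ne_zero_iff.mpr fun j _ => (hj j).ne'
  have hf : ‖((n.factorial : ℕ) : ℂ)‖ = n.factorial := by simp
  have hf0 : (n.factorial : ℝ) ≠ 0 := by positivity
  have hr : (n : ℝ) ^ x ≠ 0 := by positivity
  rw [hf]
  simp only [add_re, ofReal_re, mul_re, I_re, mul_zero, ofReal_im, I_im, mul_one, sub_self,
    add_zero]
  field_simp

/-- The function `x ↦ |Γ(x + iy)| / Γ(x)` is logarithmically concave on the positive half-line. -/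
theorem norm_Gamma_div_logConcave {a b l : ℝ} (y : ℝ) (ha : 0 < a) (hb : 0 < b) (hl₀ : 0 ≤ l)
    (hl₁ : l ≤ 1) :
    ((‖Gamma (a + y * I)‖ / Real.Gamma a) ^ 2) ^ l *
      ((‖Gamma (b + y * I)‖ / Real.Gamma b) ^ 2) ^ (1 - l) ≤
      (‖Gamma ((l * a + (1 - l) * b : ℝ) + y * I)‖ / Real.Gamma (l * a + (1 - l) * b)) ^ 2 := by
  have hl₂ : 0 ≤ 1 - l := by linarith
  have hu : 0 < l * a + (1 - l) * b :=
    (by positivity : 0 < a ^ l * b ^ (1 - l)).trans_le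
      (Real.geom_mean_le_arith_mean2_weighted hl₀ hl₂ ha.le hb.le (by ring))
  refine le_of_tendsto_of_tendsto' (((tendsto_prod_sq_div_Gamma ha y).rpow_const (Or.inr hl₀)).mul
    ((tendsto_prod_sq_div_Gamma hb y).rpow_const (Or.inr hl₂)))
    (tendsto_prod_sq_div_Gamma hu y) fun n => ?_
  rw [← Real.finsetProd_rpow _ _ (fun j _ => by positivity),
    ← Real.finsetProd_rpow _ _ (fun j _ => by positivity), ← Finset.prod_mul_distrib]
  refine Finset.prod_le_prod (fun j _ => by positivity) fun j _ => ?_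
  have := sq_div_sq_add_logConcave (a := a + j) (b := b + j) y (by positivity) (by positivity)
    hl₀ hl₁
  rwa [show l * (a + j) + (1 - l) * (b + j) = l * a + (1 - l) * b + j by ring] at this

/-- The reflection formula on the line `Re z = 1 / 2`. -/
theorem norm_Gamma_half_sq (y : ℝ) :
    (‖Gamma ((1 / 2 : ℝ) + y * I)‖ / Real.Gamma (1 / 2)) ^ 2 = 1 / Real.cosh (Real.pi * y) := by
  have h := Gamma_mul_Gamma_one_sub ((1 / 2 : ℝ) + y * I)
  have hc : (1 : ℂ) - ((1 / 2 : ℝ) + y * I) = (starRingEnd ℂ) ((1 / 2 : ℝ) + y * I) := by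
    simp only [map_add, map_mul, conj_ofReal, conj_I]; push_cast; ring
  rw [hc, Gamma_conj, mul_conj, normSq_eq_norm_sq] at h
  have hs : sin (Real.pi * ((1 / 2 : ℝ) + y * I)) = (Real.cosh (Real.pi * y) : ℝ) := by
    rw [show (Real.pi : ℂ) * ((1 / 2 : ℝ) + y * I) = (Real.pi * y : ℝ) * I + Real.pi / 2 by
      push_cast; ring, sin_add_pi_div_two, cos_mul_I, ofReal_cosh]
  rw [hs, ← ofReal_div, ofReal_inj] at h
  rw [div_pow, h, Real.Gamma_one_half_eq, Real.sq_sqrt Real.pi_pos.le]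
  have := Real.cosh_pos (Real.pi * y)
  have := Real.pi_pos
  field_simp

/-- The reflection formula on the line `Re z = 1`. -/
theorem norm_Gamma_one_sq {y : ℝ} (hy : y ≠ 0) :
    (‖Gamma ((1 : ℝ) + y * I)‖ / Real.Gamma 1) ^ 2 =
      Real.pi * y / Real.sinh (Real.pi * y) := by
  have hyI : (y : ℂ) * I ≠ 0 := mul_ne_zero (ofReal_ne_zero.mpr hy) I_ne_zero
  have h := Gamma_mul_Gamma_one_sub (y * I)
  have h1 : Gamma ((1 : ℝ) + y * I) = y * I * Gamma (y * I) := by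
    rw [ofReal_one, add_comm, Gamma_add_one _ hyI]
  have hc : (1 : ℂ) - y * I = (starRingEnd ℂ) ((1 : ℝ) + y * I) := by
    simp only [map_add, map_mul, conj_ofReal, conj_I]; push_cast; ring
  have h2 : Gamma ((1 : ℝ) + y * I) * (starRingEnd ℂ) (Gamma ((1 : ℝ) + y * I)) =
      y * I * (Real.pi / sin (Real.pi * (y * I))) := by
    rw [← h, hc, Gamma_conj]; nth_rewrite 1 [h1]; ring
  have hs : sin (Real.pi * (y * I)) = (Real.sinh (Real.pi * y) : ℝ) * I := by
    rw [← mul_assoc, sin_mul_I, ofReal_sinh]; push_cast; ring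
  have hsh : Real.sinh (Real.pi * y) ≠ 0 := by
    rw [Ne, Real.sinh_eq_zero]; exact mul_ne_zero Real.pi_ne_zero hy
  rw [hs, mul_conj, normSq_eq_norm_sq] at h2
  have h3 : (y : ℂ) * I * (Real.pi / ((Real.sinh (Real.pi * y) : ℝ) * I)) =
      ((Real.pi * y / Real.sinh (Real.pi * y) : ℝ) : ℂ) := by
    have : ((Real.sinh (Real.pi * y) : ℝ) : ℂ) ≠ 0 := ofReal_ne_zero.mpr hsh
    rw [ofReal_div, ofReal_mul]
    field_simp [I_ne_zero]
  rw [h3, ofReal_inj] at h2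
  rw [Real.Gamma_one, div_one, h2]

/-- The Stirling bound to the right of `1`. Since `1` lies between `1 / 2` and `x`, logarithmic
concavity bounds `|Γ(x + iy)|` from above by the values on the lines `Re z = 1 / 2` and `Re z = 1`,
which the reflection formula gives explicitly. -/
theorem exists_norm_Gamma_le_of_one_lt {x B : ℝ} (hx : 1 < x) (hB : 0 < B) :
    ∃ C, ∀ y : ℝ, B ≤ |y| →
      ‖Gamma (x + y * I)‖ ≤ C * (|y| ^ (x - 1 / 2) * Real.exp (-(Real.pi / 2 * |y|))) := by
  set l : ℝ := 1 - 1 / (2 * x - 1) with hl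
  have hx' : 0 < 2 * x - 1 := by linarith
  have h1l : 1 - l = 1 / (2 * x - 1) := by rw [hl]; ring
  have hl₁ : l ≤ 1 := by rw [hl]; have : 0 < 1 / (2 * x - 1) := by positivity
                         linarith
  have hl₀ : 0 ≤ l := by
    rw [hl, sub_nonneg, div_le_one hx']; linarith
  have hu : l * (1 / 2) + (1 - l) * x = 1 := by rw [h1l, hl]; field_simp; ring
  set c : ℝ := (1 - Real.exp (-(2 * Real.pi * B))) / 2 with hc
  have hc0 : 0 < c := by
    have : Real.exp (-(2 * Real.pi * B)) < 1 := Real.exp_lt_one_iff.mpr (by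
      have := Real.pi_pos
      have := mul_pos this hB
      linarith)
    rw [hc]; linarith
  have hG := Real.Gamma_pos_of_pos (by linarith : 0 < x)
  refine ⟨Real.Gamma x * (Real.pi / c) ^ (x - 1 / 2), fun y hy => ?_⟩
  have hypos : 0 < |y| := hB.trans_le hy
  have hy0 : y ≠ 0 := abs_pos.mp hypos
  have key := norm_Gamma_div_logConcave y (a := 1 / 2) (b := x) (by norm_num) (by linarith) hl₀ hl₁
  rw [hu, norm_Gamma_half_sq, norm_Gamma_one_sq hy0] at key
  set Q := (‖Gamma (x + y * I)‖ / Real.Gamma x) ^ 2 with hQ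
  have hQ0 : 0 ≤ Q := by positivity
  have hcosh : Real.cosh (Real.pi * y) ≤ Real.exp (Real.pi * |y|) := by
    rw [← Real.cosh_abs, abs_mul, abs_of_pos Real.pi_pos, Real.cosh_eq]
    have : Real.exp (-(Real.pi * |y|)) ≤ Real.exp (Real.pi * |y|) :=
      Real.exp_le_exp.mpr (by have := mul_pos Real.pi_pos hypos; linarith)
    linarith
  have hsinh : Real.pi * y / Real.sinh (Real.pi * y) ≤
      Real.pi / c * |y| * Real.exp (-(Real.pi * |y|)) := by
    have h1 : Real.pi * y / Real.sinh (Real.pi * y) =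
        Real.pi * |y| / Real.sinh (Real.pi * |y|) := by
      rcases abs_cases y with h | h
      · rw [h.1]
      · rw [h.1, mul_neg, Real.sinh_neg, neg_div_neg_eq]
    have h2 : c * Real.exp (Real.pi * |y|) ≤ Real.sinh (Real.pi * |y|) := by
      rw [Real.sinh_eq, hc]
      have : Real.exp (-(Real.pi * |y|)) ≤
          Real.exp (-(2 * Real.pi * B)) * Real.exp (Real.pi * |y|) := by
        rw [← Real.exp_add]
        exact Real.exp_le_exp.mpr (by nlinarith [Real.pi_pos])
      linarith
    rw [h1, Real.exp_neg]
    have he := Real.exp_pos (Real.pi * |y|)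
    have := Real.pi_pos
    calc _ ≤ Real.pi * |y| / (c * Real.exp (Real.pi * |y|)) := by gcongr
      _ = _ := by field_simp
  have hcl : (1 / Real.cosh (Real.pi * y)) ^ l ≥ Real.exp (-(Real.pi * |y|) * l) := by
    rw [Real.exp_mul, ge_iff_le]
    refine Real.rpow_le_rpow (Real.exp_pos _).le ?_ hl₀
    rw [Real.exp_neg, ← one_div]
    exact one_div_le_one_div_of_le (Real.cosh_pos _) hcosh
  have h6 : Real.exp (-(Real.pi * |y|) * l) * Q ^ (1 - l) ≤
      Real.pi / c * |y| * Real.exp (-(Real.pi * |y|)) :=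
    (mul_le_mul_of_nonneg_right hcl (by positivity)).trans (key.trans hsinh)
  have h7 : Q ^ (1 - l) ≤ Real.pi / c * |y| * Real.exp (-(Real.pi * |y|) * (1 - l)) := by
    have : Real.exp (-(Real.pi * |y|)) =
        Real.exp (-(Real.pi * |y|) * l) * Real.exp (-(Real.pi * |y|) * (1 - l)) := by
      rw [← Real.exp_add]; ring_nf
    rw [this] at h6
    have he := Real.exp_pos (-(Real.pi * |y|) * l)
    refine le_of_mul_le_mul_left ?_ he
    linarith
  have hpc : 0 < Real.pi / c := div_pos Real.pi_pos hc0
  have h8 : Q ^ (1 / 2 : ℝ) ≤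
      (Real.pi / c) ^ (x - 1 / 2) * (|y| ^ (x - 1 / 2) * Real.exp (-(Real.pi / 2 * |y|))) := by
    have h9 := Real.rpow_le_rpow (by positivity) h7 (by linarith : 0 ≤ x - 1 / 2)
    rw [← Real.rpow_mul hQ0, Real.mul_rpow (by positivity) (by positivity),
      Real.mul_rpow hpc.le hypos.le, ← Real.exp_mul, h1l] at h9
    have e1 : 1 / (2 * x - 1) * (x - 1 / 2) = 1 / 2 := by field_simp
    rw [mul_assoc (-(Real.pi * |y|)), e1] at h9
    refine h9.trans_eq ?_
    rw [mul_assoc]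
    congr 3
    ring
  rw [← Real.sqrt_eq_rpow, hQ, Real.sqrt_sq (by positivity), div_le_iff₀ hG] at h8
  linarith

/-- The Stirling bound for the Gamma function on a vertical line, carried to the left by the
functional equation. -/
theorem exists_norm_Gamma_le {x B : ℝ} (hx : -2 < x) (hB : 0 < B) :
    ∃ C, ∀ y : ℝ, B ≤ |y| →
      ‖Gamma (x + y * I)‖ ≤ C * (|y| ^ (x - 1 / 2) * Real.exp (-(Real.pi / 2 * |y|))) := by
  have step : ∀ x : ℝ, (∃ C, ∀ y : ℝ, B ≤ |y| → ‖Gamma ((x + 1 : ℝ) + y * I)‖ ≤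
        C * (|y| ^ (x + 1 - 1 / 2) * Real.exp (-(Real.pi / 2 * |y|)))) →
      ∃ C, ∀ y : ℝ, B ≤ |y| → ‖Gamma (x + y * I)‖ ≤
        C * (|y| ^ (x - 1 / 2) * Real.exp (-(Real.pi / 2 * |y|))) := by
    rintro x ⟨C, hC⟩
    refine ⟨C, fun y hy => ?_⟩
    have hypos : 0 < |y| := hB.trans_le hy
    have him : |y| ≤ ‖(x : ℂ) + y * I‖ := by simpa using abs_im_le_norm ((x : ℂ) + y * I)
    have hz : (x : ℂ) + y * I ≠ 0 := norm_pos_iff.mp (hypos.trans_le him)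
    have h := hC y hy
    rw [show ((x + 1 : ℝ) : ℂ) + y * I = x + y * I + 1 by push_cast; ring, Gamma_add_one _ hz,
      norm_mul, show x + 1 - 1 / 2 = x - 1 / 2 + 1 by ring, Real.rpow_add_one hypos.ne'] at h
    have h' := (mul_le_mul_of_nonneg_right him (norm_nonneg (Gamma (x + y * I)))).trans h
    refine le_of_mul_le_mul_left (h'.trans_eq ?_) hypos
    ring
  -- as `x > -2`, three unit shifts lead into the half-plane to the right of `1`
  apply step
  apply step
  apply step
  exact exists_norm_Gamma_le_of_one_lt (by linarith) hB

/-- Decay of `Γ` at rate `θ`, obtained by turning the ray of integration through the angle `θ`. -/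
theorem norm_Gamma_mul_exp_le {z : ℂ} {θ : ℝ} (hz : 0 < z.re) (hθ₀ : 0 ≤ θ)
    (hθ : θ < Real.pi / 2) :
    ‖Gamma z‖ * Real.exp (θ * |z.im|) ≤ (1 / Real.cos θ) ^ z.re * Real.Gamma z.re := by
  have hcos : 0 < Real.cos θ := Real.cos_pos_of_mem_Ioo ⟨by linarith [Real.pi_pos], hθ⟩
  have key : ∀ φ : ℝ, |φ| = θ → ‖Gamma z‖ * Real.exp (φ * z.im) ≤
      (1 / Real.cos θ) ^ z.re * Real.Gamma z.re := by
    intro φ hφ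
    have hcφ : Real.cos φ = Real.cos θ := by rw [← hφ, Real.cos_abs]
    have hre : (cexp (φ * I)).re = Real.cos θ := by rw [exp_ofReal_mul_I_re, hcφ]
    have h := integral_cpow_mul_exp_neg_complex_mul_Ioi (a := z) (r := cexp (φ * I)) hz
      (by rw [hre]; exact hcos)
    have hφ2 := abs_lt.mp (hφ.trans_lt hθ)
    have hpow : ‖cexp (φ * I) ^ (-z)‖ = Real.exp (φ * z.im) := by
      rw [cpow_def_of_ne_zero (exp_ne_zero _), Complex.log_exp
        (by simp; linarith [Real.pi_pos]) (by simp; linarith [Real.pi_pos]), norm_exp]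
      simp
    have hn := congrArg norm h
    rw [norm_mul, hpow] at hn
    rw [mul_comm, ← hn, ← Real.integral_rpow_mul_exp_neg_mul_Ioi hz hcos]
    refine (norm_integral_le_integral_norm _).trans_eq
      (setIntegral_congr_fun measurableSet_Ioi fun t ht => ?_)
    have ht' : 0 < t := ht
    simp only [norm_mul, norm_cpow_eq_rpow_re_of_pos ht', norm_exp]
    congr 2
    rw [neg_re, re_mul_ofReal, hre]
  rcases abs_cases z.im with h | h
  · rw [h.1]; exact key θ (abs_of_nonneg hθ₀)
  · rw [h.1, mul_neg, ← neg_mul]; exact key (-θ) (by rw [abs_neg, abs_of_nonneg hθ₀])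

/-- Exponential decay of the Gamma function, at any rate below `π / 2`, uniform in vertical
strips. -/
theorem exists_norm_Gamma_le_exp {a b B θ : ℝ} (ha : -2 < a) (hB : 0 < B) (hθ₀ : 0 ≤ θ)
    (hθ : θ < Real.pi / 2) :
    ∃ C, 0 ≤ C ∧ ∀ z : ℂ, a ≤ z.re → z.re ≤ b → B ≤ |z.im| →
      ‖Gamma z‖ ≤ C * Real.exp (-(θ * |z.im|)) := by
  have step : ∀ a b : ℝ, (∃ C, 0 ≤ C ∧ ∀ z : ℂ, a + 1 ≤ z.re → z.re ≤ b + 1 → B ≤ |z.im| →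
      ‖Gamma z‖ ≤ C * Real.exp (-(θ * |z.im|))) →
      ∃ C, 0 ≤ C ∧ ∀ z : ℂ, a ≤ z.re → z.re ≤ b → B ≤ |z.im| →
      ‖Gamma z‖ ≤ C * Real.exp (-(θ * |z.im|)) := by
    rintro a b ⟨C, hC0, hC⟩
    refine ⟨C / B, by positivity, fun z hza hzb hzB => ?_⟩
    have him : B ≤ ‖z‖ := hzB.trans (abs_im_le_norm z)
    have hz : z ≠ 0 := norm_pos_iff.mp (hB.trans_le him)
    have h := hC (z + 1) (by simpa using hza) (by simpa using hzb) (by simpa using hzB)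
    rw [Gamma_add_one _ hz, norm_mul, add_im, one_im, add_zero] at h
    have h' := (mul_le_mul_of_nonneg_right him (norm_nonneg (Gamma z))).trans h
    rw [div_mul_eq_mul_div, le_div_iff₀ hB]
    linarith
  apply step
  apply step
  have hcos : 0 < Real.cos θ := Real.cos_pos_of_mem_Ioo ⟨by linarith [Real.pi_pos], hθ⟩
  have hcont : ContinuousOn (fun x : ℝ => (1 / Real.cos θ) ^ x * Real.Gamma x)
      (Icc (a + 1 + 1) (b + 1 + 1)) := by
    intro x hx
    have hx0 : 0 < x := by linarith [hx.1]
    have h1 : ContinuousAt Real.Gamma x := (Real.differentiableAt_Gamma fun m => by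
      have : (0:ℝ) ≤ m := Nat.cast_nonneg m
      linarith).continuousAt
    exact ((Real.continuousAt_const_rpow (by positivity)).mul h1).continuousWithinAt
  obtain ⟨C, hC⟩ := isCompact_Icc.exists_bound_of_continuousOn hcont
  refine ⟨|C|, abs_nonneg _, fun z hza hzb _ => ?_⟩
  have h1 := norm_Gamma_mul_exp_le (z := z) (by linarith) hθ₀ hθ
  have h2 := (le_abs_self _).trans ((hC z.re ⟨hza, hzb⟩).trans (le_abs_self C))
  rw [Real.exp_neg, ← div_eq_mul_inv, le_div_iff₀ (Real.exp_pos _)]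
  exact h1.trans h2

end

/-! ### The path of integration -/

section

open Filter Topology Complex

/-- The path in closed form: the real part clamps a tent function, and the imaginary part is a sum
of three ramps. Both are visibly Lipschitz. -/
theorem pathL_eq {c₁ c₂ B : ℝ} (hc : c₁ < c₂) (hB : 0 < B) (t : ℝ) :
    pathL c₁ c₂ B t = ⟨max c₁ (min c₂ (c₂ + B - |t|)),
      min (t + (c₂ - c₁)) (-B) + max (-B) (min t B) + max (t - (c₂ - c₁)) B⟩ := by
  have hd : 0 < c₂ - c₁ := by linarith
  unfold pathL
  apply Complex.ext <;> simp only
  · rcases abs_cases t with h | h <;> rw [h.1] <;>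
    split_ifs <;> simp only [max_def, min_def] <;> split_ifs <;> linarith
  · split_ifs <;> simp only [max_def, min_def] <;> split_ifs <;> linarith

theorem pathL_re {c₁ c₂ B : ℝ} (t : ℝ) (hc : c₁ < c₂) (hB : 0 < B) :
    (pathL c₁ c₂ B t).re = max c₁ (min c₂ (c₂ + B - |t|)) := by rw [pathL_eq hc hB]

theorem pathL_im {c₁ c₂ B : ℝ} (t : ℝ) (hc : c₁ < c₂) (hB : 0 < B) :
    (pathL c₁ c₂ B t).im =
      min (t + (c₂ - c₁)) (-B) + max (-B) (min t B) + max (t - (c₂ - c₁)) B := by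
  rw [pathL_eq hc hB]

theorem pathL_re_mem {c₁ c₂ B : ℝ} (hc : c₁ < c₂) (hB : 0 < B) (t : ℝ) :
    (pathL c₁ c₂ B t).re ∈ Icc c₁ c₂ := by
  rw [pathL_re t hc hB]
  exact ⟨le_max_left _ _, max_le hc.le (min_le_left _ _)⟩

theorem lipschitzWith_pathL {c₁ c₂ B : ℝ} (hc : c₁ < c₂) (hB : 0 < B) :
    LipschitzWith 4 (pathL c₁ c₂ B) := by
  have hid : LipschitzWith 1 (fun t : ℝ => t) := LipschitzWith.id
  have habs : LipschitzWith 1 (fun t : ℝ => c₂ + B - |t|) := by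
    refine LipschitzWith.of_dist_le_mul fun x y => ?_
    simp only [Real.dist_eq, NNReal.coe_one, one_mul]
    rw [show c₂ + B - |x| - (c₂ + B - |y|) = -(|x| - |y|) by ring, abs_neg]
    exact abs_abs_sub_abs_le _ _
  have hadd : ∀ d : ℝ, LipschitzWith 1 (fun t : ℝ => t + d) := fun d => by
    refine LipschitzWith.of_dist_le_mul fun x y => ?_
    simp [Real.dist_eq]
  have hre : LipschitzWith 1 (fun t => (pathL c₁ c₂ B t).re) := by
    simp only [pathL_re _ hc hB]
    exact (habs.const_min _).const_max _
  have him : LipschitzWith 3 (fun t => (pathL c₁ c₂ B t).im) := by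
    simp only [pathL_im _ hc hB]
    have h1 := ((hadd (c₂ - c₁)).min_const (-B)).add ((hid.min_const B).const_max (-B))
    have h2 := h1.add ((hadd (-(c₂ - c₁))).max_const B)
    have e : (1 + 1 + 1 : NNReal) = 3 := by norm_num
    rw [e] at h2
    exact h2
  refine LipschitzWith.of_dist_le_mul fun x y => ?_
  have h1 := hre.dist_le_mul x y
  have h2 := him.dist_le_mul x y
  simp only [Real.dist_eq, NNReal.coe_one, one_mul, NNReal.coe_ofNat] at h1 h2
  have h3 := Complex.norm_le_abs_re_add_abs_im (pathL c₁ c₂ B x - pathL c₁ c₂ B y)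
  rw [sub_re, sub_im] at h3
  rw [dist_eq_norm, Real.dist_eq]
  simp only [NNReal.coe_ofNat]
  linarith

theorem continuous_pathL {c₁ c₂ B : ℝ} (hc : c₁ < c₂) (hB : 0 < B) :
    Continuous (pathL c₁ c₂ B) := (lipschitzWith_pathL hc hB).continuous

theorem norm_deriv_pathL_le {c₁ c₂ B : ℝ} (hc : c₁ < c₂) (hB : 0 < B) (t : ℝ) :
    ‖deriv (pathL c₁ c₂ B) t‖ ≤ 4 :=
  norm_deriv_le_of_lipschitz (lipschitzWith_pathL hc hB)

theorem abs_pathL_im_sub_le {c₁ c₂ B : ℝ} (hc : c₁ < c₂) (hB : 0 < B) (t : ℝ) :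
    |(pathL c₁ c₂ B t).im - t| ≤ c₂ - c₁ := by
  rw [pathL_im t hc hB, abs_le]
  constructor <;> simp only [max_def, min_def] <;> split_ifs <;> linarith

/-- Outside a bounded parameter interval the path runs on the half-lines. -/
theorem pathL_of_lt_abs {c₁ c₂ B : ℝ} (hc : c₁ < c₂) (hB : 0 < B)
    {t : ℝ} (ht : B + (c₂ - c₁) < |t|) :
    (pathL c₁ c₂ B t).re = c₁ ∧ B ≤ |(pathL c₁ c₂ B t).im| := by
  rw [pathL_im t hc hB, pathL_re t hc hB]
  refine ⟨max_eq_left ((min_le_right _ _).trans (by linarith)), ?_⟩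
  rcases lt_abs.mp ht with h | h
  · refine le_trans ?_ (le_abs_self _)
    simp only [max_def, min_def]; split_ifs <;> linarith
  · refine le_trans ?_ (neg_le_abs _)
    simp only [max_def, min_def]; split_ifs <;> linarith

/-- This is how the path avoids the poles of `Γ`, and how its translates avoid the pole of `ζ`. -/
theorem pathL_re_eq_or {c₁ c₂ B : ℝ} (hc : c₁ < c₂) (hB : 0 < B) (t : ℝ) :
    (pathL c₁ c₂ B t).re = c₂ ∨ B ≤ |(pathL c₁ c₂ B t).im| := by
  rcases le_or_gt |t| B with h | h
  · left
    rw [pathL_re t hc hB, min_eq_left (by linarith), max_eq_right hc.le]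
  · right
    rw [pathL_im t hc hB]
    rcases lt_abs.mp h with h | h
    · refine le_trans ?_ (le_abs_self _)
      simp only [max_def, min_def]; split_ifs <;> linarith
    · refine le_trans ?_ (neg_le_abs _)
      simp only [max_def, min_def]; split_ifs <;> linarith

theorem continuous_Gamma_pathL {c₁ c₂ B : ℝ} (hc : c₁ < c₂) (hB : 0 < B)
    (hc₂ : 0 < c₂) : Continuous fun t => Gamma (pathL c₁ c₂ B t) := by
  refine continuous_iff_continuousAt.mpr fun t => ?_
  refine ContinuousAt.comp (f := pathL c₁ c₂ B) (g := Gamma)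
    (differentiableAt_Gamma _ fun m hm => ?_).continuousAt (continuous_pathL hc hB).continuousAt
  have hm0 : (0 : ℝ) ≤ m := Nat.cast_nonneg m
  rcases pathL_re_eq_or hc hB t with h | h <;> rw [hm] at h
  · simp at h; linarith
  · simp at h; linarith

/-- A bound valid near infinity extends to the line, up to the constant. -/
theorem exists_norm_le_of_far {f : ℝ → ℂ} {g : ℝ → ℝ} {R C : ℝ} (hf : Continuous f)
    (hg : Continuous g) (hg0 : ∀ t, 0 < g t) (h : ∀ t, R < |t| → ‖f t‖ ≤ C * g t) :
    ∃ C', 0 ≤ C' ∧ ∀ t, ‖f t‖ ≤ C' * g t := by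
  obtain ⟨D, hD⟩ := (isCompact_Icc (a := -R) (b := R)).exists_bound_of_continuousOn
    (f := fun t => ‖f t‖ / g t) ((hf.norm.div hg fun t => (hg0 t).ne').continuousOn)
  refine ⟨max |C| |D|, by positivity, fun t => ?_⟩
  have hgt := hg0 t
  rcases lt_or_ge R |t| with ht | ht
  · refine (h t ht).trans ?_
    gcongr
    exact (le_abs_self C).trans (le_max_left _ _)
  · have h1 := (le_abs_self _).trans ((hD t (abs_le.mp ht)).trans (le_abs_self D))
    rw [div_le_iff₀ hgt] at h1
    refine h1.trans ?_
    gcongr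
    exact le_max_right _ _

theorem integrable_exp_neg_mul_abs {δ : ℝ} (hδ : 0 < δ) :
    Integrable fun t : ℝ => Real.exp (-(δ * |t|)) := by
  rw [← integrableOn_univ, ← Iic_union_Ioi (a := (0 : ℝ))]
  refine IntegrableOn.union ?_ ?_
  · refine (integrableOn_exp_mul_Iic hδ 0).congr_fun (fun t ht => ?_) measurableSet_Iic
    simp [abs_of_nonpos (mem_Iic.mp ht)]
  · refine (exp_neg_integrableOn_Ioi 0 hδ).congr_fun (fun t ht => ?_) measurableSet_Ioi
    simp [abs_of_pos (mem_Ioi.mp ht)]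

end

/-! ### The exponential as a contour integral of the Gamma function -/

section

open Filter Topology Complex

/-- A parameter interval on which the path is affine contributes the integral over a segment. -/
theorem integral_pathL_piece {c₁ c₂ B a b : ℝ} (hab : a ≤ b) (f : ℂ → ℂ) (p v : ℂ)
    (h : ∀ t ∈ Ioo a b, pathL c₁ c₂ B t = p + t * v) :
    ∫ t in a..b, f (pathL c₁ c₂ B t) * deriv (pathL c₁ c₂ B) t =
      ∫ t in a..b, f (p + t * v) * v := by
  refine intervalIntegral.integral_congr_Ioo_of_le hab fun t ht => ?_
  have hd : HasDerivAt (pathL c₁ c₂ B) v t := by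
    have h1 : HasDerivAt (fun t : ℝ => p + t * v) v t := by
      simpa using ((hasDerivAt_id t).ofReal_comp.mul_const v).const_add p
    refine h1.congr_of_eventuallyEq ?_
    filter_upwards [isOpen_Ioo.mem_nhds ht] with u hu using h u hu
  simp only [h t ht, hd.deriv]

/-- The half-lines of the path `L(c, B)` may be moved to the abscissa `c₂` when the integrand is
holomorphic between the two abscissae and decays exponentially. -/
theorem integral_pathL_eq_vertical {c₁ c₂ B C δ : ℝ} (hc : c₁ < c₂) (hB : 0 < B) (hδ : 0 < δ)
    {f : ℂ → ℂ}
    (hf : ∀ z : ℂ, z.re ∈ Icc c₁ c₂ → B ≤ |z.im| → DifferentiableAt ℂ f z)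
    (hdecay : ∀ z : ℂ, z.re ∈ Icc c₁ c₂ → B ≤ |z.im| → ‖f z‖ ≤ C * Real.exp (-(δ * |z.im|)))
    (h₁ : Integrable fun t => f (pathL c₁ c₂ B t) * deriv (pathL c₁ c₂ B) t)
    (h₂ : Integrable fun y : ℝ => f (c₂ + y * I)) :
    ∫ t, f (pathL c₁ c₂ B t) * deriv (pathL c₁ c₂ B) t = I * ∫ y : ℝ, f (c₂ + y * I) := by
  set d := c₂ - c₁ with hd
  have hd0 : 0 < d := by linarith
  let err : ℝ → ℂ := fun S => (∫ x in c₁..c₂, f (x + (-S : ℝ) * I)) - ∫ x in c₁..c₂, f (x + S * I)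
  have hcut : ∀ S : ℝ, B < S → ∫ t in (-(S + d))..(S + d), f (pathL c₁ c₂ B t) *
      deriv (pathL c₁ c₂ B) t = I * (∫ y in (-S)..S, f (c₂ + y * I)) + err S := by
    intro S hS
    have hii : ∀ a b, IntervalIntegrable (fun t => f (pathL c₁ c₂ B t) *
      deriv (pathL c₁ c₂ B) t) volume a b := fun a b => h₁.intervalIntegrable
    have hii₂ : ∀ a b, IntervalIntegrable (fun y : ℝ => f (c₂ + y * I)) volume a b :=
      fun a b => h₂.intervalIntegrable
    -- the lower half-line, the three segments and the upper half-line, cut off at height `S`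
    have e1 : ∫ t in (-(S + d))..(-B - d), f (pathL c₁ c₂ B t) * deriv (pathL c₁ c₂ B) t =
        I * ∫ y in (-S)..(-B), f (c₁ + y * I) := by
      rw [integral_pathL_piece (by linarith) f (c₁ + d * I) I, intervalIntegral.integral_mul_const,
        mul_comm]
      · congr 1
        have := intervalIntegral.integral_comp_add_right (a := -(S + d)) (b := -B - d)
          (fun y : ℝ => f (c₁ + y * I)) d
        rw [show -(S + d) + d = -S by ring, show -B - d + d = -B by ring] at this
        rw [← this]
        refine intervalIntegral.integral_congr fun t _ => ?_
        congr 1; push_cast; ring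
      · intro t ht
        rw [pathL, if_pos (by linarith [ht.2])]
        apply Complex.ext <;> simp; ring
    have e2 : ∫ t in (-B - d)..(-B), f (pathL c₁ c₂ B t) * deriv (pathL c₁ c₂ B) t =
        ∫ x in c₁..c₂, f (x + (-B : ℝ) * I) := by
      rw [integral_pathL_piece (by linarith) f (c₂ + B + (-B : ℝ) * I) 1]
      · have := intervalIntegral.integral_comp_add_right (a := -B - d) (b := -B)
          (fun x : ℝ => f (x + (-B : ℝ) * I)) (c₂ + B)
        rw [show -B - d + (c₂ + B) = c₁ by rw [hd]; ring, show -B + (c₂ + B) = c₂ by ring] at this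
        rw [← this]
        refine intervalIntegral.integral_congr fun t _ => ?_
        simp only [mul_one]; congr 1; push_cast; ring
      · intro t ht
        rw [pathL, if_neg (by linarith [ht.1]), if_pos ht.2.le]
        apply Complex.ext <;> simp; ring
    have e3 : ∫ t in (-B)..B, f (pathL c₁ c₂ B t) * deriv (pathL c₁ c₂ B) t =
        I * ∫ y in (-B)..B, f (c₂ + y * I) := by
      rw [integral_pathL_piece (by linarith) f c₂ I, intervalIntegral.integral_mul_const, mul_comm]
      intro t ht
      rw [pathL, if_neg (by linarith [ht.1]), if_neg (by linarith [ht.1]), if_pos ht.2.le]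
      apply Complex.ext <;> simp
    have e4 : ∫ t in B..(B + d), f (pathL c₁ c₂ B t) * deriv (pathL c₁ c₂ B) t =
        - ∫ x in c₁..c₂, f (x + B * I) := by
      rw [integral_pathL_piece (by linarith) f (c₂ + B + B * I) (-1)]
      · have := intervalIntegral.integral_comp_sub_left (a := B) (b := B + d)
          (fun x : ℝ => f (x + B * I)) (c₂ + B)
        rw [show c₂ + B - (B + d) = c₁ by rw [hd]; ring, show c₂ + B - B = c₂ by ring] at this
        rw [← this, ← intervalIntegral.integral_neg]
        refine intervalIntegral.integral_congr fun t _ => ?_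
        simp only [mul_neg, mul_one]; congr 2; push_cast; ring
      · intro t ht
        rw [pathL, if_neg (by linarith [ht.1]), if_neg (by linarith [ht.1]),
          if_neg (by linarith [ht.1]), if_pos (by linarith [ht.2])]
        apply Complex.ext <;> simp; ring
    have e5 : ∫ t in (B + d)..(S + d), f (pathL c₁ c₂ B t) * deriv (pathL c₁ c₂ B) t =
        I * ∫ y in B..S, f (c₁ + y * I) := by
      rw [integral_pathL_piece (by linarith) f (c₁ - d * I) I, intervalIntegral.integral_mul_const,
        mul_comm]
      · congr 1
        have := intervalIntegral.integral_comp_sub_right (a := B + d) (b := S + d)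
          (fun y : ℝ => f (c₁ + y * I)) d
        rw [show B + d - d = B by ring, show S + d - d = S by ring] at this
        rw [← this]
        refine intervalIntegral.integral_congr fun t _ => ?_
        congr 1; push_cast; ring
      · intro t ht
        rw [pathL, if_neg (by linarith [ht.1]), if_neg (by linarith [ht.1]),
          if_neg (by linarith [ht.1]), if_neg (by linarith [ht.1])]
        apply Complex.ext <;> simp; ring
    -- Cauchy's theorem above and below
    have r1 := integral_boundary_rect_eq_zero_of_differentiableOn f ⟨c₁, B⟩ ⟨c₂, S⟩ (by
      intro z hz
      rw [mem_reProdIm, uIcc_of_le hc.le, uIcc_of_le hS.le] at hz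
      exact (hf z hz.1 (hz.2.1.trans (le_abs_self _))).differentiableWithinAt)
    have r2 := integral_boundary_rect_eq_zero_of_differentiableOn f ⟨c₁, -S⟩ ⟨c₂, -B⟩ (by
      intro z hz
      rw [mem_reProdIm, uIcc_of_le hc.le, uIcc_of_le (by simp; exact hS.le)] at hz
      exact (hf z hz.1 ((le_neg_of_le_neg hz.2.2).trans (neg_le_abs _))).differentiableWithinAt)
    simp only [smul_eq_mul] at r1 r2
    rw [← intervalIntegral.integral_add_adjacent_intervals (hii _ (-B - d)) (hii _ _),
      ← intervalIntegral.integral_add_adjacent_intervals (hii (-B - d) (-B)) (hii _ _),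
      ← intervalIntegral.integral_add_adjacent_intervals (hii (-B) B) (hii _ _),
      ← intervalIntegral.integral_add_adjacent_intervals (hii B (B + d)) (hii _ _),
      e1, e2, e3, e4, e5,
      ← intervalIntegral.integral_add_adjacent_intervals (hii₂ (-S) (-B)) (hii₂ (-B) S),
      ← intervalIntegral.integral_add_adjacent_intervals (hii₂ (-B) B) (hii₂ B S)]
    simp only [err]
    linear_combination -r1 - r2
  have herr : Tendsto err atTop (𝓝 0) := by
    have hbd : ∀ᶠ S in atTop, ‖err S‖ ≤ 2 * (C * Real.exp (-(δ * S)) * |c₂ - c₁|) := by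
      filter_upwards [eventually_gt_atTop B] with S hS
      have hS0 : 0 < S := hB.trans hS
      have hb : ∀ s : ℝ, |s| = S → ‖∫ x in c₁..c₂, f (x + s * I)‖ ≤
          C * Real.exp (-(δ * S)) * |c₂ - c₁| := by
        intro s hs
        refine intervalIntegral.norm_integral_le_of_norm_le_const fun x hx => ?_
        rw [uIoc_of_le hc.le] at hx
        have := hdecay (x + s * I) (by simpa using ⟨hx.1.le, hx.2⟩) (by simp [hs, hS.le])
        simpa [hs] using this
      have h1 := hb (-S) (by rw [abs_neg, abs_of_pos hS0])
      have h2 := hb S (abs_of_pos hS0)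
      refine (norm_sub_le _ _).trans ?_
      linarith
    refine squeeze_zero_norm' hbd ?_
    have h1 : Tendsto (fun S : ℝ => Real.exp (-(δ * S))) atTop (𝓝 0) :=
      Real.tendsto_exp_neg_atTop_nhds_zero.comp (tendsto_id.const_mul_atTop hδ)
    have := ((h1.const_mul C).mul_const |c₂ - c₁|).const_mul 2
    simpa using this
  have l1 : Tendsto (fun S : ℝ => ∫ t in (-(S + d))..(S + d), f (pathL c₁ c₂ B t) *
      deriv (pathL c₁ c₂ B) t) atTop (𝓝 (∫ t, f (pathL c₁ c₂ B t) * deriv (pathL c₁ c₂ B) t)) :=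
    intervalIntegral_tendsto_integral h₁
      (tendsto_neg_atTop_atBot.comp (tendsto_atTop_add_const_right _ _ tendsto_id))
      (tendsto_atTop_add_const_right _ _ tendsto_id)
  have l2 : Tendsto (fun S : ℝ => I * (∫ y in (-S)..S, f (c₂ + y * I)) + err S) atTop
      (𝓝 (I * (∫ y : ℝ, f (c₂ + y * I)) + 0)) :=
    ((intervalIntegral_tendsto_integral h₂ tendsto_neg_atTop_atBot tendsto_id).const_mul I).add herr
  rw [add_zero] at l2
  refine tendsto_nhds_unique l1 (l2.congr' ?_)
  filter_upwards [eventually_gt_atTop B] with S hS using (hcut S hS).symm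

theorem rpow_le_rpow_add_rpow {t a b x : ℝ} (ht : 0 < t) (hax : a ≤ x) (hxb : x ≤ b) :
    t ^ x ≤ t ^ a + t ^ b := by
  rcases le_total 1 t with h | h
  · exact (Real.rpow_le_rpow_of_exponent_le h hxb).trans
      (le_add_of_nonneg_left (Real.rpow_nonneg ht.le _))
  · exact (Real.rpow_le_rpow_of_exponent_ge ht h hax).trans
      (le_add_of_nonneg_right (Real.rpow_nonneg ht.le _))

theorem exists_norm_Gamma_mul_cpow_le {a b B : ℝ} {r : ℂ} (ha : -2 < a) (hB : 0 < B)
    (hr : 0 < r.re) :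
    ∃ C δ, 0 ≤ C ∧ 0 < δ ∧ ∀ z : ℂ, z.re ∈ Icc a b → B ≤ |z.im| →
      ‖Gamma z * r ^ (-z)‖ ≤ C * Real.exp (-(δ * |z.im|)) := by
  have harg : |arg r| < Real.pi / 2 := abs_arg_lt_pi_div_two_iff.mpr (Or.inl hr)
  have hr0 : r ≠ 0 := by rintro rfl; simp at hr
  obtain ⟨C, hC0, hC⟩ := exists_norm_Gamma_le_exp (b := b) (θ := (|arg r| + Real.pi / 2) / 2) ha hB
    (by have := Real.pi_pos; positivity) (by linarith)
  have hn := norm_pos_iff.mpr hr0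
  refine ⟨C * (‖r‖ ^ (-b) + ‖r‖ ^ (-a)), (Real.pi / 2 - |arg r|) / 2, by positivity, by linarith,
    fun z hz hzB => ?_⟩
  rw [norm_mul, norm_cpow_of_ne_zero hr0]
  have h1 : ‖r‖ ^ (-z).re ≤ ‖r‖ ^ (-b) + ‖r‖ ^ (-a) :=
    rpow_le_rpow_add_rpow hn (by simpa using hz.2) (by simpa using hz.1)
  have h2 : Real.exp (-(arg r * (-z).im)) ≤ Real.exp (|arg r| * |z.im|) := by
    rw [neg_im, mul_neg, neg_neg, ← abs_mul]
    exact Real.exp_le_exp.mpr (le_abs_self _)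
  rw [div_eq_mul_inv, ← Real.exp_neg]
  calc _ ≤ (C * Real.exp (-((|arg r| + Real.pi / 2) / 2 * |z.im|))) *
        ((‖r‖ ^ (-b) + ‖r‖ ^ (-a)) * Real.exp (|arg r| * |z.im|)) := by
        gcongr
        exact hC z hz.1 hz.2 hzB
    _ = C * (‖r‖ ^ (-b) + ‖r‖ ^ (-a)) * (Real.exp (-((|arg r| + Real.pi / 2) / 2 * |z.im|)) *
        Real.exp (|arg r| * |z.im|)) := by ring
    _ = _ := by rw [← Real.exp_add]; congr 2; ring

theorem integrable_Gamma_mul_cpow_vertical {c₂ : ℝ} {r : ℂ} (hc₂ : 0 < c₂) (hr : 0 < r.re) :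
    Integrable fun y : ℝ => Gamma (c₂ + y * I) * r ^ (-(c₂ + y * I)) := by
  have hr0 : r ≠ 0 := by rintro rfl; simp at hr
  obtain ⟨C, δ, hC0, hδ, hC⟩ := exists_norm_Gamma_mul_cpow_le (a := c₂) (b := c₂) (B := 1)
    (by linarith) one_pos hr
  have hcont : Continuous fun y : ℝ => Gamma (c₂ + y * I) * r ^ (-(c₂ + y * I)) := by
    refine Continuous.mul (continuous_iff_continuousAt.mpr fun y => ?_) ?_
    · refine ContinuousAt.comp (f := fun y : ℝ => (c₂ : ℂ) + y * I) (g := Gamma)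
        (differentiableAt_Gamma _ fun m hm => ?_).continuousAt (by fun_prop)
      have := congrArg re hm
      have hm0 : (0 : ℝ) ≤ m := Nat.cast_nonneg m
      simp at this
      linarith
    · exact Continuous.const_cpow (by fun_prop) (Or.inl hr0)
  obtain ⟨C', hC'0, hC'⟩ := exists_norm_le_of_far (R := 1) (C := C) hcont
    (g := fun y => Real.exp (-(δ * |y|))) (by fun_prop) (fun t => Real.exp_pos _) fun y hy => by
      simpa using hC (c₂ + y * I) (by simp) (by simpa using hy.le)
  exact ((integrable_exp_neg_mul_abs hδ).const_mul C').mono' hcont.aestronglyMeasurable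
    (Eventually.of_forall hC')

theorem integrable_Gamma_mul_cpow_pathL {c₁ c₂ B : ℝ} {r : ℂ} (hc₁ : -2 < c₁) (hc : c₁ < c₂)
    (hc₂ : 0 < c₂) (hB : 0 < B) (hr : 0 < r.re) :
    Integrable fun t => Gamma (pathL c₁ c₂ B t) * r ^ (-pathL c₁ c₂ B t) := by
  have hr0 : r ≠ 0 := by rintro rfl; simp at hr
  obtain ⟨C, δ, hC0, hδ, hC⟩ := exists_norm_Gamma_mul_cpow_le (b := c₂) hc₁ hB hr
  have hcont : Continuous fun t => Gamma (pathL c₁ c₂ B t) * r ^ (-pathL c₁ c₂ B t) :=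
    (continuous_Gamma_pathL hc hB hc₂).mul
      (Continuous.const_cpow (continuous_pathL hc hB).neg (Or.inl hr0))
  obtain ⟨C', hC'0, hC'⟩ := exists_norm_le_of_far (R := B + (c₂ - c₁))
    (C := C * Real.exp (δ * (c₂ - c₁))) hcont
    (g := fun y => Real.exp (-(δ * |y|))) (by fun_prop) (fun t => Real.exp_pos _) fun t ht => by
      have h1 := hC _ (pathL_re_mem hc hB t) (pathL_of_lt_abs hc hB ht).2
      refine h1.trans ?_
      rw [mul_assoc, ← Real.exp_add]
      gcongr
      have h2 := abs_pathL_im_sub_le hc hB t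
      have h3 : |t| ≤ |(pathL c₁ c₂ B t).im| + (c₂ - c₁) := by
        have := abs_sub_abs_le_abs_sub t (pathL c₁ c₂ B t).im
        rw [abs_sub_comm] at this
        linarith
      nlinarith
  exact ((integrable_exp_neg_mul_abs hδ).const_mul C').mono' hcont.aestronglyMeasurable
    (Eventually.of_forall hC')

theorem Integrable.mul_deriv_pathL {c₁ c₂ B : ℝ} (hc : c₁ < c₂) (hB : 0 < B) {f : ℝ → ℂ}
    (hf : Integrable f) : Integrable fun t => f t * deriv (pathL c₁ c₂ B) t :=
  hf.mul_bdd (c := 4) (measurable_deriv _).aestronglyMeasurable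
    (Eventually.of_forall (norm_deriv_pathL_le hc hB))

/-- The exponential as a contour integral of the Gamma function along `L(c, B)`. -/
theorem contourL_Gamma_mul_cpow {c₁ c₂ B : ℝ} {r : ℂ} (hc₁ : -2 < c₁) (hc : c₁ < c₂)
    (hc₂ : 0 < c₂) (hB : 0 < B) (hr : 0 < r.re) :
    contourL c₁ c₂ B (fun z => Gamma z * r ^ (-z)) = cexp (-r) := by
  have hr0 : r ≠ 0 := by rintro rfl; simp at hr
  obtain ⟨C, δ, hC0, hδ, hC⟩ := exists_norm_Gamma_mul_cpow_le (b := c₂) hc₁ hB hr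
  have hmel : ∀ z : ℂ, 0 < z.re → mellin (fun t : ℝ => cexp (-(r * t))) z = Gamma z * r ^ (-z) := by
    intro z hz
    rw [mellin, mul_comm, ← integral_cpow_mul_exp_neg_complex_mul_Ioi hz hr]
    rfl
  have hvert := integrable_Gamma_mul_cpow_vertical hc₂ hr
  have hinv := mellinInv_mellin_eq c₂ (fun t : ℝ => cexp (-(r * t))) one_pos ?_ ?_ ?_
  · rw [contourL, integral_pathL_eq_vertical hc hB hδ ?_ hC
      (Integrable.mul_deriv_pathL hc hB (integrable_Gamma_mul_cpow_pathL hc₁ hc hc₂ hB hr)) hvert]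
    · rw [mellinInv] at hinv
      simp only [ofReal_one, one_cpow, one_smul, mul_one] at hinv
      rw [← hinv]
      have : ∫ y : ℝ, mellin (fun t : ℝ => cexp (-(r * t))) (c₂ + y * I) =
          ∫ y : ℝ, Gamma (c₂ + y * I) * r ^ (-(c₂ + y * I)) :=
        integral_congr_ae (Eventually.of_forall fun y => hmel _ (by simpa using hc₂))
      rw [this, real_smul]
      have := Real.pi_ne_zero
      push_cast
      field_simp [I_ne_zero]
    · intro z _ hzB
      refine (differentiableAt_Gamma _ fun m hm => ?_).mul
        (differentiableAt_id.neg.const_cpow (Or.inl hr0))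
      rw [hm] at hzB
      simp at hzB
      linarith
  · -- convergence of the Mellin integral
    have hcont : Continuous fun t : ℝ => cexp (-(r * t)) := by fun_prop
    refine mellinConvergent_of_isBigO_rpow_exp (a := r.re) (b := 0) hr
      (hcont.locallyIntegrable.locallyIntegrableOn _) ?_ ?_ (by simpa using hc₂)
    · refine Asymptotics.isBigO_of_le _ fun t => ?_
      rw [norm_exp, Real.norm_eq_abs, abs_of_pos (Real.exp_pos _)]
      simp
    · simp only [neg_zero, Real.rpow_zero]
      exact (hcont.tendsto 0).isBigO_one ℝ |>.mono nhdsWithin_le_nhds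
  · refine hvert.congr (Eventually.of_forall fun y => ?_)
    exact (hmel _ (by simpa using hc₂)).symm
  · fun_prop

end

/-! ### Decay of Fourier integrals of compactly supported smooth functions -/

section

open Filter Topology

/-- A function supported in `[-1, 1]` that is absolutely continuous together with its first two
derivatives, and whose third derivative agrees almost everywhere with a difference of monotone
functions on an interval that leaves room for translations by at most `1`. -/
structure IsCompactSmooth (F : ℝ → ℝ) : Prop where
  ac : ∀ a b, AbsolutelyContinuousOnInterval F a b
  ac_deriv : ∀ a b, AbsolutelyContinuousOnInterval (deriv F) a b
  ac_deriv_deriv : ∀ a b, AbsolutelyContinuousOnInterval (deriv (deriv F)) a b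
  zero : ∀ x, 1 < |x| → F x = 0
  bv : ∃ p q : ℝ → ℝ, MonotoneOn p (Icc (-3) 4) ∧ MonotoneOn q (Icc (-3) 4) ∧
    deriv (deriv (deriv F)) =ᵐ[volume] p - q

theorem deriv_eq_zero_of_one_lt_abs {F : ℝ → ℝ} (h : ∀ x, 1 < |x| → F x = 0) :
    ∀ x, 1 < |x| → deriv F x = 0 := by
  intro x hx
  have : F =ᶠ[𝓝 x] fun _ => 0 := by
    filter_upwards [(isOpen_lt continuous_const continuous_abs).mem_nhds hx] with y hy using h y hy
  rw [this.deriv_eq, deriv_const]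

theorem continuous_of_ac {F : ℝ → ℝ} (h : ∀ a b, AbsolutelyContinuousOnInterval F a b) :
    Continuous F := by
  refine continuous_iff_continuousAt.mpr fun x => ?_
  refine (h (x - 1) (x + 1)).continuousOn.continuousAt ?_
  rw [uIcc_of_le (by linarith)]
  exact Icc_mem_nhds (by linarith) (by linarith)

theorem support_subset_of_zero {F : ℝ → ℝ} (h : ∀ x, 1 < |x| → F x = 0) :
    Function.support F ⊆ Ioc (-2) 2 := by
  intro x hx
  have : |x| ≤ 1 := not_lt.mp fun hlt => hx (h x hlt)
  rw [abs_le] at this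
  exact ⟨by linarith, by linarith⟩

theorem integrable_of_zero {F : ℝ → ℝ} (h : ∀ x, 1 < |x| → F x = 0)
    (hF : IntervalIntegrable F volume (-2) 2) : Integrable F := by
  rw [intervalIntegrable_iff_integrableOn_Ioc_of_le (by norm_num)] at hF
  exact (integrableOn_iff_integrable_of_support_subset (support_subset_of_zero h)).mp hF

/-- Integration by parts; the free phase turns the resulting sine back into a cosine. -/
theorem integral_mul_cos_eq_deriv {F : ℝ → ℝ} (hF : AbsolutelyContinuousOnInterval F (-2) 2)
    (h₁ : F (-2) = 0) (h₂ : F 2 = 0) {t : ℝ} (ht : t ≠ 0) (α : ℝ) :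
    ∫ ν in (-2)..2, F ν * Real.cos (t * ν + α) =
      (1 / t) * ∫ ν in (-2)..2, deriv F ν * Real.cos (t * ν + (α + Real.pi / 2)) := by
  have hd : ∀ ν : ℝ, HasDerivAt (fun ν => Real.sin (t * ν + α) / t) (Real.cos (t * ν + α)) ν := by
    intro ν
    have h1 : HasDerivAt (fun ν => t * ν + α) t ν := by
      simpa using ((hasDerivAt_id ν).const_mul t).add_const α
    have := (h1.sin).div_const t
    simpa [ht] using this
  have hg : AbsolutelyContinuousOnInterval (fun ν => Real.sin (t * ν + α) / t) (-2) 2 :=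
    ContDiffOn.absolutelyContinuousOnInterval (by fun_prop)
  have := hF.integral_mul_deriv_eq_deriv_mul hg
  rw [funext fun ν => (hd ν).deriv, h₁, h₂] at this
  rw [this, ← intervalIntegral.integral_const_mul]
  simp only [zero_mul, sub_self, zero_sub]
  rw [← intervalIntegral.integral_neg]
  refine intervalIntegral.integral_congr fun ν _ => ?_
  rw [← add_assoc, Real.cos_add_pi_div_two]
  field_simp

/-- A monotone function is Lipschitz in mean under translation, as the integral of the increments
telescopes. -/
theorem integral_monotone_translate_le {p : ℝ → ℝ} (hp : MonotoneOn p (Icc (-3) 4)) {h : ℝ}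
    (h₀ : 0 < h) (h₁ : h ≤ 1) :
    IntervalIntegrable (fun x => p (x + h) - p x) volume (-3) 3 ∧
    ∫ x in (-3)..3, (p (x + h) - p x) ≤ (p 4 - p (-3)) * h := by
  have hint : ∀ a b, -3 ≤ a → a ≤ b → b ≤ 4 → IntervalIntegrable p volume a b := by
    intro a b ha hab hb
    refine (hp.mono ?_).intervalIntegrable
    rw [uIcc_of_le hab]
    exact Icc_subset_Icc ha hb
  have i1 : IntervalIntegrable (fun x => p (x + h)) volume (-3) 3 := by
    have := (hint (-3 + h) (3 + h) (by linarith) (by linarith) (by linarith)).comp_add_right h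
    simpa using this
  have i2 := hint (-3) 3 le_rfl (by norm_num) (by norm_num)
  refine ⟨i1.sub i2, ?_⟩
  rw [intervalIntegral.integral_sub i1 i2, intervalIntegral.integral_comp_add_right]
  have s1 := intervalIntegral.integral_add_adjacent_intervals
    (hint (-3 + h) 3 (by linarith) (by linarith) (by linarith))
    (hint 3 (3 + h) (by linarith) (by linarith) (by linarith))
  have s2 := intervalIntegral.integral_add_adjacent_intervals
    (hint (-3) (-3 + h) (by linarith) (by linarith) (by linarith))
    (hint (-3 + h) 3 (by linarith) (by linarith) (by linarith))
  have u1 : ∫ x in (3 : ℝ)..(3 + h), p x ≤ p 4 * h := by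
    have := intervalIntegral.integral_mono_on (by linarith)
      (hint 3 (3 + h) (by linarith) (by linarith) (by linarith))
      (intervalIntegrable_const (c := p 4)) fun x hx =>
        hp ⟨by linarith [hx.1], by linarith [hx.2]⟩ ⟨by norm_num, le_rfl⟩ (by linarith [hx.2])
    simp only [intervalIntegral.integral_const, smul_eq_mul] at this
    linarith
  have u2 : p (-3) * h ≤ ∫ x in (-3 : ℝ)..(-3 + h), p x := by
    have := intervalIntegral.integral_mono_on (by linarith)
      (intervalIntegrable_const (c := p (-3)))
      (hint (-3) (-3 + h) (by linarith) (by linarith) (by linarith)) fun x hx =>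
        hp ⟨le_rfl, by norm_num⟩ ⟨by linarith [hx.1], by linarith [hx.2]⟩ (by linarith [hx.1])
    simp only [intervalIntegral.integral_const, smul_eq_mul] at this
    linarith
  linarith

/-- A compactly supported function of bounded variation is Lipschitz in mean under translation. -/
theorem exists_integral_abs_translate_sub_le {φ p q : ℝ → ℝ} (hφ : ∀ x, 1 < |x| → φ x = 0)
    (hp : MonotoneOn p (Icc (-3) 4)) (hq : MonotoneOn q (Icc (-3) 4))
    (hφg : φ =ᵐ[volume] p - q) :
    ∃ C, ∀ h, 0 < h → h ≤ 1 → ∫ x, |φ (x + h) - φ x| ≤ C * h := by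
  refine ⟨(p 4 - p (-3)) + (q 4 - q (-3)), fun h h₀ h₁ => ?_⟩
  obtain ⟨ip, bp⟩ := integral_monotone_translate_le hp h₀ h₁
  obtain ⟨iq, bq⟩ := integral_monotone_translate_le hq h₀ h₁
  have hsupp : Function.support (fun x => |φ (x + h) - φ x|) ⊆ Ioc (-3) 3 := by
    intro x hx
    by_contra hcon
    refine hx ?_
    have h1 : 1 < |x| := by
      rw [mem_Ioc, not_and_or, not_lt, not_le] at hcon
      rcases hcon with h | h
      · exact lt_abs.mpr (Or.inr (by linarith))
      · exact lt_abs.mpr (Or.inl (by linarith))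
    have h2 : 1 < |x + h| := by
      rw [mem_Ioc, not_and_or, not_lt, not_le] at hcon
      rcases hcon with h | h
      · exact lt_abs.mpr (Or.inr (by linarith))
      · exact lt_abs.mpr (Or.inl (by linarith))
    simp [hφ _ h1, hφ _ h2]
  rw [← intervalIntegral.integral_eq_integral_of_support_subset hsupp, add_mul]
  refine le_trans ?_ (add_le_add bp bq)
  rw [← intervalIntegral.integral_add ip iq, intervalIntegral.integral_of_le (by norm_num),
    intervalIntegral.integral_of_le (by norm_num)]
  have htr : ∀ᵐ x : ℝ, φ (x + h) = (p - q) (x + h) :=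
    (measurePreserving_add_right volume h).quasiMeasurePreserving.ae hφg
  refine integral_mono_of_nonneg (Eventually.of_forall fun x => abs_nonneg _)
    (by
      rw [intervalIntegrable_iff_integrableOn_Ioc_of_le (by norm_num)] at ip iq
      exact ip.add iq) ?_
  filter_upwards [ae_restrict_of_ae htr, ae_restrict_of_ae hφg,
    ae_restrict_mem measurableSet_Ioc] with x hx1 hx2 hx3
  rw [hx1, hx2]
  have m1 : x ∈ Icc (-3 : ℝ) 4 := ⟨hx3.1.le, by linarith [hx3.2]⟩
  have m2 : x + h ∈ Icc (-3 : ℝ) 4 := ⟨by linarith [hx3.1], by linarith [hx3.2]⟩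
  have := hp m1 m2 (by linarith)
  have := hq m1 m2 (by linarith)
  simp only [Pi.sub_apply]
  rw [abs_le]
  constructor <;> linarith

/-- The half-period trick: a function that is Lipschitz in mean has a Fourier transform `O(1/t)`. -/
theorem abs_integral_mul_cos_le_of_translate {φ : ℝ → ℝ} (hφ : Integrable φ) {C t : ℝ} (ht : 0 < t)
    (h : ∫ x, |φ (x + Real.pi / t) - φ x| ≤ C * (Real.pi / t)) (β : ℝ) :
    |∫ ν, φ ν * Real.cos (t * ν + β)| ≤ C * Real.pi / t := by
  have hcos : ∀ γ : ℝ, AEStronglyMeasurable (fun ν => Real.cos (t * ν + γ)) volume := fun γ =>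
    Continuous.aestronglyMeasurable (by fun_prop)
  have hi : ∀ ψ : ℝ → ℝ, Integrable ψ → Integrable (fun ν => ψ ν * Real.cos (t * ν + β)) :=
    fun ψ hψ => hψ.mul_bdd (c := 1) (hcos β) (Eventually.of_forall fun ν => Real.abs_cos_le_one _)
  have htrans : Integrable (fun x => φ (x + Real.pi / t)) := hφ.comp_add_right _
  have e1 : ∫ ν, φ (ν + Real.pi / t) * Real.cos (t * ν + β) =
      -∫ ν, φ ν * Real.cos (t * ν + β) := by
    rw [← integral_add_right_eq_self (fun ν => φ ν * Real.cos (t * ν + β)) (Real.pi / t),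
      ← integral_neg]
    refine integral_congr_ae (Eventually.of_forall fun ν => ?_)
    simp only
    rw [show t * (ν + Real.pi / t) + β = t * ν + β + Real.pi by field_simp; ring, Real.cos_add_pi]
    ring
  have e2 : ∫ ν, (φ (ν + Real.pi / t) - φ ν) * Real.cos (t * ν + β) =
      -2 * ∫ ν, φ ν * Real.cos (t * ν + β) := by
    simp only [sub_mul]
    rw [integral_sub (hi _ htrans) (hi _ hφ), e1]
    ring
  have e3 : |∫ ν, (φ (ν + Real.pi / t) - φ ν) * Real.cos (t * ν + β)| ≤ C * (Real.pi / t) := by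
    refine (abs_integral_le_integral_abs).trans (le_trans ?_ h)
    refine integral_mono (hi _ (htrans.sub hφ)).abs (htrans.sub hφ).abs fun ν => ?_
    simp only [abs_mul]
    exact mul_le_of_le_one_right (abs_nonneg _) (Real.abs_cos_le_one _)
  rw [e2, abs_mul] at e3
  norm_num at e3
  have := abs_nonneg (∫ ν, φ ν * Real.cos (t * ν + β))
  rw [mul_div_assoc]
  linarith

/-- The Fourier transform of a smooth compactly supported function decays like `t⁻⁴`. -/
theorem IsCompactSmooth.exists_abs_integral_mul_cos_le {F : ℝ → ℝ} (hF : IsCompactSmooth F) :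
    ∃ C, 0 ≤ C ∧ ∀ t, 0 ≤ t → ∀ α, |∫ ν, F ν * Real.cos (t * ν + α)| ≤ C * ((1 + t) ^ 4)⁻¹ := by
  obtain ⟨p, q, hp, hq, hFg⟩ := hF.bv
  have z1 := deriv_eq_zero_of_one_lt_abs hF.zero
  have z2 := deriv_eq_zero_of_one_lt_abs z1
  have z3 := deriv_eq_zero_of_one_lt_abs z2
  have i3 : Integrable (deriv (deriv (deriv F))) :=
    integrable_of_zero z3 (hF.ac_deriv_deriv (-2) 2).intervalIntegrable_deriv
  have i0 : Integrable F := integrable_of_zero hF.zero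
    ((continuous_of_ac hF.ac).intervalIntegrable _ _)
  obtain ⟨C, hC⟩ := exists_integral_abs_translate_sub_le z3 hp hq hFg
  have hline : ∀ G : ℝ → ℝ, (∀ x, 1 < |x| → G x = 0) → ∀ t α,
      ∫ ν, G ν * Real.cos (t * ν + α) = ∫ ν in (-2)..2, G ν * Real.cos (t * ν + α) := by
    intro G hG t α
    refine (intervalIntegral.integral_eq_integral_of_support_subset ?_).symm
    exact support_subset_of_zero fun x hx => by rw [hG x hx, zero_mul]
  have a2 : (1 : ℝ) < |2| := by norm_num
  have a2' : (1 : ℝ) < |-2| := by norm_num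
  have hbig : ∀ t, Real.pi ≤ t → ∀ α,
      |∫ ν, F ν * Real.cos (t * ν + α)| ≤ |C * Real.pi| / t ^ 4 := by
    intro t htpi α
    have ht : 0 < t := Real.pi_pos.trans_le htpi
    rw [hline F hF.zero,
      integral_mul_cos_eq_deriv (hF.ac _ _) (hF.zero _ a2') (hF.zero _ a2) ht.ne',
      integral_mul_cos_eq_deriv (hF.ac_deriv _ _) (z1 _ a2') (z1 _ a2) ht.ne',
      integral_mul_cos_eq_deriv (hF.ac_deriv_deriv _ _) (z2 _ a2') (z2 _ a2) ht.ne',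
      ← hline _ z3, abs_mul, abs_mul, abs_mul, abs_of_pos (by positivity : 0 < 1 / t)]
    have h1 := abs_integral_mul_cos_le_of_translate i3 ht
      (hC (Real.pi / t) (by have := Real.pi_pos; positivity) (by rwa [div_le_one ht]))
      (α + Real.pi / 2 + Real.pi / 2 + Real.pi / 2)
    have h2 : C * Real.pi / t ≤ |C * Real.pi| / t := by gcongr; exact le_abs_self _
    calc _ ≤ 1 / t * (1 / t * (1 / t * (|C * Real.pi| / t))) := by
          gcongr; exact h1.trans h2
      _ = _ := by field_simp
  have hall : ∀ t α, |∫ ν, F ν * Real.cos (t * ν + α)| ≤ ∫ ν, |F ν| := by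
    intro t α
    refine abs_integral_le_integral_abs.trans ?_
    refine integral_mono_of_nonneg (Eventually.of_forall fun x => abs_nonneg _) i0.abs
      (Eventually.of_forall fun ν => ?_)
    simp only [abs_mul]
    exact mul_le_of_le_one_right (abs_nonneg _) (Real.abs_cos_le_one _)
  have hI : 0 ≤ ∫ ν, |F ν| := integral_nonneg fun _ => abs_nonneg _
  refine ⟨16 * |C * Real.pi| + (1 + Real.pi) ^ 4 * ∫ ν, |F ν|, by
    have := Real.pi_pos; positivity, fun t ht α => ?_⟩
  rw [← div_eq_mul_inv, le_div_iff₀ (by positivity)]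
  have hpi := Real.pi_gt_three
  rcases le_or_gt Real.pi t with h | h
  · have h1 := hbig t h α
    have ht0 : 0 < t := by linarith
    rw [le_div_iff₀ (by positivity)] at h1
    have h2 : (1 + t) ^ 4 ≤ 16 * t ^ 4 := by
      calc (1 + t) ^ 4 ≤ (2 * t) ^ 4 := by gcongr; linarith
        _ = _ := by ring
    have h3 := mul_le_mul_of_nonneg_left h2 (abs_nonneg (∫ ν, F ν * Real.cos (t * ν + α)))
    have h4 : 0 ≤ (1 + Real.pi) ^ 4 * ∫ ν, |F ν| := by positivity
    linarith
  · have h1 := hall t α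
    have h2 : (1 + t) ^ 4 ≤ (1 + Real.pi) ^ 4 := by gcongr
    have h3 := mul_le_mul h1 h2 (by positivity) hI
    have h4 := abs_nonneg (C * Real.pi)
    linarith

theorem IsSmoothSieve.zero_of_one_lt_abs {E : ℝ → ℝ} (hE : IsSmoothSieve E) :
    ∀ x, 1 < |x| → E x = 0 := by
  intro x hx
  refine image_eq_zero_of_notMem_tsupport ?_
  rw [hE.support, mem_Icc, ← abs_le]
  exact not_le.mpr hx

theorem IsSmoothSieve.isCompactSmooth {E : ℝ → ℝ} (hE : IsSmoothSieve E) : IsCompactSmooth E where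
  ac := hE.ac
  ac_deriv := hE.ac_deriv
  ac_deriv_deriv := hE.ac_deriv_deriv
  zero := hE.zero_of_one_lt_abs
  bv := by
    obtain ⟨g, hg, h⟩ := hE.bv
    have hg' := (hg.mono (subset_univ (Icc (-3) 4))).locallyBoundedVariationOn
    obtain ⟨p, q, hp, hq, rfl⟩ := hg'.exists_monotoneOn_sub_monotoneOn
    exact ⟨p, q, hp, hq, h⟩

/-- The function `x ↦ x E(x)`, whose Fourier transform is essentially the derivative of that of
`E`, has the same smoothness as `E`. -/
theorem IsSmoothSieve.isCompactSmooth_id_mul {E : ℝ → ℝ} (hE : IsSmoothSieve E) :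
    IsCompactSmooth fun x => x * E x := by
  have hid : ∀ a b, AbsolutelyContinuousOnInterval (fun x : ℝ => x) a b := fun a b =>
    ContDiffOn.absolutelyContinuousOnInterval (by fun_prop)
  have d1 : deriv (fun x => x * E x) = E + (fun x => x) * deriv E := by
    funext x
    have := (hasDerivAt_id x).mul (hE.differentiable x).hasDerivAt
    rw [show (fun x => x * E x) = id * E from rfl, this.deriv]
    simp
  have d2 : deriv (E + (fun x => x) * deriv E) =
      (deriv E + deriv E) + (fun x => x) * deriv (deriv E) := by
    funext x
    have := (hE.differentiable x).hasDerivAt.add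
      ((hasDerivAt_id x).mul (hE.differentiable_deriv x).hasDerivAt)
    rw [show E + (fun x => x) * deriv E = E + id * deriv E from rfl, this.deriv]
    simp
    ring
  obtain ⟨g, hg, hEg⟩ := hE.bv
  have h3 := (((hE.ac_deriv_deriv (-3) 4).add (hE.ac_deriv_deriv (-3) 4)).add
    (hE.ac_deriv_deriv (-3) 4)).boundedVariationOn
  rw [uIcc_of_le (by norm_num)] at h3
  have hxg : BoundedVariationOn ((fun x : ℝ => x) * g) (Icc (-3) 4) :=
    (BoundedVariationOn.id_Icc _ _).mul (hg.mono (subset_univ _))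
  obtain ⟨p₁, q₁, hp₁, hq₁, e₁⟩ := h3.locallyBoundedVariationOn.exists_monotoneOn_sub_monotoneOn
  obtain ⟨p₂, q₂, hp₂, hq₂, e₂⟩ := hxg.locallyBoundedVariationOn.exists_monotoneOn_sub_monotoneOn
  refine ⟨fun a b => (hid a b).mul (hE.ac a b), fun a b => ?_, fun a b => ?_, fun x hx => ?_,
    p₁ + p₂, q₁ + q₂, hp₁.add hp₂, hq₁.add hq₂, ?_⟩
  · rw [d1]; exact (hE.ac a b).add ((hid a b).mul (hE.ac_deriv a b))
  · rw [d1, d2]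
    exact ((hE.ac_deriv a b).add (hE.ac_deriv a b)).add ((hid a b).mul (hE.ac_deriv_deriv a b))
  · simp only [hE.zero_of_one_lt_abs x hx, mul_zero]
  · rw [add_sub_add_comm, ← e₁, ← e₂]
    -- `(x * E)''' = 3 * E'' + x * E'''` almost everywhere, where the absolutely continuous function
    -- `E''` is differentiable
    have hdiff : ∀ᵐ x : ℝ, DifferentiableAt ℝ (deriv (deriv E)) x := by
      have hn : ∀ᵐ x : ℝ, ∀ n : ℕ, x ∈ uIcc (-(n : ℝ)) n →
          DifferentiableAt ℝ (deriv (deriv E)) x :=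
        ae_all_iff.mpr fun n => (hE.ac_deriv_deriv (-(n : ℝ)) n).ae_differentiableAt
      filter_upwards [hn] with x hx
      obtain ⟨n, hn⟩ := exists_nat_ge |x|
      refine hx n ?_
      rw [uIcc_of_le (by linarith [abs_nonneg x])]
      exact abs_le.mp hn
    filter_upwards [hdiff, hEg] with x hx hgx
    rw [d1, d2]
    have h1 := (hE.differentiable_deriv x).hasDerivAt
    have := (h1.add h1).add ((hasDerivAt_id x).mul hx.hasDerivAt)
    rw [show deriv E + deriv E + (fun x => x) * deriv (deriv E) =
      deriv E + deriv E + id * deriv (deriv E) from rfl, this.deriv]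
    simp [hgx]
    ring

end

/-! ### The Fourier and Mellin transforms of the sieving function -/

section

open Filter Topology

theorem fourierE_eq {E : ℝ → ℝ} {lam : ℝ} (hlam : 0 < lam) (t : ℝ) :
    fourierE E lam t = lam * ∫ x, E x * Real.cos (lam * t * x) := by
  have := Measure.integral_comp_div (fun x => E x * Real.cos (lam * t * x)) lam
  rw [abs_of_pos hlam, smul_eq_mul] at this
  rw [← this, fourierE]
  refine integral_congr_ae (Eventually.of_forall fun ν => ?_)
  simp only [scaled]
  congr 2
  field_simp

theorem fourierE_neg (E : ℝ → ℝ) (lam t : ℝ) : fourierE E lam (-t) = fourierE E lam t := by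
  simp [fourierE]

theorem inv_one_add_mul_pow_le {lam t : ℝ} (hlam : 0 < lam) (ht : 0 ≤ t) :
    ((1 + lam * t) ^ 4)⁻¹ ≤ (1 + lam⁻¹) ^ 4 * ((1 + t) ^ 4)⁻¹ := by
  rw [← div_eq_mul_inv, ← div_pow, ← inv_pow]
  refine pow_le_pow_left₀ (by positivity) ?_ 4
  rw [inv_le_iff_one_le_mul₀ (by positivity), div_mul_eq_mul_div, le_div_iff₀ (by positivity)]
  have : (1 + lam⁻¹) * (1 + lam * t) = 1 + lam * t + lam⁻¹ + t := by field_simp; ring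
  rw [this]
  have : 0 < lam⁻¹ := by positivity
  nlinarith [mul_nonneg hlam.le ht]

theorem IsSmoothSieve.integrable_id_mul {E : ℝ → ℝ} (hE : IsSmoothSieve E) :
    Integrable fun x => x * E x :=
  integrable_of_zero hE.isCompactSmooth_id_mul.zero
    ((continuous_of_ac hE.isCompactSmooth_id_mul.ac).intervalIntegrable _ _)

theorem IsSmoothSieve.integrable {E : ℝ → ℝ} (hE : IsSmoothSieve E) : Integrable E :=
  integrable_of_zero hE.zero_of_one_lt_abs
    (hE.differentiable.continuous.intervalIntegrable _ _)

theorem exists_abs_fourierE_le {E : ℝ → ℝ} (hE : IsSmoothSieve E) {lam : ℝ} (hlam : 0 < lam) :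
    ∃ C, 0 ≤ C ∧ ∀ t, 0 ≤ t → |fourierE E lam t| ≤ C * ((1 + t) ^ 4)⁻¹ := by
  obtain ⟨C, hC0, hC⟩ := hE.isCompactSmooth.exists_abs_integral_mul_cos_le
  refine ⟨lam * (C * (1 + lam⁻¹) ^ 4), by positivity, fun t ht => ?_⟩
  rw [fourierE_eq hlam, abs_mul, abs_of_pos hlam, mul_assoc, mul_assoc]
  have := hC (lam * t) (by positivity) 0
  simp only [add_zero] at this
  gcongr
  exact this.trans (by gcongr; exact inv_one_add_mul_pow_le hlam ht)

/-- The derivative of the Fourier transform, together with its decay. -/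
theorem exists_hasDerivAt_fourierE {E : ℝ → ℝ} (hE : IsSmoothSieve E) {lam : ℝ} (hlam : 0 < lam) :
    ∃ f' : ℝ → ℝ, (∀ t, HasDerivAt (fourierE E lam) (f' t) t) ∧
      ∃ C, 0 ≤ C ∧ ∀ t, 0 ≤ t → |f' t| ≤ C * ((1 + t) ^ 4)⁻¹ := by
  obtain ⟨C, hC0, hC⟩ := hE.isCompactSmooth_id_mul.exists_abs_integral_mul_cos_le
  refine ⟨fun t => lam * ∫ x, lam * (x * E x * Real.cos (lam * t * x + Real.pi / 2)), fun t => ?_,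
    lam * (lam * (C * (1 + lam⁻¹) ^ 4)), by positivity, fun t ht => ?_⟩
  · rw [funext (fourierE_eq hlam)]
    refine HasDerivAt.const_mul lam ?_
    have hcont := hE.differentiable.continuous
    refine (hasDerivAt_integral_of_dominated_loc_of_deriv_le
      (F := fun t x => E x * Real.cos (lam * t * x))
      (F' := fun t x => lam * (x * E x * Real.cos (lam * t * x + Real.pi / 2)))
      (bound := fun x => lam * |x * E x|) (s := univ) univ_mem
      (Eventually.of_forall fun s => Continuous.aestronglyMeasurable (by fun_prop)) ?_
      (Continuous.aestronglyMeasurable (by fun_prop)) ?_ ?_ ?_).2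
    · exact hE.integrable.mul_bdd (c := 1) (Continuous.aestronglyMeasurable (by fun_prop))
        (Eventually.of_forall fun x => Real.abs_cos_le_one _)
    · refine Eventually.of_forall fun x s _ => ?_
      rw [Real.norm_eq_abs, abs_mul, abs_mul, abs_of_pos hlam]
      gcongr
      exact mul_le_of_le_one_right (abs_nonneg _) (Real.abs_cos_le_one _)
    · exact hE.integrable_id_mul.abs.const_mul lam
    · refine Eventually.of_forall fun x s _ => ?_
      have h1 : HasDerivAt (fun s => lam * s * x) (lam * x) s := by
        simpa using ((hasDerivAt_id s).const_mul lam).mul_const x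
      have := (h1.cos).const_mul (E x)
      refine this.congr_deriv ?_
      rw [Real.cos_add_pi_div_two]
      ring
  · beta_reduce
    rw [integral_const_mul, abs_mul, abs_mul, abs_of_pos hlam, mul_assoc, mul_assoc, mul_assoc]
    have := hC (lam * t) (by positivity) (Real.pi / 2)
    gcongr
    exact this.trans (by gcongr; exact inv_one_add_mul_pow_le hlam ht)

theorem continuous_fourierE {E : ℝ → ℝ} (hE : IsSmoothSieve E) {lam : ℝ} (hlam : 0 < lam) :
    Continuous (fourierE E lam) := by
  obtain ⟨f', hf', -⟩ := exists_hasDerivAt_fourierE hE hlam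
  exact continuous_iff_continuousAt.mpr fun t => (hf' t).continuousAt

theorem integrableOn_inv_pow_mul_rpow {x : ℝ} (h₁ : -3 < x) (h₂ : x < 1) :
    IntegrableOn (fun t : ℝ => ((1 + t) ^ 4)⁻¹ * t ^ (-x)) (Ioi 0) := by
  have hmeas : Measurable (fun t : ℝ => ((1 + t) ^ 4)⁻¹ * t ^ (-x)) := by fun_prop
  rw [← Ioc_union_Ioi_eq_Ioi (zero_le_one (α := ℝ))]
  refine IntegrableOn.union ?_ ?_
  · have h : IntegrableOn (fun t : ℝ => t ^ (-x)) (Ioc 0 1) := by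
      have := intervalIntegral.intervalIntegrable_rpow' (a := 0) (b := 1) (r := -x) (by linarith)
      rwa [intervalIntegrable_iff_integrableOn_Ioc_of_le zero_le_one] at this
    refine h.mono' hmeas.aestronglyMeasurable ?_
    filter_upwards [ae_restrict_mem measurableSet_Ioc] with t ht
    have ht0 : 0 < t := ht.1
    rw [Real.norm_of_nonneg (by positivity)]
    refine mul_le_of_le_one_left (by positivity) (inv_le_one_of_one_le₀ ?_)
    exact one_le_pow₀ (by linarith)
  · have h := integrableOn_Ioi_rpow_of_lt (a := -4 - x) (by linarith) one_pos
    refine h.mono' hmeas.aestronglyMeasurable ?_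
    filter_upwards [ae_restrict_mem measurableSet_Ioi] with t ht
    have ht0 : 0 < t := one_pos.trans ht
    rw [Real.norm_of_nonneg (by positivity), sub_eq_add_neg, Real.rpow_add ht0]
    gcongr
    rw [Real.rpow_neg ht0.le]
    norm_num
    gcongr
    linarith

/-- A common majorant of `t⁻ᶻ (1 + t)⁻⁴` for `a ≤ Re z ≤ b`. -/
theorem exists_integrableOn_majorant {a b : ℝ} (ha : -3 < a) (hb : b < 1) :
    ∃ w : ℝ → ℝ, IntegrableOn w (Ioi 0) ∧ ∀ t : ℝ, 0 < t → ∀ z : ℂ, z.re ∈ Icc a b →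
      ((1 + t) ^ 4)⁻¹ * ‖(t : ℂ) ^ (-z)‖ ≤ w t := by
  by_cases hab : a ≤ b
  · refine ⟨fun t => ((1 + t) ^ 4)⁻¹ * t ^ (-b) + ((1 + t) ^ 4)⁻¹ * t ^ (-a),
      (integrableOn_inv_pow_mul_rpow (by linarith) hb).add
        (integrableOn_inv_pow_mul_rpow ha (by linarith)), fun t ht z hz => ?_⟩
    beta_reduce
    rw [Complex.norm_cpow_eq_rpow_re_of_pos ht, ← mul_add]
    gcongr
    exact rpow_le_rpow_add_rpow ht (by simpa using hz.2) (by simpa using hz.1)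
  · exact ⟨fun _ => 0, integrableOn_zero, fun t _ z hz => absurd (hz.1.trans hz.2) hab⟩

theorem aestronglyMeasurable_mellin_integrand {f : ℝ → ℝ} (hf : Continuous f) (z : ℂ) :
    AEStronglyMeasurable (fun t : ℝ => (f t : ℂ) * (t : ℂ) ^ (-z)) (volume.restrict (Ioi 0)) :=
  Measurable.aestronglyMeasurable (by have := hf.measurable; fun_prop)

theorem norm_mellin_integrand_le {f w : ℝ → ℝ} {C : ℝ}
    (hf : ∀ t, 0 ≤ t → |f t| ≤ C * ((1 + t) ^ 4)⁻¹) (hC : 0 ≤ C) {z : ℂ}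
    (hw : ∀ t : ℝ, 0 < t → ((1 + t) ^ 4)⁻¹ * ‖(t : ℂ) ^ (-z)‖ ≤ w t) {t : ℝ} (ht : 0 < t) :
    ‖(f t : ℂ) * (t : ℂ) ^ (-z)‖ ≤ C * w t := by
  rw [norm_mul, Complex.norm_real, Real.norm_eq_abs]
  calc _ ≤ C * ((1 + t) ^ 4)⁻¹ * ‖(t : ℂ) ^ (-z)‖ := by gcongr; exact hf t ht.le
    _ = C * (((1 + t) ^ 4)⁻¹ * ‖(t : ℂ) ^ (-z)‖) := by ring
    _ ≤ _ := by gcongr; exact hw t ht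

theorem integrableOn_mellin_integrand {f : ℝ → ℝ} {C : ℝ} (hcont : Measurable f)
    (hf : ∀ t, 0 ≤ t → |f t| ≤ C * ((1 + t) ^ 4)⁻¹) (hC : 0 ≤ C) {z : ℂ} (h₁ : -3 < z.re)
    (h₂ : z.re < 1) : IntegrableOn (fun t : ℝ => (f t : ℂ) * (t : ℂ) ^ (-z)) (Ioi 0) := by
  obtain ⟨w, hw, hwb⟩ := exists_integrableOn_majorant h₁ h₂
  refine (hw.const_mul C).mono' (Measurable.aestronglyMeasurable (by fun_prop)) ?_
  filter_upwards [ae_restrict_mem measurableSet_Ioi] with t ht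
  exact norm_mellin_integrand_le hf hC (fun t ht => hwb t ht z ⟨le_rfl, le_rfl⟩) ht

theorem continuousOn_mellinM {E : ℝ → ℝ} (hE : IsSmoothSieve E) {lam : ℝ} (hlam : 0 < lam) :
    ContinuousOn (mellinM E lam) {z | -3 < z.re ∧ z.re < 1} := by
  obtain ⟨C, hC0, hC⟩ := exists_abs_fourierE_le hE hlam
  have hopen : IsOpen {z : ℂ | -3 < z.re ∧ z.re < 1} :=
    (isOpen_lt continuous_const Complex.continuous_re).inter
      (isOpen_lt Complex.continuous_re continuous_const)
  refine ContinuousOn.mul continuousOn_const (DifferentiableOn.continuousOn (𝕜 := ℂ) ?_)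
  refine differentiableOn_integral_of_dominated hopen
    (fun z _ => aestronglyMeasurable_mellin_integrand (continuous_fourierE hE hlam) z) ?_ ?_
  · filter_upwards [ae_restrict_mem measurableSet_Ioi] with t ht
    have ht0 : (t : ℂ) ≠ 0 := Complex.ofReal_ne_zero.mpr (ne_of_gt ht)
    intro z _
    exact ((differentiableAt_id.neg.const_cpow (Or.inl ht0)).const_mul _).differentiableWithinAt
  · rintro z₀ ⟨h₁, h₂⟩
    obtain ⟨w, hw, hwb⟩ := exists_integrableOn_majorant (a := (z₀.re - 3) / 2)
      (b := (z₀.re + 1) / 2) (by linarith) (by linarith)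
    refine ⟨min ((z₀.re + 3) / 2) ((1 - z₀.re) / 2), lt_min (by linarith) (by linarith),
      fun t => C * w t, hw.const_mul C, ?_⟩
    filter_upwards [ae_restrict_mem measurableSet_Ioi] with t ht z hz
    refine norm_mellin_integrand_le hC hC0 (fun t ht => hwb t ht z ?_) ht
    have hre : |(z - z₀).re| < min ((z₀.re + 3) / 2) ((1 - z₀.re) / 2) :=
      (Complex.abs_re_le_norm _).trans_lt (by simpa [dist_eq_norm] using hz)
    rw [Complex.sub_re, lt_min_iff, abs_lt, abs_lt] at hre
    exact ⟨by linarith [hre.1.1], by linarith [hre.2.2]⟩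

theorem exists_norm_mellinM_le {E : ℝ → ℝ} (hE : IsSmoothSieve E) {lam : ℝ} (hlam : 0 < lam)
    {a b : ℝ} (ha : -3 < a) (hb : b < 1) :
    ∃ C, 0 ≤ C ∧ ∀ z : ℂ, z.re ∈ Icc a b → ‖mellinM E lam z‖ ≤ C := by
  obtain ⟨C, hC0, hC⟩ := exists_abs_fourierE_le hE hlam
  obtain ⟨w, hw, hwb⟩ := exists_integrableOn_majorant ha hb
  refine ⟨|1 / Real.pi * ∫ t in Ioi 0, C * w t|, abs_nonneg _, fun z hz => ?_⟩
  refine le_trans ?_ (le_abs_self _)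
  rw [mellinM, norm_mul]
  have h1 : ‖(1 / (Real.pi : ℂ))‖ = 1 / Real.pi := by
    rw [norm_div, norm_one, Complex.norm_real, Real.norm_of_nonneg Real.pi_pos.le]
  rw [h1]
  have := Real.pi_pos
  gcongr
  refine norm_integral_le_of_norm_le (hw.const_mul C) ?_
  filter_upwards [ae_restrict_mem measurableSet_Ioi] with t ht
  exact norm_mellin_integrand_le hC hC0 (fun t ht => hwb t ht z hz) ht

/-- Integration by parts in the Mellin transform gains a factor of the size of `|z|`. -/
theorem one_sub_mul_mellinM {E : ℝ → ℝ} (hE : IsSmoothSieve E) {lam : ℝ} (hlam : 0 < lam)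
    {f' : ℝ → ℝ} (hf' : ∀ t, HasDerivAt (fourierE E lam) (f' t) t) {C' : ℝ} (hC'0 : 0 ≤ C')
    (hC' : ∀ t, 0 ≤ t → |f' t| ≤ C' * ((1 + t) ^ 4)⁻¹) {z : ℂ} (h₁ : -2 < z.re) (h₂ : z.re < 1) :
    (1 - z) * mellinM E lam z =
      -((1 / (Real.pi : ℂ)) * ∫ t : ℝ in Ioi 0, (f' t : ℂ) * (t : ℂ) ^ (-(z - 1))) := by
  obtain ⟨C, hC0, hC⟩ := exists_abs_fourierE_le hE hlam
  have hmeas : Measurable f' := by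
    rw [show f' = deriv (fourierE E lam) from funext fun t => (hf' t).deriv.symm]
    exact measurable_deriv _
  have hz0 : 0 < (1 - z).re := by simpa using h₂
  have hz1 : (1 - z) ≠ 0 := fun h => by simp [h] at hz0
  have i1 := integrableOn_mellin_integrand (continuous_fourierE hE hlam).measurable hC hC0
    (by linarith : -3 < z.re) h₂
  have i2 := integrableOn_mellin_integrand hmeas hC' hC'0 (z := z - 1)
    (by simp; linarith) (by simp; linarith)
  have hu : ∀ t ∈ Ioi (0 : ℝ), HasDerivAt (fun t => (fourierE E lam t : ℂ)) (f' t : ℂ) t :=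
    fun t _ => (hf' t).ofReal_comp
  have hv : ∀ t ∈ Ioi (0 : ℝ), HasDerivAt (fun t : ℝ => (t : ℂ) ^ (1 - z))
      ((1 - z) * (t : ℂ) ^ (-z)) t := by
    intro t ht
    have := hasDerivAt_ofReal_cpow_const (r := 1 - z) (ne_of_gt ht) hz1
    rwa [show 1 - z - 1 = -z by ring] at this
  have hnorm : ∀ t : ℝ, 0 < t → ‖(t : ℂ) ^ (1 - z)‖ = t ^ (1 - z.re) := fun t ht => by
    rw [Complex.norm_cpow_eq_rpow_re_of_pos ht]; simp
  have key := integral_Ioi_mul_deriv_eq_deriv_mul (a := (0 : ℝ)) (a' := (0 : ℂ))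
    (b' := (0 : ℂ)) hu hv ?_ ?_ ?_ ?_
  · have e1 : ∫ t : ℝ in Ioi 0, (fourierE E lam t : ℂ) * ((1 - z) * (t : ℂ) ^ (-z)) =
        (1 - z) * ∫ t : ℝ in Ioi 0, (fourierE E lam t : ℂ) * (t : ℂ) ^ (-z) := by
      rw [← integral_const_mul]
      refine integral_congr_ae (Eventually.of_forall fun t => ?_)
      simp only; ring
    rw [e1] at key
    rw [mellinM, neg_sub, mul_left_comm, key]
    ring
  · refine (i1.const_mul (1 - z)).congr (Eventually.of_forall fun t => ?_)
    simp only [Pi.mul_apply]; ring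
  · refine i2.congr (Eventually.of_forall fun t => ?_)
    simp only [Pi.mul_apply, neg_sub]
  · have h3 : Tendsto (fun t : ℝ => C * t ^ (1 - z.re)) (𝓝[>] 0) (𝓝 0) := by
      have h4 : 0 < 1 - z.re := by linarith
      have := (Real.continuousAt_rpow_const 0 (1 - z.re) (Or.inr h4.le)).tendsto.const_mul C
      rw [Real.zero_rpow h4.ne', mul_zero] at this
      exact this.mono_left nhdsWithin_le_nhds
    refine squeeze_zero_norm' ?_ h3
    filter_upwards [self_mem_nhdsWithin] with t ht
    have ht0 : 0 < t := ht
    rw [Pi.mul_apply, norm_mul, Complex.norm_real, Real.norm_eq_abs, hnorm t ht0]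
    gcongr
    refine (hC t ht0.le).trans (mul_le_of_le_one_right hC0 (inv_le_one_of_one_le₀ ?_))
    exact one_le_pow₀ (by linarith)
  · have h3 : Tendsto (fun t : ℝ => C * t ^ (-(3 + z.re))) atTop (𝓝 0) := by
      simpa using (tendsto_rpow_neg_atTop (by linarith : 0 < 3 + z.re)).const_mul C
    refine squeeze_zero_norm' ?_ h3
    filter_upwards [eventually_gt_atTop 0] with t ht0
    rw [Pi.mul_apply, norm_mul, Complex.norm_real, Real.norm_eq_abs, hnorm t ht0]
    calc _ ≤ C * ((1 + t) ^ 4)⁻¹ * t ^ (1 - z.re) := by gcongr; exact hC t ht0.le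
      _ ≤ C * (t ^ 4)⁻¹ * t ^ (1 - z.re) := by gcongr; linarith
      _ = _ := by
        rw [show -(3 + z.re) = -4 + (1 - z.re) by ring, Real.rpow_add ht0, Real.rpow_neg ht0.le]
        norm_num
        ring

/-- Decay of the Mellin transform of the Fourier transform in vertical strips. -/
theorem exists_norm_mellinM_mul_le {E : ℝ → ℝ} (hE : IsSmoothSieve E) {lam : ℝ} (hlam : 0 < lam)
    {a b : ℝ} (ha : -2 < a) (hb : b < 1) :
    ∃ C, 0 ≤ C ∧ ∀ z : ℂ, z.re ∈ Icc a b → (1 + |z.im|) * ‖mellinM E lam z‖ ≤ C := by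
  obtain ⟨f', hf', C', hC'0, hC'⟩ := exists_hasDerivAt_fourierE hE hlam
  obtain ⟨C₀, hC₀, hM⟩ := exists_norm_mellinM_le hE hlam (by linarith : -3 < a) hb
  obtain ⟨w, hw, hwb⟩ := exists_integrableOn_majorant (a := a - 1) (b := b - 1) (by linarith)
    (by linarith)
  refine ⟨C₀ + |1 / Real.pi * ∫ t in Ioi 0, C' * w t|, by positivity, fun z hz => ?_⟩
  have h1 := one_sub_mul_mellinM hE hlam hf' hC'0 hC' (z := z) (by linarith [hz.1])
    (by linarith [hz.2])
  have h2 : ‖(1 - z) * mellinM E lam z‖ ≤ |1 / Real.pi * ∫ t in Ioi 0, C' * w t| := by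
    refine le_trans ?_ (le_abs_self _)
    have h3 : ‖(1 / (Real.pi : ℂ))‖ = 1 / Real.pi := by
      rw [norm_div, norm_one, Complex.norm_real, Real.norm_of_nonneg Real.pi_pos.le]
    rw [h1, norm_neg, norm_mul, h3]
    have := Real.pi_pos
    gcongr
    refine norm_integral_le_of_norm_le (hw.const_mul C') ?_
    filter_upwards [ae_restrict_mem measurableSet_Ioi] with t ht
    exact norm_mellin_integrand_le hC' hC'0 (fun t ht => hwb t ht (z - 1)
      ⟨by simpa using hz.1, by simpa using hz.2⟩) ht
  have h4 : |z.im| ≤ ‖1 - z‖ := by simpa using Complex.abs_im_le_norm (1 - z)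
  rw [norm_mul] at h2
  have h5 := mul_le_mul_of_nonneg_right h4 (norm_nonneg (mellinM E lam z))
  have := hM z hz
  rw [add_mul, one_mul]
  linarith

theorem integrable_fourierE {E : ℝ → ℝ} (hE : IsSmoothSieve E) {lam : ℝ}
    (hlam : 0 < lam) : Integrable (fourierE E lam) := by
  obtain ⟨C, hC0, hC⟩ := exists_abs_fourierE_le hE hlam
  have h : Integrable (fun t : ℝ => C * ((1 + ‖t‖) ^ (-4 : ℝ))) :=
    (integrable_one_add_norm (by simp)).const_mul C
  refine h.mono' (continuous_fourierE hE hlam).aestronglyMeasurable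
    (Eventually.of_forall fun t => ?_)
  have : fourierE E lam t = fourierE E lam |t| := by
    rcases abs_cases t with h | h
    · rw [h.1]
    · rw [h.1, fourierE_neg]
  rw [this, Real.norm_eq_abs, Real.norm_eq_abs, Real.rpow_neg (by positivity)]
  exact_mod_cast hC |t| (abs_nonneg t)

/-- Fourier inversion, in the form of a cosine integral. -/
theorem integral_fourierE_mul_cos {E : ℝ → ℝ} (hE : IsSmoothSieve E) {lam : ℝ} (hlam : 0 < lam)
    (a : ℝ) :
    (1 / Real.pi) * ∫ t in Ioi 0, fourierE E lam t * Real.cos (a * t) = scaled E lam a := by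
  have hlam0 : lam ≠ 0 := hlam.ne'
  have hcontE : Continuous (scaled E lam) := by
    have := hE.differentiable.continuous
    unfold scaled
    fun_prop
  have hintE : Integrable (scaled E lam) := hE.integrable.comp_div hlam0
  have hevenE : ∀ ν, scaled E lam (-ν) = scaled E lam ν := fun ν => by
    simp only [scaled, neg_div, hE.even]
  set f : ℝ → ℂ := fun ν => (scaled E lam ν : ℂ) with hf
  have hintf : Integrable f := hintE.ofReal
  have hodd : ∀ c : ℝ, ∫ ν, scaled E lam ν * Real.sin (ν * c) = 0 := by
    intro c
    have h1 := integral_neg_eq_self (fun ν => scaled E lam ν * Real.sin (ν * c)) volume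
    simp only [hevenE, neg_mul, Real.sin_neg, mul_neg, integral_neg] at h1
    linarith
  have hF : ∀ ξ : ℝ, FourierTransform.fourier f ξ = (fourierE E lam (2 * Real.pi * ξ) : ℂ) := by
    intro ξ
    rw [Real.fourier_real_eq_integral_exp_smul]
    have hi1 : Integrable fun ν => scaled E lam ν * Real.cos (ν * (2 * Real.pi * ξ)) :=
      hintE.mul_bdd (c := 1) (Continuous.aestronglyMeasurable (by fun_prop))
        (Eventually.of_forall fun x => Real.abs_cos_le_one _)
    have hi2 : Integrable fun ν => scaled E lam ν * Real.sin (ν * (2 * Real.pi * ξ)) :=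
      hintE.mul_bdd (c := 1) (Continuous.aestronglyMeasurable (by fun_prop))
        (Eventually.of_forall fun x => Real.abs_sin_le_one _)
    calc _ = ∫ ν : ℝ, (((scaled E lam ν * Real.cos (ν * (2 * Real.pi * ξ)) : ℝ) : ℂ) -
          ((scaled E lam ν * Real.sin (ν * (2 * Real.pi * ξ)) : ℝ) : ℂ) * Complex.I) := by
          refine integral_congr_ae (Eventually.of_forall fun ν => ?_)
          simp only [hf, smul_eq_mul]
          rw [Complex.exp_mul_I, ← Complex.ofReal_cos, ← Complex.ofReal_sin,
            show -2 * Real.pi * ν * ξ = -(ν * (2 * Real.pi * ξ)) by ring, Real.cos_neg,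
            Real.sin_neg]
          push_cast
          ring
      _ = _ := by
          rw [integral_sub hi1.ofReal (hi2.ofReal.mul_const _), integral_mul_const,
            integral_complex_ofReal, integral_complex_ofReal, hodd, fourierE]
          simp
  have hintFE := integrable_fourierE hE hlam
  have h2pi : (2 * Real.pi) ≠ 0 := by have := Real.pi_pos; positivity
  have hFf : Integrable (FourierTransform.fourier f) := by
    rw [funext hF]
    exact (hintFE.comp_mul_left' h2pi).ofReal
  have hinv := hintf.fourierInv_fourier_eq hFf (v := a)
    (Complex.continuous_ofReal.comp hcontE).continuousAt
  rw [Real.fourierInv_eq', funext hF] at hinv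
  have hre := congrArg Complex.re hinv
  have hif : Integrable fun ξ : ℝ =>
      Complex.exp (((2 * Real.pi * (inner ℝ ξ a) : ℝ) : ℂ) * Complex.I) •
      (fourierE E lam (2 * Real.pi * ξ) : ℂ) := by
    refine Integrable.bdd_mul (c := 1) (hintFE.comp_mul_left' h2pi).ofReal
      (Continuous.aestronglyMeasurable (by fun_prop))
      (Eventually.of_forall fun ξ => (Complex.norm_exp_ofReal_mul_I _).le)
  have hre2 : ∫ ξ : ℝ, fourierE E lam (2 * Real.pi * ξ) * Real.cos (a * (2 * Real.pi * ξ)) =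
      scaled E lam a := by
    rw [show (f a).re = scaled E lam a from Complex.ofReal_re _] at hre
    rw [← hre]
    have := integral_re hif
    simp only [RCLike.re_to_complex] at this
    rw [← this]
    refine integral_congr_ae (Eventually.of_forall fun ξ => ?_)
    simp only [smul_eq_mul, Complex.re_mul_ofReal, Complex.exp_ofReal_mul_I_re]
    rw [mul_comm]
    congr 2
    simp
    ring
  have hsub := Measure.integral_comp_mul_left (fun t => fourierE E lam t * Real.cos (a * t))
    (2 * Real.pi)
  rw [hre2] at hsub
  have hab := integral_comp_abs (f := fun t => fourierE E lam t * Real.cos (a * t))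
  have hab2 : ∫ x, fourierE E lam |x| * Real.cos (a * |x|) =
      ∫ x, fourierE E lam x * Real.cos (a * x) := by
    refine integral_congr_ae (Eventually.of_forall fun t => ?_)
    rcases abs_cases t with h | h
    · simp only [h.1]
    · simp only [h.1, fourierE_neg, mul_neg, Real.cos_neg]
  rw [hab2] at hab
  rw [hsub, hab, smul_eq_mul, abs_of_pos (by have := Real.pi_pos; positivity)]
  have := Real.pi_ne_zero
  field_simp

end

/-! ### Bounds for the logarithmic derivative of the zeta function -/

section

open Filter Topology Complex

theorem sub_floor_mem {t : ℝ} (ht : 0 ≤ t) : 0 ≤ t - ⌊t⌋₊ ∧ t - ⌊t⌋₊ ≤ 1 :=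
  ⟨sub_nonneg.mpr (Nat.floor_le ht), by linarith [Nat.lt_floor_add_one t]⟩

theorem measurable_sub_floor_mul_cpow (s : ℂ) :
    Measurable fun t : ℝ => ((t - ⌊t⌋₊ : ℝ) : ℂ) * (t : ℂ) ^ (-(s + 1)) := by
  have : Measurable fun t : ℝ => (⌊t⌋₊ : ℝ) := measurable_from_nat.comp Nat.measurable_floor
  fun_prop

theorem norm_sub_floor_mul_cpow_le {s : ℂ} {a t : ℝ} (ht : 1 < t) (hs : a ≤ s.re) :
    ‖((t - ⌊t⌋₊ : ℝ) : ℂ) * (t : ℂ) ^ (-(s + 1))‖ ≤ t ^ (-a - 1) := by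
  have ht0 : 0 < t := one_pos.trans ht
  have h := sub_floor_mem ht0.le
  rw [norm_mul, norm_real, Real.norm_of_nonneg h.1, norm_cpow_eq_rpow_re_of_pos ht0]
  refine (mul_le_of_le_one_left (by positivity) h.2).trans ?_
  exact Real.rpow_le_rpow_of_exponent_le ht.le (by simp; linarith)

theorem integrableOn_sub_floor_mul_cpow {s : ℂ} (hs : 0 < s.re) :
    IntegrableOn (fun t : ℝ => ((t - ⌊t⌋₊ : ℝ) : ℂ) * (t : ℂ) ^ (-(s + 1))) (Ioi 1) := by
  refine (integrableOn_Ioi_rpow_of_lt (a := -s.re - 1) (by linarith) one_pos).mono'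
    (measurable_sub_floor_mul_cpow s).aestronglyMeasurable ?_
  filter_upwards [ae_restrict_mem measurableSet_Ioi] with t ht
  exact norm_sub_floor_mul_cpow_le ht le_rfl

/-- Abel summation for the zeta function with its pole removed. -/
theorem riemannZeta₀_eq_of_one_lt {s : ℂ} (hs : 1 < s.re) : riemannZeta₀ s =
    1 - s * ∫ t : ℝ in Ioi 1, ((t - ⌊t⌋₊ : ℝ) : ℂ) * (t : ℂ) ^ (-(s + 1)) := by
  have hs1 : s ≠ 1 := fun h => by simp [h] at hs
  have hs1' : s - 1 ≠ 0 := sub_ne_zero.mpr hs1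
  have h := LSeries_eq_mul_integral (fun _ => (1 : ℂ)) zero_le_one hs
    (LSeriesSummable_one_iff.mpr hs) (by
      refine Asymptotics.isBigO_of_le _ fun n => ?_
      simp)
  rw [show LSeries (fun _ => (1 : ℂ)) s = riemannZeta s from LSeries_one_eq_riemannZeta hs] at h
  have i1 : IntegrableOn (fun t : ℝ => (t : ℂ) ^ (-s)) (Ioi 1) :=
    integrableOn_Ioi_cpow_of_lt (by simpa using hs) one_pos
  have i2 := integrableOn_sub_floor_mul_cpow (s := s) (by linarith)
  have e1 : ∫ t : ℝ in Ioi 1, (∑ k ∈ Finset.Icc 1 ⌊t⌋₊, (1 : ℂ)) * (t : ℂ) ^ (-(s + 1)) =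
      (∫ t : ℝ in Ioi 1, (t : ℂ) ^ (-s)) -
        ∫ t : ℝ in Ioi 1, ((t - ⌊t⌋₊ : ℝ) : ℂ) * (t : ℂ) ^ (-(s + 1)) := by
    rw [← integral_sub i1 i2]
    refine setIntegral_congr_fun measurableSet_Ioi fun t ht => ?_
    have ht0 : (t : ℂ) ≠ 0 := ofReal_ne_zero.mpr (ne_of_gt (one_pos.trans ht))
    have : (t : ℂ) ^ (-s) = t * (t : ℂ) ^ (-(s + 1)) := by
      rw [show -s = -(s + 1) + 1 by ring, cpow_add _ _ ht0, cpow_one, mul_comm]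
    simp only [Finset.sum_const, Nat.card_Icc, add_tsub_cancel_right, nsmul_eq_mul, mul_one]
    rw [this]
    push_cast
    ring
  have e2 : ∫ t : ℝ in Ioi 1, (t : ℂ) ^ (-s) = 1 / (s - 1) := by
    rw [integral_Ioi_cpow_of_lt (by simpa using hs) one_pos, ofReal_one, one_cpow,
      neg_div, ← div_neg]
    congr 1; ring
  have h0 := riemannZeta_eq_inv_sub_add hs1
  rw [h, e1, e2] at h0
  have h1 : riemannZeta₀ s = s * (1 / (s - 1) - ∫ t : ℝ in Ioi 1, ((t - ⌊t⌋₊ : ℝ) : ℂ) *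
    (t : ℂ) ^ (-(s + 1))) - (s - 1)⁻¹ := by rw [h0]; ring
  rw [h1]
  field_simp
  ring

/-- The formula of Abel summation persists to the right of the imaginary axis. -/
theorem riemannZeta₀_eq {s : ℂ} (hs : 0 < s.re) : riemannZeta₀ s =
    1 - s * ∫ t : ℝ in Ioi 1, ((t - ⌊t⌋₊ : ℝ) : ℂ) * (t : ℂ) ^ (-(s + 1)) := by
  have hUo : IsOpen {s : ℂ | 0 < s.re} := isOpen_lt continuous_const continuous_re
  have hconv : IsPreconnected {s : ℂ | 0 < s.re} := (convex_halfSpace_re_gt 0).isPreconnected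
  have hG : DifferentiableOn ℂ (fun s : ℂ => ∫ t : ℝ in Ioi 1, ((t - ⌊t⌋₊ : ℝ) : ℂ) *
      (t : ℂ) ^ (-(s + 1))) {s : ℂ | 0 < s.re} := by
    refine differentiableOn_integral_of_dominated hUo
      (fun s _ => (measurable_sub_floor_mul_cpow s).aestronglyMeasurable) ?_ fun s₀ hs₀ => ?_
    · filter_upwards [ae_restrict_mem measurableSet_Ioi] with t ht
      have ht0 : (t : ℂ) ≠ 0 := ofReal_ne_zero.mpr (ne_of_gt (one_pos.trans ht))
      intro s _
      have h1 : DifferentiableAt ℂ (fun s : ℂ => -(s + 1)) s := by fun_prop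
      exact ((h1.const_cpow (Or.inl ht0)).const_mul _).differentiableWithinAt
    · have hs₀' : 0 < s₀.re := hs₀
      refine ⟨s₀.re / 2, by positivity, fun t => t ^ (-(s₀.re / 2) - 1),
        integrableOn_Ioi_rpow_of_lt (by linarith) one_pos, ?_⟩
      filter_upwards [ae_restrict_mem measurableSet_Ioi] with t ht s hs
      refine norm_sub_floor_mul_cpow_le ht ?_
      have hre : |(s - s₀).re| < s₀.re / 2 :=
        (abs_re_le_norm _).trans_lt (by simpa [dist_eq_norm] using hs)
      rw [sub_re, abs_lt] at hre
      linarith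
  have hR : DifferentiableOn ℂ (fun s : ℂ => 1 - s * ∫ t : ℝ in Ioi 1, ((t - ⌊t⌋₊ : ℝ) : ℂ) *
      (t : ℂ) ^ (-(s + 1))) {s : ℂ | 0 < s.re} :=
    (differentiableOn_const _).sub (differentiableOn_id.mul hG)
  refine (differentiable_riemannZeta₀.differentiableOn.analyticOnNhd
    hUo).eqOn_of_preconnected_of_eventuallyEq (hR.analyticOnNhd hUo) hconv (z₀ := 2) (by simp) ?_ hs
  filter_upwards [(isOpen_lt continuous_const continuous_re).mem_nhds
    (show (1 : ℝ) < (2 : ℂ).re by simp)] with z hz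
  exact riemannZeta₀_eq_of_one_lt hz

/-- Linear growth of the zeta function to the right of the critical line. -/
theorem norm_riemannZeta_le {s : ℂ} (hs : 1 / 2 ≤ s.re) (him : 1 ≤ |s.im|) :
    ‖riemannZeta s‖ ≤ 2 + 2 * ‖s‖ := by
  have hs1 : s ≠ 1 := fun h => by simp [h] at him; linarith
  have h1 : 1 ≤ ‖s - 1‖ := him.trans (by simpa using abs_im_le_norm (s - 1))
  have h2 : ‖(s - 1)⁻¹‖ ≤ 1 := by rw [norm_inv]; exact inv_le_one_of_one_le₀ h1
  have h3 : ‖∫ t : ℝ in Ioi 1, ((t - ⌊t⌋₊ : ℝ) : ℂ) * (t : ℂ) ^ (-(s + 1))‖ ≤ 2 := by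
    refine (norm_integral_le_of_norm_le (integrableOn_Ioi_rpow_of_lt (a := -(1 / 2) - 1)
      (by norm_num) one_pos) ?_).trans_eq ?_
    · filter_upwards [ae_restrict_mem measurableSet_Ioi] with t ht
      exact norm_sub_floor_mul_cpow_le ht hs
    · rw [integral_Ioi_rpow_of_lt (by norm_num) one_pos]
      norm_num
  rw [riemannZeta_eq_inv_sub_add hs1, riemannZeta₀_eq (by linarith)]
  calc _ ≤ ‖(s - 1)⁻¹‖ + (‖(1 : ℂ)‖ + ‖s * ∫ t : ℝ in Ioi 1, ((t - ⌊t⌋₊ : ℝ) : ℂ) *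
        (t : ℂ) ^ (-(s + 1))‖) := (norm_add_le _ _).trans (by gcongr; exact norm_sub_le _ _)
    _ ≤ 1 + (1 + ‖s‖ * 2) := by
        rw [norm_one, norm_mul]; gcongr
    _ = _ := by ring

/-- On the line `Re s = 2` the first term of the series dominates the others: `2 - ζ(2) > 1 / 3`. -/
theorem third_le_norm_riemannZeta {s : ℂ} (hs : s.re = 2) : 1 / 3 ≤ ‖riemannZeta s‖ := by
  have hs1 : 1 < s.re := by rw [hs]; norm_num
  have hn : ∀ n : ℕ, ‖1 / ((n : ℂ) + 1) ^ s‖ = 1 / ((n + 1 : ℕ) : ℝ) ^ 2 := by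
    intro n
    rw [norm_div, norm_one, show ((n : ℂ) + 1) = (((n + 1 : ℕ) : ℝ) : ℂ) by push_cast; ring,
      norm_cpow_eq_rpow_re_of_pos (by positivity), hs]
    norm_num
  have hz2 := hasSum_zeta_two
  have hz2' : HasSum (fun n : ℕ => 1 / ((n + 1 : ℕ) : ℝ) ^ 2) (Real.pi ^ 2 / 6) := by
    rw [hasSum_nat_add_iff (f := fun n : ℕ => 1 / ((n : ℕ) : ℝ) ^ 2) 1]
    simpa using hz2
  have hsum : Summable fun n : ℕ => 1 / ((n : ℂ) + 1) ^ s :=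
    Summable.of_norm (by simp only [hn]; exact hz2'.summable)
  have hz3 : HasSum (fun n : ℕ => 1 / ((n + 1 + 1 : ℕ) : ℝ) ^ 2) (Real.pi ^ 2 / 6 - 1) := by
    rw [hasSum_nat_add_iff (f := fun n : ℕ => 1 / ((n + 1 : ℕ) : ℝ) ^ 2) 1]
    simpa using hz2'
  rw [zeta_eq_tsum_one_div_nat_add_one_cpow hs1, hsum.tsum_eq_zero_add]
  have h1 : ‖∑' n : ℕ, 1 / (((n + 1 : ℕ) : ℂ) + 1) ^ s‖ ≤ Real.pi ^ 2 / 6 - 1 := by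
    refine tsum_of_norm_bounded hz3 fun n => ?_
    rw [hn]
  have h2 : ‖1 / (((0 : ℕ) : ℂ) + 1) ^ s‖ = 1 := by simp
  have h3 := norm_sub_le_norm_add (1 / (((0 : ℕ) : ℂ) + 1) ^ s)
    (∑' n : ℕ, 1 / (((n + 1 : ℕ) : ℂ) + 1) ^ s)
  rw [h2] at h3
  have h4 := Real.pi_lt_d2
  have h5 := Real.pi_pos
  nlinarith

theorem riemannZeta_ne_zero_of_RH (hRH : RiemannHypothesis) {s : ℂ} (hs : 1 / 2 < s.re)
    (hs1 : s ≠ 1) : riemannZeta s ≠ 0 := by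
  intro h
  have := hRH s h (by
    rintro ⟨n, rfl⟩
    have hn : (0 : ℝ) ≤ n := Nat.cast_nonneg n
    simp at hs
    linarith) hs1
  linarith

/-- The logarithmic derivative is bounded by the logarithm of the function: for a function without
zeros on a disc, the Borel–Carathéodory theorem and Cauchy's estimate. -/
theorem norm_logDeriv_le_of_ne_zero {F : ℂ → ℂ} {c w : ℂ} {R r δ M : ℝ} (hδ : 0 < δ) (hM : 0 < M)
    (hw : ‖w‖ ≤ r) (hr : 0 ≤ r) (hrR : r + 2 * δ = R)
    (hF : DifferentiableOn ℂ F (Metric.ball c R)) (hF0 : ∀ z ∈ Metric.ball c R, F z ≠ 0)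
    (hFM : ∀ z ∈ Metric.ball c R, ‖F z‖ ≤ ‖F c‖ * Real.exp M) :
    ‖deriv F (c + w) / F (c + w)‖ ≤ 2 * M * R / δ ^ 2 := by
  have hR : 0 < R := by linarith
  have hopen : IsOpen (Metric.ball c R) := Metric.isOpen_ball
  have hc : c ∈ Metric.ball c R := Metric.mem_ball_self hR
  have hL : DifferentiableOn ℂ (fun z => deriv F z / F z) (Metric.ball c R) :=
    (hF.deriv hopen).div hF hF0
  obtain ⟨g, hgc, hg⟩ := hL.isExactOn_ball.with_val_at c 0
  have hexp : ∀ z ∈ Metric.ball c R, F z = F c * cexp (g z) := by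
    have hconst : ∀ z ∈ Metric.ball c R, HasDerivAt (fun z => F z * cexp (-g z)) 0 z := by
      intro z hz
      have h1 := (hF.differentiableAt (hopen.mem_nhds hz)).hasDerivAt
      have h2 := (hg z hz).neg.cexp
      refine (h1.mul h2).congr_deriv ?_
      have := hF0 z hz
      field_simp
      ring
    intro z hz
    have := (convex_ball c R).is_const_of_fderivWithin_eq_zero (𝕜 := ℂ)
      (f := fun z => F z * cexp (-g z))
      (fun z hz => (hconst z hz).differentiableAt.differentiableWithinAt)
      (fun z hz => by
        rw [fderivWithin_of_isOpen hopen hz]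
        ext
        simp [(hconst z hz).hasFDerivAt.fderiv]) hz hc
    simp only [hgc, neg_zero, exp_zero, mul_one] at this
    rw [← this, mul_assoc, ← exp_add]
    simp
  have hre : ∀ z ∈ Metric.ball c R, (g z).re ≤ M := by
    intro z hz
    have h1 := hFM z hz
    rw [hexp z hz, norm_mul, norm_exp] at h1
    exact Real.exp_le_exp.mp (le_of_mul_le_mul_left h1 (norm_pos_iff.mpr (hF0 c hc)))
  have hmem : ∀ v ∈ Metric.ball (0 : ℂ) R, c + v ∈ Metric.ball c R := fun v hv => by
    simpa using hv
  have hBC : ∀ v : ℂ, ‖v‖ ≤ r + δ → ‖g (c + v)‖ ≤ 2 * M * R / δ := by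
    intro v hv
    have hvR : ‖v‖ < R := by linarith
    have := borelCaratheodory_zero (f := fun v => g (c + v)) hM
      (fun v hv => ((hg _ (hmem v hv)).differentiableAt.comp v
        ((differentiableAt_id).const_add c)).differentiableWithinAt)
      (fun v hv => hre _ (hmem v hv)) hR (by simpa using hvR) (by simp [hgc])
    refine this.trans ?_
    gcongr
    linarith
  have hball : ∀ z ∈ Metric.closedBall (c + w) δ, ‖z - c‖ ≤ r + δ := by
    intro z hz
    rw [Metric.mem_closedBall, dist_eq_norm] at hz
    calc ‖z - c‖ = ‖(z - (c + w)) + w‖ := by congr 1; ring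
      _ ≤ δ + r := (norm_add_le _ _).trans (add_le_add hz hw)
      _ = _ := add_comm _ _
  have hsub : ∀ z ∈ Metric.closedBall (c + w) δ, z ∈ Metric.ball c R := fun z hz => by
    rw [Metric.mem_ball, dist_eq_norm]
    linarith [hball z hz]
  have hderiv := norm_deriv_le_of_forall_mem_sphere_norm_le (f := g) (c := c + w)
    (C := 2 * M * R / δ) hδ ((DifferentiableOn.mono (fun z hz => (hg z hz).differentiableAt.differentiableWithinAt)
      hsub).diffContOnCl_ball le_rfl) fun z hz => by
        have := hBC (z - c) (hball z (Metric.sphere_subset_closedBall hz))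
        simpa using this
  rw [(hg _ (hsub _ (Metric.mem_closedBall_self hδ.le))).deriv] at hderiv
  refine hderiv.trans_eq ?_
  field_simp

theorem exists_norm_zetaLogDeriv_le_of_one_lt {a : ℝ} (ha : 1 < a) :
    ∃ C, 0 ≤ C ∧ ∀ z : ℂ, a ≤ z.re → ‖zetaLogDeriv z‖ ≤ C := by
  have hs : LSeriesSummable (fun n => (ArithmeticFunction.vonMangoldt n : ℂ)) (a : ℂ) :=
    ArithmeticFunction.LSeriesSummable_vonMangoldt (by simpa using ha)
  refine ⟨∑' n, ‖LSeries.term (fun n => (ArithmeticFunction.vonMangoldt n : ℂ)) a n‖,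
    tsum_nonneg fun _ => norm_nonneg _, fun z hz => ?_⟩
  have h := ArithmeticFunction.LSeries_vonMangoldt_eq_deriv_riemannZeta_div (s := z) (by linarith)
  rw [zetaLogDeriv, ← norm_neg, ← neg_div, ← h, LSeries]
  exact tsum_of_norm_bounded hs.norm.hasSum fun n =>
    LSeries.norm_term_le_of_re_le_re _ (by simpa using hz) n

/-- Under the Riemann hypothesis, `ζ'/ζ` grows more slowly than any power to the right of the
critical line. -/
theorem exists_norm_zetaLogDeriv_le_of_RH (hRH : RiemannHypothesis) {δ ε : ℝ} (hδ : 0 < δ)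
    (hε : 0 < ε) :
    ∃ C, 0 ≤ C ∧ ∀ z : ℂ, 1 / 2 + δ ≤ z.re → 3 ≤ |z.im| → ‖zetaLogDeriv z‖ ≤ C * |z.im| ^ ε := by
  -- a smaller `δ` gives a stronger statement
  wlog hδ1 : δ < 1 / 2 generalizing δ
  · obtain ⟨C, hC0, hC⟩ := this (δ := 1 / 4) (by norm_num) (by norm_num)
    exact ⟨C, hC0, fun z hz => hC z (by linarith)⟩
  obtain ⟨C₁, hC₁0, hC₁⟩ := exists_norm_zetaLogDeriv_le_of_one_lt (a := 3 / 2) (by norm_num)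
  set κ : ℝ := 2 * (3 / 2) / (δ / 4) ^ 2 with hκ
  have hκ0 : 0 < κ := by positivity
  refine ⟨C₁ + κ * ((15 : ℝ) ^ ε / ε), by positivity, fun z hz him => ?_⟩
  set y := |z.im| with hy
  have hy0 : 0 < y := by linarith
  have hye : 1 ≤ y ^ ε := Real.one_le_rpow (by linarith) hε.le
  rcases le_or_gt (3 / 2) z.re with h | h
  · have h1 := hC₁ z h
    have h2 : 0 ≤ κ * ((15 : ℝ) ^ ε / ε) := by positivity
    nlinarith
  have hM : 0 < Real.log (15 * y) := Real.log_pos (by linarith)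
  -- discs about `2 + i Im z`, which stay to the right of the critical line and away from the pole;
  -- there `ζ` has at most linear growth, so that the bound is of logarithmic size
  have key := norm_logDeriv_le_of_ne_zero (F := riemannZeta) (c := 2 + z.im * I)
    (w := (z.re - 2 : ℝ)) (R := 3 / 2 - δ / 2) (r := 3 / 2 - δ) (δ := δ / 4)
    (M := Real.log (15 * y)) (by positivity) hM ?_ (by linarith) (by ring) ?_ ?_ ?_
  · have e : (2 : ℂ) + z.im * I + (z.re - 2 : ℝ) = z := by
      apply Complex.ext <;> simp
    rw [e] at key
    rw [zetaLogDeriv]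
    refine key.trans ?_
    have h1 : Real.log (15 * y) ≤ (15 : ℝ) ^ ε * y ^ ε / ε := by
      rw [← Real.mul_rpow (by norm_num) hy0.le]
      exact Real.log_le_rpow_div (by positivity) hε
    calc 2 * Real.log (15 * y) * (3 / 2 - δ / 2) / (δ / 4) ^ 2
        ≤ 2 * ((15 : ℝ) ^ ε * y ^ ε / ε) * (3 / 2) / (δ / 4) ^ 2 := by
          gcongr <;> linarith
      _ = κ * ((15 : ℝ) ^ ε / ε) * y ^ ε := by rw [hκ]; ring
      _ ≤ _ := by
          gcongr
          linarith
  · rw [norm_real, Real.norm_eq_abs, abs_le]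
    constructor <;> linarith
  all_goals
    have hmem : ∀ v ∈ Metric.ball ((2 : ℂ) + z.im * I) (3 / 2 - δ / 2),
        1 / 2 < v.re ∧ 1 ≤ |v.im| ∧ ‖v‖ ≤ 7 / 2 + y := by
      intro v hv
      rw [Metric.mem_ball, dist_eq_norm] at hv
      have h1 := (abs_re_le_norm _).trans_lt hv
      have h2 := (abs_im_le_norm _).trans_lt hv
      simp at h1 h2
      rw [abs_lt] at h1
      refine ⟨by linarith [h1.1], ?_, ?_⟩
      · have := abs_sub_abs_le_abs_sub z.im v.im
        rw [abs_sub_comm] at this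
        linarith
      · calc ‖v‖ = ‖(v - ((2 : ℂ) + z.im * I)) + ((2 : ℂ) + z.im * I)‖ := by congr 1; ring
          _ ≤ (3 / 2 - δ / 2) + (2 + y) := by
              refine (norm_add_le _ _).trans (add_le_add hv.le ((norm_add_le _ _).trans ?_))
              simp [hy]
          _ ≤ _ := by linarith
    have hne1 : ∀ v ∈ Metric.ball ((2 : ℂ) + z.im * I) (3 / 2 - δ / 2), v ≠ 1 := by
      rintro v hv rfl
      have := (hmem 1 hv).2.1
      simp at this
      linarith
  · intro v hv
    exact (differentiableAt_riemannZeta (hne1 v hv)).differentiableWithinAt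
  · intro v hv
    exact riemannZeta_ne_zero_of_RH hRH (hmem v hv).1 (hne1 v hv)
  · intro v hv
    obtain ⟨h1, h2, h3⟩ := hmem v hv
    have h4 := norm_riemannZeta_le h1.le h2
    have h5 := third_le_norm_riemannZeta (s := 2 + z.im * I) (by simp)
    rw [Real.exp_log (by positivity)]
    have h6 : 5 * y ≤ ‖riemannZeta (2 + z.im * I)‖ * (15 * y) := by nlinarith
    linarith

end

/-! ### Majorants for the kernel of the repeated integral -/

section

open Filter Topology Complex

theorem one_add_abs_pos (t : ℝ) : 0 < 1 + |t| := by linarith [abs_nonneg t]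

theorem continuous_one_add_abs_rpow (r : ℝ) : Continuous fun t : ℝ => (1 + |t|) ^ r :=
  (continuous_const.add continuous_abs).rpow_const fun t =>
    Or.inl (one_add_abs_pos t).ne'

theorem integrable_one_add_abs_rpow {r : ℝ} (hr : r < -1) :
    Integrable fun t : ℝ => (1 + |t|) ^ r := by
  have := integrable_one_add_norm (E := ℝ) (μ := volume) (r := -r) (by simp; linarith)
  simpa using this

theorem one_le_one_add_abs_rpow (t : ℝ) {r : ℝ} (hr : 0 ≤ r) : 1 ≤ (1 + |t|) ^ r :=
  Real.one_le_rpow (by linarith [abs_nonneg t]) hr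

/-- The elementary inequality behind the absolute convergence of the repeated integral: the larger
of the two factors on the left lends half a power of decay in `t`. -/
theorem one_add_abs_rpow_mul_inv_le (t u : ℝ) {p : ℝ} (hp : 1 / 2 ≤ p) :
    (1 + |u|) ^ (-p) * (1 + |t + u|)⁻¹ ≤
      2 * (1 + |t|) ^ (-(1 / 2) : ℝ) *
        ((1 + |u|) ^ (-p - 1 / 2) + (1 + |t + u|) ^ (-p - 1 / 2)) := by
  set a := 1 + |u| with ha
  set b := 1 + |t + u| with hb
  set c := 1 + |t| with hc
  have ha1 : 1 ≤ a := by linarith [abs_nonneg u]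
  have hb1 : 1 ≤ b := by linarith [abs_nonneg (t + u)]
  have hc1 : 1 ≤ c := by linarith [abs_nonneg t]
  have ha0 : 0 < a := by linarith
  have hb0 : 0 < b := by linarith
  have hc0 : 0 < c := by linarith
  have habc : c ≤ a + b := by
    have : |t| ≤ |t + u| + |u| := by
      have := abs_sub (t + u) u
      rwa [add_sub_cancel_right] at this
    linarith
  have half : ∀ x : ℝ, 0 < x → c ≤ 2 * x → x ^ (-(1 / 2) : ℝ) ≤ 2 * c ^ (-(1 / 2) : ℝ) := by
    intro x hx hcx
    have h1 : (2 * x) ^ (-(1 / 2) : ℝ) ≤ c ^ (-(1 / 2) : ℝ) :=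
      Real.rpow_le_rpow_of_nonpos hc0 hcx (by norm_num)
    rw [Real.mul_rpow (by norm_num) hx.le] at h1
    have h2 : (1 / 2 : ℝ) ≤ (2 : ℝ) ^ (-(1 / 2) : ℝ) := by
      calc (1 / 2 : ℝ) = (2 : ℝ) ^ (-1 : ℝ) := by rw [Real.rpow_neg_one]; norm_num
        _ ≤ _ := Real.rpow_le_rpow_of_exponent_le (by norm_num) (by norm_num)
    have h3 : 0 ≤ x ^ (-(1 / 2) : ℝ) := by positivity
    nlinarith
  have pa : 0 ≤ a ^ (-p - 1 / 2) := by positivity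
  have pb : 0 ≤ b ^ (-p - 1 / 2) := by positivity
  rw [← Real.rpow_neg_one b]
  rcases le_total a b with h | h
  · have h1 : b ^ (-1 : ℝ) = b ^ (-(1 / 2) : ℝ) * b ^ (-(1 / 2) : ℝ) := by
      rw [← Real.rpow_add hb0]; norm_num
    have h2 : b ^ (-(1 / 2) : ℝ) ≤ a ^ (-(1 / 2) : ℝ) :=
      Real.rpow_le_rpow_of_nonpos ha0 h (by norm_num)
    calc a ^ (-p) * b ^ (-1 : ℝ) = b ^ (-(1 / 2) : ℝ) * (a ^ (-p) * b ^ (-(1 / 2) : ℝ)) := by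
          rw [h1]; ring
      _ ≤ (2 * c ^ (-(1 / 2) : ℝ)) * (a ^ (-p) * a ^ (-(1 / 2) : ℝ)) := by
          gcongr
          exact half b hb0 (by linarith)
      _ = (2 * c ^ (-(1 / 2) : ℝ)) * a ^ (-p - 1 / 2) := by
          rw [← Real.rpow_add ha0]; congr 1
      _ ≤ _ := by gcongr; linarith
  · have h1 : a ^ (-p) = a ^ (-(1 / 2) : ℝ) * a ^ (-(p - 1 / 2)) := by
      rw [← Real.rpow_add ha0]; congr 1; ring
    have h2 : a ^ (-(p - 1 / 2)) ≤ b ^ (-(p - 1 / 2)) :=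
      Real.rpow_le_rpow_of_nonpos hb0 h (by linarith)
    calc a ^ (-p) * b ^ (-1 : ℝ) = a ^ (-(1 / 2) : ℝ) * (a ^ (-(p - 1 / 2)) * b ^ (-1 : ℝ)) := by
          rw [h1]; ring
      _ ≤ (2 * c ^ (-(1 / 2) : ℝ)) * (b ^ (-(p - 1 / 2)) * b ^ (-1 : ℝ)) := by
          gcongr
          exact half a ha0 (by linarith)
      _ = (2 * c ^ (-(1 / 2) : ℝ)) * b ^ (-p - 1 / 2) := by
          rw [← Real.rpow_add hb0]; congr 2; ring
      _ ≤ _ := by gcongr; linarith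

theorem integrable_prod_one_add_abs {p : ℝ} (hp : 1 / 2 < p) :
    Integrable fun q : ℝ × ℝ =>
      (1 + |q.1|) ^ (-p) * (1 + |q.2|) ^ (-p) * (1 + |q.1 + q.2|)⁻¹ := by
  have hj : Integrable fun t : ℝ => (1 + |t|) ^ (-p - 1 / 2) :=
    integrable_one_add_abs_rpow (by linarith)
  have h1 : Integrable fun q : ℝ × ℝ => (1 + |q.1|) ^ (-p - 1 / 2) * (1 + |q.2|) ^ (-p - 1 / 2) :=
    hj.mul_prod hj
  have h2 : Integrable fun q : ℝ × ℝ =>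
      (1 + |q.1|) ^ (-p - 1 / 2) * (1 + |q.1 + q.2|) ^ (-p - 1 / 2) := by
    have := (measurePreserving_prod_add (volume : Measure ℝ)
      (volume : Measure ℝ)).integrable_comp_of_integrable h1
    exact this
  have hcont : Continuous fun q : ℝ × ℝ =>
      (1 + |q.1|) ^ (-p) * (1 + |q.2|) ^ (-p) * (1 + |q.1 + q.2|)⁻¹ := by
    refine (((continuous_one_add_abs_rpow (-p)).comp continuous_fst).mul
      ((continuous_one_add_abs_rpow (-p)).comp continuous_snd)).mul ?_
    exact Continuous.inv₀ (by fun_prop) fun q => (one_add_abs_pos _).ne'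
  refine ((h1.add h2).const_mul 2).mono' hcont.aestronglyMeasurable
    (Eventually.of_forall fun q => ?_)
  have a1 := one_add_abs_pos q.1
  have a2 := one_add_abs_pos q.2
  have a3 := one_add_abs_pos (q.1 + q.2)
  rw [Real.norm_of_nonneg (by positivity), mul_assoc]
  calc _ ≤ (1 + |q.1|) ^ (-p) * (2 * (1 + |q.1|) ^ (-(1 / 2) : ℝ) *
        ((1 + |q.2|) ^ (-p - 1 / 2) + (1 + |q.1 + q.2|) ^ (-p - 1 / 2))) := by
        gcongr _ * ?_
        exact one_add_abs_rpow_mul_inv_le q.1 q.2 hp.le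
    _ = 2 * (((1 + |q.1|) ^ (-p) * (1 + |q.1|) ^ (-(1 / 2) : ℝ)) *
        ((1 + |q.2|) ^ (-p - 1 / 2) + (1 + |q.1 + q.2|) ^ (-p - 1 / 2))) := by ring
    _ = _ := by
        rw [← Real.rpow_add a1]
        simp only [Pi.add_apply]
        rw [show -p + -(1 / 2) = -p - 1 / 2 by ring]
        ring

theorem integrable_one_add_abs_mul_inv {p : ℝ} (hp : 1 / 2 < p) (t : ℝ) :
    Integrable fun u : ℝ => (1 + |u|) ^ (-p) * (1 + |t + u|)⁻¹ := by
  have hj : Integrable fun t : ℝ => (1 + |t|) ^ (-p - 1 / 2) :=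
    integrable_one_add_abs_rpow (by linarith)
  have hcont : Continuous fun u : ℝ => (1 + |u|) ^ (-p) * (1 + |t + u|)⁻¹ :=
    (continuous_one_add_abs_rpow (-p)).mul
      (Continuous.inv₀ (by fun_prop) fun q => (one_add_abs_pos _).ne')
  refine ((hj.add (hj.comp_add_left t)).const_mul (2 * (1 + |t|) ^ (-(1 / 2) : ℝ))).mono'
    hcont.aestronglyMeasurable (Eventually.of_forall fun u => ?_)
  have a2 := one_add_abs_pos u
  have a3 := one_add_abs_pos (t + u)
  rw [Real.norm_of_nonneg (by positivity)]
  exact one_add_abs_rpow_mul_inv_le t u hp.le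

/-- The standing assumptions on the parameters of the path. -/
structure PathParams (c₁ c₂ B : ℝ) : Prop where
  lower : -(3 / 2) < c₁
  neg : c₁ < 0
  pos : 0 < c₂
  upper : c₂ < 1 / 2
  height : 0 < B

theorem PathParams.lt {c₁ c₂ B : ℝ} (h : PathParams c₁ c₂ B) : c₁ < c₂ := h.neg.trans h.pos

theorem PathParams.continuous {c₁ c₂ B : ℝ} (h : PathParams c₁ c₂ B) :
    Continuous (pathL c₁ c₂ B) := continuous_pathL h.lt h.height

/-- The decay of `M^lam(z + w)` along the path, in the form used for the majorant. The exponent is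
`c₁ - 1 / 2` from Stirling's bound for `Γ`, weakened by `- c₁ / 4` to make room for `ζ'/ζ`. -/
theorem exists_mellinM_pathL_majorant {E : ℝ → ℝ} (hE : IsSmoothSieve E) {lam : ℝ}
    (hlam : 0 < lam) {c₁ c₂ B : ℝ} (h : PathParams c₁ c₂ B) :
    ∃ m : ℝ → ℝ, (∀ t u, ‖mellinM E lam (pathL c₁ c₂ B t + pathL c₁ c₂ B u)‖ ≤ m (t + u)) ∧
      (Integrable fun q : ℝ × ℝ => (1 + |q.1|) ^ (-(1 / 2 - 3 * c₁ / 4)) *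
        (1 + |q.2|) ^ (-(1 / 2 - 3 * c₁ / 4)) * m (q.1 + q.2)) ∧
      ∀ t, Integrable fun u => (1 + |u|) ^ (-(1 / 2 - 3 * c₁ / 4)) * m (t + u) := by
  have hneg := h.neg
  have hlow := h.lower
  have hpos := h.pos
  have hup := h.upper
  have hre : ∀ t u, (pathL c₁ c₂ B t + pathL c₁ c₂ B u).re ∈ Icc (2 * c₁) (2 * c₂) := by
    intro t u
    have h1 := pathL_re_mem h.lt h.height t
    have h2 := pathL_re_mem h.lt h.height u
    rw [add_re]
    exact ⟨by linarith [h1.1, h2.1], by linarith [h1.2, h2.2]⟩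
  -- far to the left the decay of the Gamma factors suffices; otherwise `-2 < 2 * c₁`, and the decay
  -- of `M^lam` in strips to the right of `-2` is at hand
  rcases le_or_gt c₁ (-(3 / 4)) with hc | hc
  · obtain ⟨C, hC0, hC⟩ := exists_norm_mellinM_le hE hlam (a := 2 * c₁) (b := 2 * c₂)
      (by linarith) (by linarith)
    have hj : Integrable fun t : ℝ => (1 + |t|) ^ (-(1 / 2 - 3 * c₁ / 4)) :=
      integrable_one_add_abs_rpow (by linarith)
    exact ⟨fun _ => C, fun t u => hC _ (hre t u), (hj.mul_prod hj).mul_const C,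
      fun t => hj.mul_const C⟩
  · obtain ⟨C, hC0, hC⟩ := exists_norm_mellinM_mul_le hE hlam (a := 2 * c₁) (b := 2 * c₂)
      (by linarith) (by linarith)
    set d := c₂ - c₁ with hd
    have hd0 : 0 < d := by linarith
    refine ⟨fun r => (1 + 2 * d) * C * (1 + |r|)⁻¹, fun t u => ?_, ?_, fun t => ?_⟩
    · have h0 := hC _ (hre t u)
      have h1 := abs_pathL_im_sub_le h.lt h.height t
      have h2 := abs_pathL_im_sub_le h.lt h.height u
      set y := (pathL c₁ c₂ B t + pathL c₁ c₂ B u).im with hy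
      have h3 : |t + u| ≤ |y| + 2 * d := by
        have e : t + u = y + (-((pathL c₁ c₂ B t).im - t) + -((pathL c₁ c₂ B u).im - u)) := by
          rw [hy, add_im]; ring
        calc |t + u| ≤ |y| + |-((pathL c₁ c₂ B t).im - t) + -((pathL c₁ c₂ B u).im - u)| := by
              rw [e]; exact abs_add_le _ _
          _ ≤ |y| + (|-((pathL c₁ c₂ B t).im - t)| + |-((pathL c₁ c₂ B u).im - u)|) := by
              gcongr; exact abs_add_le _ _
          _ ≤ _ := by rw [abs_neg, abs_neg]; linarith
      have h4 : 1 + |t + u| ≤ (1 + 2 * d) * (1 + |y|) := by nlinarith [abs_nonneg y]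
      beta_reduce
      rw [← div_eq_mul_inv, le_div_iff₀ (one_add_abs_pos _)]
      have h5 := mul_le_mul_of_nonneg_left h4
        (norm_nonneg (mellinM E lam (pathL c₁ c₂ B t + pathL c₁ c₂ B u)))
      have h6 := mul_le_mul_of_nonneg_left h0 (by positivity : 0 ≤ 1 + 2 * d)
      linarith
    · refine ((integrable_prod_one_add_abs (p := 1 / 2 - 3 * c₁ / 4) (by linarith)).const_mul
        ((1 + 2 * d) * C)).congr (Eventually.of_forall fun q => ?_)
      simp only; ring
    · refine ((integrable_one_add_abs_mul_inv (p := 1 / 2 - 3 * c₁ / 4) (by linarith) t).const_mul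
        ((1 + 2 * d) * C)).congr (Eventually.of_forall fun q => ?_)
      simp only; ring

/-- Stirling's bound along the path, with the exponential decay made explicit: the
growth of the cosine can cancel it completely. -/
theorem exists_norm_Gamma_pathL_le {c₁ c₂ B : ℝ} (h : PathParams c₁ c₂ B) :
    ∃ C, 0 ≤ C ∧ ∀ t, ‖Gamma (pathL c₁ c₂ B t)‖ *
      Real.exp (Real.pi / 2 * |(pathL c₁ c₂ B t).im|) ≤ C * (1 + |t|) ^ (c₁ - 1 / 2) := by
  have hneg := h.neg
  have hlow := h.lower
  have hB := h.height
  obtain ⟨C, hC⟩ := exists_norm_Gamma_le (x := c₁) (by linarith) hB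
  set d := c₂ - c₁ with hd
  have hd0 : 0 < d := by linarith [h.lt]
  set κ := (1 + d) / B + 1 with hκ
  have hκ0 : 0 < κ := by positivity
  have hcont := h.continuous
  have hf : Continuous fun t => Gamma (pathL c₁ c₂ B t) *
      (Real.exp (Real.pi / 2 * |(pathL c₁ c₂ B t).im|) : ℝ) :=
    (continuous_Gamma_pathL h.lt h.height h.pos).mul (by fun_prop)
  obtain ⟨C', hC'0, hC'⟩ := exists_norm_le_of_far (R := B + d) (C := |C| * κ ^ (-(c₁ - 1 / 2))) hf
    (continuous_one_add_abs_rpow (c₁ - 1 / 2))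
    (fun t => Real.rpow_pos_of_pos (one_add_abs_pos t) _) fun t ht => by
      obtain ⟨hre, him⟩ := pathL_of_lt_abs h.lt h.height ht
      set y := (pathL c₁ c₂ B t).im with hy
      have hz : pathL c₁ c₂ B t = c₁ + y * I :=
        Complex.ext (by simp [hre]) (by simp [hy])
      have hy0 : 0 < |y| := hB.trans_le him
      have h1 := hC y him
      have h2 := abs_pathL_im_sub_le h.lt h.height t
      have h3 : 1 + |t| ≤ κ * |y| := by
        have : |t| ≤ |y| + d := by
          have := abs_sub_abs_le_abs_sub t y
          rw [abs_sub_comm] at this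
          linarith
        have h4 : 1 + d ≤ (1 + d) / B * |y| := by
          rw [div_mul_eq_mul_div, le_div_iff₀ hB]
          gcongr
        rw [hκ, add_mul, one_mul]
        linarith
      have h5 : |y| ^ (c₁ - 1 / 2) ≤ κ ^ (-(c₁ - 1 / 2)) * (1 + |t|) ^ (c₁ - 1 / 2) := by
        have := Real.rpow_le_rpow_of_nonpos (one_add_abs_pos t) h3 (by linarith : c₁ - 1 / 2 ≤ 0)
        rw [Real.mul_rpow hκ0.le hy0.le] at this
        rw [Real.rpow_neg hκ0.le, inv_mul_eq_div, le_div_iff₀ (by positivity)]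
        linarith
      rw [norm_mul, norm_real, Real.norm_of_nonneg (Real.exp_pos _).le, hz]
      calc _ ≤ (C * (|y| ^ (c₁ - 1 / 2) * Real.exp (-(Real.pi / 2 * |y|)))) *
            Real.exp (Real.pi / 2 * |y|) := by gcongr
        _ = C * |y| ^ (c₁ - 1 / 2) := by
            rw [mul_assoc, mul_assoc, ← Real.exp_add, neg_add_cancel, Real.exp_zero, mul_one]
        _ ≤ |C| * |y| ^ (c₁ - 1 / 2) := by gcongr; exact le_abs_self C
        _ ≤ |C| * (κ ^ (-(c₁ - 1 / 2)) * (1 + |t|) ^ (c₁ - 1 / 2)) := by gcongr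
        _ = _ := by ring
  refine ⟨C', hC'0, fun t => ?_⟩
  have := hC' t
  rwa [norm_mul, norm_real, Real.norm_of_nonneg (Real.exp_pos _).le] at this

/-- The kernel `Γ(z) Γ(w) M^lam(z + w) exp(iθ(z - w)) dz dw` on the parametrized path. For
`θ = ± π / 2` the half sum is the kernel of the repeated integral without its zeta factors. -/
def expKernel (E : ℝ → ℝ) (lam c₁ c₂ B θ : ℝ) (q : ℝ × ℝ) : ℂ :=
  Gamma (pathL c₁ c₂ B q.1) * Gamma (pathL c₁ c₂ B q.2) *
    mellinM E lam (pathL c₁ c₂ B q.1 + pathL c₁ c₂ B q.2) *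
    cexp (θ * I * (pathL c₁ c₂ B q.1 - pathL c₁ c₂ B q.2)) *
    deriv (pathL c₁ c₂ B) q.1 * deriv (pathL c₁ c₂ B) q.2

theorem continuous_mellinM_pathL {E : ℝ → ℝ} (hE : IsSmoothSieve E) {lam : ℝ}
    (hlam : 0 < lam) {c₁ c₂ B : ℝ} (h : PathParams c₁ c₂ B) :
    Continuous fun q : ℝ × ℝ => mellinM E lam (pathL c₁ c₂ B q.1 + pathL c₁ c₂ B q.2) := by
  have hcont := h.continuous
  refine (continuousOn_mellinM hE hlam).comp_continuous
    (f := fun q : ℝ × ℝ => pathL c₁ c₂ B q.1 + pathL c₁ c₂ B q.2) (by fun_prop) fun q => ?_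
  have h1 := pathL_re_mem h.lt h.height q.1
  have h2 := pathL_re_mem h.lt h.height q.2
  simp only [mem_ofPred_eq, add_re]
  exact ⟨by linarith [h1.1, h2.1, h.lower], by linarith [h1.2, h2.2, h.upper]⟩

theorem measurable_expKernel {E : ℝ → ℝ} (hE : IsSmoothSieve E) {lam : ℝ}
    (hlam : 0 < lam) {c₁ c₂ B : ℝ} (h : PathParams c₁ c₂ B) (θ : ℝ) :
    Measurable (expKernel E lam c₁ c₂ B θ) := by
  have hcont := h.continuous
  have h1 := continuous_mellinM_pathL hE hlam h
  have h2 := continuous_Gamma_pathL h.lt h.height h.pos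
  have h3 : Measurable fun q : ℝ × ℝ => Gamma (pathL c₁ c₂ B q.1) * Gamma (pathL c₁ c₂ B q.2) *
    mellinM E lam (pathL c₁ c₂ B q.1 + pathL c₁ c₂ B q.2) *
    cexp (θ * I * (pathL c₁ c₂ B q.1 - pathL c₁ c₂ B q.2)) :=
    ((((h2.comp continuous_fst).mul (h2.comp continuous_snd)).mul h1).mul
      (by fun_prop)).measurable
  exact (h3.mul ((measurable_deriv _).comp measurable_fst)).mul
    ((measurable_deriv _).comp measurable_snd)

theorem norm_exp_mul_I_le {θ : ℝ} (hθ : |θ| ≤ Real.pi / 2) (z w : ℂ) :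
    ‖cexp (θ * I * (z - w))‖ ≤
      Real.exp (Real.pi / 2 * |z.im|) * Real.exp (Real.pi / 2 * |w.im|) := by
  rw [norm_exp, ← Real.exp_add]
  refine Real.exp_le_exp.mpr ?_
  have e : ((θ : ℂ) * I * (z - w)).re = θ * (-z.im + w.im) := by simp; ring
  rw [e]
  calc θ * (-z.im + w.im) ≤ |θ| * |-z.im + w.im| := by rw [← abs_mul]; exact le_abs_self _
    _ ≤ Real.pi / 2 * (|z.im| + |w.im|) := by
        gcongr
        exact (abs_add_le _ _).trans (by rw [abs_neg])
    _ = _ := by ring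

/-- An integrable majorant of the kernel, uniform in `θ`, with room for factors of the size of
`(1 + |t|) ^ (- c₁ / 4)` in both variables. -/
theorem exists_expKernel_majorant {E : ℝ → ℝ} (hE : IsSmoothSieve E) {lam : ℝ}
    (hlam : 0 < lam) {c₁ c₂ B : ℝ} (h : PathParams c₁ c₂ B) :
    ∃ D : ℝ × ℝ → ℝ, Integrable D ∧ ∀ θ : ℝ, |θ| ≤ Real.pi / 2 → ∀ q : ℝ × ℝ,
      (1 + |q.1|) ^ (-c₁ / 4) * (1 + |q.2|) ^ (-c₁ / 4) * ‖expKernel E lam c₁ c₂ B θ q‖ ≤ D q := by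
  obtain ⟨m, hm, hint, -⟩ := exists_mellinM_pathL_majorant hE hlam h
  obtain ⟨C, hC0, hC⟩ := exists_norm_Gamma_pathL_le h
  refine ⟨_, hint.const_mul (16 * C ^ 2), fun θ hθ q => ?_⟩
  have a1 := one_add_abs_pos q.1
  have a2 := one_add_abs_pos q.2
  have hm0 := (norm_nonneg _).trans (hm q.1 q.2)
  have e : ∀ x : ℝ, 0 < x → x ^ (-c₁ / 4) * x ^ (c₁ - 1 / 2) = x ^ (-(1 / 2 - 3 * c₁ / 4)) :=
    fun x hx => by rw [← Real.rpow_add hx]; congr 1; ring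
  set z := pathL c₁ c₂ B q.1 with hz
  set w := pathL c₁ c₂ B q.2 with hw
  have hk : ‖expKernel E lam c₁ c₂ B θ q‖ ≤
      (C * (1 + |q.1|) ^ (c₁ - 1 / 2)) * (C * (1 + |q.2|) ^ (c₁ - 1 / 2)) * m (q.1 + q.2) *
        4 * 4 := by
    rw [expKernel, norm_mul, norm_mul, norm_mul, norm_mul, norm_mul]
    calc _ ≤ ‖Gamma z‖ * ‖Gamma w‖ * ‖mellinM E lam (z + w)‖ *
          (Real.exp (Real.pi / 2 * |z.im|) * Real.exp (Real.pi / 2 * |w.im|)) * 4 * 4 := by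
          gcongr
          · exact norm_exp_mul_I_le hθ z w
          · exact norm_deriv_pathL_le h.lt h.height _
          · exact norm_deriv_pathL_le h.lt h.height _
      _ = (‖Gamma z‖ * Real.exp (Real.pi / 2 * |z.im|)) *
          (‖Gamma w‖ * Real.exp (Real.pi / 2 * |w.im|)) * ‖mellinM E lam (z + w)‖ * 4 * 4 := by
          ring
      _ ≤ _ := by
          gcongr ?_ * ?_ * ?_ * 4 * 4
          · exact hC q.1
          · exact hC q.2
          · exact hm q.1 q.2
  calc _ ≤ (1 + |q.1|) ^ (-c₁ / 4) * (1 + |q.2|) ^ (-c₁ / 4) *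
        ((C * (1 + |q.1|) ^ (c₁ - 1 / 2)) * (C * (1 + |q.2|) ^ (c₁ - 1 / 2)) * m (q.1 + q.2) *
        4 * 4) := by gcongr
    _ = 16 * C ^ 2 * (((1 + |q.1|) ^ (-c₁ / 4) * (1 + |q.1|) ^ (c₁ - 1 / 2)) *
        ((1 + |q.2|) ^ (-c₁ / 4) * (1 + |q.2|) ^ (c₁ - 1 / 2)) * m (q.1 + q.2)) := by ring
    _ = _ := by rw [e _ a1, e _ a2]

theorem cos_eq_half_exp_add (z w : ℂ) : cos ((Real.pi : ℂ) * (z - w) / 2) =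
    (cexp ((Real.pi / 2 : ℝ) * I * (z - w)) + cexp ((-(Real.pi / 2) : ℝ) * I * (z - w))) / 2 := by
  rw [cos]
  congr 3
  · push_cast; ring
  · push_cast; ring

/-- An integrable majorant of the kernel of the inner integral, for a fixed outer variable. -/
theorem exists_innerKernel_majorant {E : ℝ → ℝ} (hE : IsSmoothSieve E) {lam : ℝ}
    (hlam : 0 < lam) {c₁ c₂ B : ℝ} (h : PathParams c₁ c₂ B) (t : ℝ) :
    ∃ D : ℝ → ℝ, Integrable D ∧ ∀ u : ℝ,
      (1 + |u|) ^ (-c₁ / 4) * ‖Gamma (pathL c₁ c₂ B u) *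
        mellinM E lam (pathL c₁ c₂ B t + pathL c₁ c₂ B u) *
        cos ((Real.pi : ℂ) * (pathL c₁ c₂ B t - pathL c₁ c₂ B u) / 2) *
        deriv (pathL c₁ c₂ B) u‖ ≤ D u := by
  obtain ⟨m, hm, -, hint⟩ := exists_mellinM_pathL_majorant hE hlam h
  obtain ⟨C, hC0, hC⟩ := exists_norm_Gamma_pathL_le h
  set z := pathL c₁ c₂ B t with hz
  refine ⟨_, (hint t).const_mul (4 * C * Real.exp (Real.pi / 2 * |z.im|)), fun u => ?_⟩
  set w := pathL c₁ c₂ B u with hw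
  have a2 := one_add_abs_pos u
  have hm0 := (norm_nonneg _).trans (hm t u)
  have e : ∀ x : ℝ, 0 < x → x ^ (-c₁ / 4) * x ^ (c₁ - 1 / 2) = x ^ (-(1 / 2 - 3 * c₁ / 4)) :=
    fun x hx => by rw [← Real.rpow_add hx]; congr 1; ring
  have hpi := Real.pi_pos
  have hcos : ‖cos ((Real.pi : ℂ) * (z - w) / 2)‖ ≤
      Real.exp (Real.pi / 2 * |z.im|) * Real.exp (Real.pi / 2 * |w.im|) := by
    rw [cos_eq_half_exp_add, norm_div, norm_ofNat, div_le_iff₀ two_pos]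
    have h1 := norm_exp_mul_I_le (θ := Real.pi / 2) (by rw [abs_of_pos (by positivity)]) z w
    have h2 := norm_exp_mul_I_le (θ := -(Real.pi / 2))
      (by rw [abs_neg, abs_of_pos (by positivity)]) z w
    refine (norm_add_le _ _).trans ?_
    linarith
  rw [norm_mul, norm_mul, norm_mul]
  calc _ ≤ (1 + |u|) ^ (-c₁ / 4) * (‖Gamma w‖ * m (t + u) *
        (Real.exp (Real.pi / 2 * |z.im|) * Real.exp (Real.pi / 2 * |w.im|)) * 4) := by
        gcongr
        · exact hm t u
        · exact norm_deriv_pathL_le h.lt h.height _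
    _ = (1 + |u|) ^ (-c₁ / 4) * ((‖Gamma w‖ * Real.exp (Real.pi / 2 * |w.im|)) * m (t + u) *
        Real.exp (Real.pi / 2 * |z.im|) * 4) := by ring
    _ ≤ (1 + |u|) ^ (-c₁ / 4) * ((C * (1 + |u|) ^ (c₁ - 1 / 2)) * m (t + u) *
        Real.exp (Real.pi / 2 * |z.im|) * 4) := by gcongr _ * (?_ * _ * _ * 4); exact hC u
    _ = 4 * C * Real.exp (Real.pi / 2 * |z.im|) *
        (((1 + |u|) ^ (-c₁ / 4) * (1 + |u|) ^ (c₁ - 1 / 2)) * m (t + u)) := by ring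
    _ = _ := by rw [e _ a2]

end

/-! ### Absolute convergence and holomorphy of the repeated integral -/

section

open Filter Topology Complex

/-- The kernel `Γ(z) Γ(w) M^lam(z + w) cos(π(z - w)/2) dz dw` on the parametrized path. -/
def cosKernel (E : ℝ → ℝ) (lam c₁ c₂ B : ℝ) (q : ℝ × ℝ) : ℂ :=
  (expKernel E lam c₁ c₂ B (Real.pi / 2) q + expKernel E lam c₁ c₂ B (-(Real.pi / 2)) q) / 2

theorem measurable_cosKernel {E : ℝ → ℝ} (hE : IsSmoothSieve E) {lam : ℝ}
    (hlam : 0 < lam) {c₁ c₂ B : ℝ} (h : PathParams c₁ c₂ B) :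
    Measurable (cosKernel E lam c₁ c₂ B) :=
  ((measurable_expKernel hE hlam h _).add (measurable_expKernel hE hlam h _)).div_const 2

theorem exists_cosKernel_majorant {E : ℝ → ℝ} (hE : IsSmoothSieve E) {lam : ℝ}
    (hlam : 0 < lam) {c₁ c₂ B : ℝ} (h : PathParams c₁ c₂ B) :
    ∃ D : ℝ × ℝ → ℝ, Integrable D ∧ ∀ q : ℝ × ℝ,
      (1 + |q.1|) ^ (-c₁ / 4) * (1 + |q.2|) ^ (-c₁ / 4) * ‖cosKernel E lam c₁ c₂ B q‖ ≤ D q := by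
  obtain ⟨D, hD, hDb⟩ := exists_expKernel_majorant hE hlam h
  have hpi := Real.pi_pos
  refine ⟨D, hD, fun q => ?_⟩
  have h1 := hDb (Real.pi / 2) (by rw [abs_of_pos (by positivity)]) q
  have h2 := hDb (-(Real.pi / 2)) (by rw [abs_neg, abs_of_pos (by positivity)]) q
  set W := (1 + |q.1|) ^ (-c₁ / 4) * (1 + |q.2|) ^ (-c₁ / 4)
  have hW : 0 ≤ W := by
    have a1 := one_add_abs_pos q.1
    have a2 := one_add_abs_pos q.2
    positivity
  have h3 : ‖cosKernel E lam c₁ c₂ B q‖ ≤ (‖expKernel E lam c₁ c₂ B (Real.pi / 2) q‖ +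
      ‖expKernel E lam c₁ c₂ B (-(Real.pi / 2)) q‖) / 2 := by
    rw [cosKernel, norm_div, norm_ofNat]
    gcongr
    exact norm_add_le _ _
  have h4 := mul_le_mul_of_nonneg_left h3 hW
  linarith

theorem differentiableAt_zetaLogDeriv {z : ℂ} (hz : z ≠ 1) (h0 : riemannZeta z ≠ 0) :
    DifferentiableAt ℂ zetaLogDeriv z := by
  have hd : DifferentiableOn ℂ riemannZeta {1}ᶜ := fun s hs =>
    (differentiableAt_riemannZeta hs).differentiableWithinAt
  have hopen : IsOpen ({1}ᶜ : Set ℂ) := isOpen_compl_singleton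
  exact ((hd.deriv hopen).differentiableAt (hopen.mem_nhds hz)).div
    (differentiableAt_riemannZeta hz) h0

/-- A region of parameters `s` for which `ζ'/ζ` is regular on the translated path `L + s` and of
moderate growth there, locally uniformly in `s`. -/
structure IsZetaRegion (c₁ c₂ B : ℝ) (U : Set ℂ) : Prop where
  isOpen : IsOpen U
  ne_one : ∀ s ∈ U, ∀ t, pathL c₁ c₂ B t + s ≠ 1
  zeta_ne_zero : ∀ s ∈ U, ∀ t, riemannZeta (pathL c₁ c₂ B t + s) ≠ 0
  bound : ∀ s₀ ∈ U, ∃ r > 0, ∃ C, 0 ≤ C ∧ ∀ s ∈ Metric.ball s₀ r, ∀ t,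
    ‖zetaLogDeriv (pathL c₁ c₂ B t + s)‖ ≤ C * (1 + |t|) ^ (-c₁ / 4)

theorem IsZetaRegion.continuous {c₁ c₂ B : ℝ} (h : PathParams c₁ c₂ B) {U : Set ℂ}
    (hU : IsZetaRegion c₁ c₂ B U) {s : ℂ} (hs : s ∈ U) :
    Continuous fun t => zetaLogDeriv (pathL c₁ c₂ B t + s) :=
  continuous_iff_continuousAt.mpr fun t =>
    (differentiableAt_zetaLogDeriv (hU.ne_one s hs t) (hU.zeta_ne_zero s hs t)).continuousAt.comp
      (f := fun t => pathL c₁ c₂ B t + s) (h.continuous.add continuous_const).continuousAt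

/-- The full integrand of the repeated integral on the parametrized path. -/
def fullIntegrand (E : ℝ → ℝ) (lam c₁ c₂ B : ℝ) (s : ℂ) (q : ℝ × ℝ) : ℂ :=
  zetaLogDeriv (pathL c₁ c₂ B q.1 + s) * zetaLogDeriv (pathL c₁ c₂ B q.2 + s) *
    cosKernel E lam c₁ c₂ B q

theorem fullIntegrand_eq (E : ℝ → ℝ) (lam c₁ c₂ B : ℝ) (s : ℂ) (q : ℝ × ℝ) :
    fullIntegrand E lam c₁ c₂ B s q =
      Gamma (pathL c₁ c₂ B q.1) * zetaLogDeriv (pathL c₁ c₂ B q.1 + s) *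
      innerIntegrand E lam s (pathL c₁ c₂ B q.1) (pathL c₁ c₂ B q.2) *
      deriv (pathL c₁ c₂ B) q.1 * deriv (pathL c₁ c₂ B) q.2 := by
  rw [fullIntegrand, cosKernel, expKernel, expKernel, innerIntegrand, cos_eq_half_exp_add]
  ring

theorem aestronglyMeasurable_fullIntegrand {E : ℝ → ℝ} (hE : IsSmoothSieve E) {lam : ℝ}
    (hlam : 0 < lam) {c₁ c₂ B : ℝ} (h : PathParams c₁ c₂ B) {U : Set ℂ}
    (hU : IsZetaRegion c₁ c₂ B U) {s : ℂ} (hs : s ∈ U) :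
    AEStronglyMeasurable (fullIntegrand E lam c₁ c₂ B s) := by
  have hz := hU.continuous h hs
  exact (((hz.comp continuous_fst).mul (hz.comp continuous_snd)).measurable.mul
    (measurable_cosKernel hE hlam h)).aestronglyMeasurable

theorem exists_fullIntegrand_majorant {E : ℝ → ℝ} (hE : IsSmoothSieve E) {lam : ℝ}
    (hlam : 0 < lam) {c₁ c₂ B : ℝ} (h : PathParams c₁ c₂ B) {U : Set ℂ}
    (hU : IsZetaRegion c₁ c₂ B U) {s₀ : ℂ} (hs₀ : s₀ ∈ U) :
    ∃ r > 0, ∃ D : ℝ × ℝ → ℝ, Integrable D ∧ ∀ s ∈ Metric.ball s₀ r, ∀ q,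
      ‖fullIntegrand E lam c₁ c₂ B s q‖ ≤ D q := by
  obtain ⟨D, hD, hDb⟩ := exists_cosKernel_majorant hE hlam h
  obtain ⟨r, hr, C, hC0, hC⟩ := hU.bound s₀ hs₀
  refine ⟨r, hr, _, hD.const_mul (C ^ 2), fun s hs q => ?_⟩
  have a1 := one_add_abs_pos q.1
  rw [fullIntegrand, norm_mul, norm_mul]
  calc _ ≤ (C * (1 + |q.1|) ^ (-c₁ / 4)) * (C * (1 + |q.2|) ^ (-c₁ / 4)) *
        ‖cosKernel E lam c₁ c₂ B q‖ := by
        gcongr ?_ * ?_ * _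
        · exact hC s hs q.1
        · exact hC s hs q.2
    _ = C ^ 2 * ((1 + |q.1|) ^ (-c₁ / 4) * (1 + |q.2|) ^ (-c₁ / 4) *
        ‖cosKernel E lam c₁ c₂ B q‖) := by ring
    _ ≤ _ := by gcongr; exact hDb q

theorem integrable_fullIntegrand {E : ℝ → ℝ} (hE : IsSmoothSieve E) {lam : ℝ}
    (hlam : 0 < lam) {c₁ c₂ B : ℝ} (h : PathParams c₁ c₂ B) {U : Set ℂ}
    (hU : IsZetaRegion c₁ c₂ B U) {s : ℂ} (hs : s ∈ U) :
    Integrable (fullIntegrand E lam c₁ c₂ B s) := by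
  obtain ⟨r, hr, D, hD, hDb⟩ := exists_fullIntegrand_majorant hE hlam h hU hs
  exact hD.mono' (aestronglyMeasurable_fullIntegrand hE hlam h hU hs)
    (Eventually.of_forall (hDb s (Metric.mem_ball_self hr)))

theorem IsZetaRegion.integralTConverges {E : ℝ → ℝ} (hE : IsSmoothSieve E) {lam : ℝ}
    (hlam : 0 < lam) {c₁ c₂ B : ℝ} (h : PathParams c₁ c₂ B) {U : Set ℂ}
    (hU : IsZetaRegion c₁ c₂ B U) {s : ℂ} (hs : s ∈ U) :
    IntegralTConverges E lam c₁ c₂ B s := by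
  refine ⟨fun t => ?_, ?_⟩
  · obtain ⟨D, hD, hDb⟩ := exists_innerKernel_majorant hE hlam h t
    obtain ⟨r, hr, C, hC0, hC⟩ := hU.bound s hs
    have hcont := h.continuous
    have h1 : Continuous fun u => innerIntegrand E lam s (pathL c₁ c₂ B t) (pathL c₁ c₂ B u) := by
      refine (((continuous_Gamma_pathL h.lt h.height h.pos).mul (hU.continuous h hs)).mul
        ((continuous_mellinM_pathL hE hlam h).comp (Continuous.prodMk_right t))).mul ?_
      fun_prop
    refine (hD.const_mul C).mono' (h1.measurable.mul (measurable_deriv _)).aestronglyMeasurable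
      (Eventually.of_forall fun u => ?_)
    have h2 := hC s (Metric.mem_ball_self hr) u
    calc _ = ‖zetaLogDeriv (pathL c₁ c₂ B u + s)‖ * ‖Gamma (pathL c₁ c₂ B u) *
        mellinM E lam (pathL c₁ c₂ B t + pathL c₁ c₂ B u) *
        cos ((Real.pi : ℂ) * (pathL c₁ c₂ B t - pathL c₁ c₂ B u) / 2) *
        deriv (pathL c₁ c₂ B) u‖ := by
          rw [← norm_mul, innerIntegrand]; congr 1; ring
      _ ≤ (C * (1 + |u|) ^ (-c₁ / 4)) * ‖Gamma (pathL c₁ c₂ B u) *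
        mellinM E lam (pathL c₁ c₂ B t + pathL c₁ c₂ B u) *
        cos ((Real.pi : ℂ) * (pathL c₁ c₂ B t - pathL c₁ c₂ B u) / 2) *
        deriv (pathL c₁ c₂ B) u‖ := by gcongr
      _ ≤ C * D u := by
          rw [mul_assoc]
          gcongr _ * ?_
          exact hDb u
  · exact (integrable_fullIntegrand hE hlam h hU hs).congr
      (Eventually.of_forall fun q => fullIntegrand_eq E lam c₁ c₂ B s q)

/-- Under absolute convergence the repeated integral is a double integral. -/
theorem integralT_eq {E : ℝ → ℝ} {lam c₁ c₂ B : ℝ} {s : ℂ}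
    (hint : Integrable (fullIntegrand E lam c₁ c₂ B s)) :
    integralT E lam c₁ c₂ B s =
      (1 / (2 * (Real.pi : ℂ) * I)) ^ 2 * ∫ q, fullIntegrand E lam c₁ c₂ B s q := by
  rw [Measure.volume_eq_prod] at hint ⊢
  rw [integral_prod _ hint, integralT, sq]
  simp only [contourL, fullIntegrand_eq]
  generalize 1 / (2 * (Real.pi : ℂ) * I) = κ
  rw [mul_assoc κ κ]
  congr 1
  rw [← integral_const_mul]
  congr 1 with t
  have h1 : ∫ u, Gamma (pathL c₁ c₂ B t) * zetaLogDeriv (pathL c₁ c₂ B t + s) *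
        innerIntegrand E lam s (pathL c₁ c₂ B t) (pathL c₁ c₂ B u) *
        deriv (pathL c₁ c₂ B) t * deriv (pathL c₁ c₂ B) u =
      Gamma (pathL c₁ c₂ B t) * zetaLogDeriv (pathL c₁ c₂ B t + s) * deriv (pathL c₁ c₂ B) t *
        ∫ u, innerIntegrand E lam s (pathL c₁ c₂ B t) (pathL c₁ c₂ B u) *
          deriv (pathL c₁ c₂ B) u := by
    rw [← integral_const_mul]
    congr 1 with u
    ring
  rw [h1]
  ring

theorem IsZetaRegion.differentiableOn_integralT {E : ℝ → ℝ} (hE : IsSmoothSieve E) {lam : ℝ}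
    (hlam : 0 < lam) {c₁ c₂ B : ℝ} (h : PathParams c₁ c₂ B) {U : Set ℂ}
    (hU : IsZetaRegion c₁ c₂ B U) :
    DifferentiableOn ℂ (integralT E lam c₁ c₂ B) U := by
  refine DifferentiableOn.congr (f := fun s => (1 / (2 * (Real.pi : ℂ) * I)) ^ 2 *
    ∫ q, fullIntegrand E lam c₁ c₂ B s q) ?_
    fun s hs => integralT_eq (integrable_fullIntegrand hE hlam h hU hs)
  refine DifferentiableOn.const_mul (differentiableOn_integral_of_dominated hU.isOpen
    (fun s hs => aestronglyMeasurable_fullIntegrand hE hlam h hU hs)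
    (Eventually.of_forall fun q s hs => ?_) fun s₀ hs₀ => ?_) _
  · have h1 : ∀ t, DifferentiableAt ℂ (fun s => zetaLogDeriv (pathL c₁ c₂ B t + s)) s := fun t =>
      (differentiableAt_zetaLogDeriv (hU.ne_one s hs t) (hU.zeta_ne_zero s hs t)).comp s
        (differentiableAt_id.const_add _)
    exact (((h1 q.1).mul (h1 q.2)).mul_const _).differentiableWithinAt
  · obtain ⟨r, hr, D, hD, hDb⟩ := exists_fullIntegrand_majorant hE hlam h hU hs₀
    exact ⟨r, hr, D, hD, Eventually.of_forall fun q s hs => hDb s hs q⟩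

theorem isZetaRegion_halfPlane {c₁ c₂ B : ℝ} (h : PathParams c₁ c₂ B) :
    IsZetaRegion c₁ c₂ B (halfPlane c₁) := by
  have hre : ∀ s : ℂ, ∀ t, c₁ + s.re ≤ (pathL c₁ c₂ B t + s).re := fun s t => by
    rw [add_re]; linarith [(pathL_re_mem h.lt h.height t).1]
  refine ⟨isOpen_lt continuous_const continuous_re, fun s hs t heq => ?_, fun s hs t => ?_,
    fun s₀ hs₀ => ?_⟩
  · have h1 : 1 - c₁ < s.re := hs
    have h2 := hre s t
    rw [heq, one_re] at h2
    linarith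
  · have h1 : 1 - c₁ < s.re := hs
    exact riemannZeta_ne_zero_of_one_le_re (by linarith [hre s t])
  · have h1 : 1 - c₁ < s₀.re := hs₀
    set δ := (s₀.re - (1 - c₁)) / 2 with hδ
    have hδ0 : 0 < δ := by linarith
    obtain ⟨C, hC0, hC⟩ := exists_norm_zetaLogDeriv_le_of_one_lt (a := 1 + δ) (by linarith)
    refine ⟨δ, hδ0, C, hC0, fun s hs t => (hC _ ?_).trans ?_⟩
    · have h2 : |(s - s₀).re| < δ := (abs_re_le_norm _).trans_lt (mem_ball_iff_norm.mp hs)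
      rw [sub_re, abs_lt] at h2
      linarith [hre s t, h2.1]
    · exact le_mul_of_one_le_right hC0 (one_le_one_add_abs_rpow t (by linarith [h.neg]))

/-- Under the Riemann hypothesis the half-strip is admissible: to the right of the critical line the
only singularity of `ζ'/ζ` is the pole at `1`, which the translated path avoids, since it passes the
real axis at `c₂ + Re s > 1`. -/
theorem isZetaRegion_halfStrip (hRH : RiemannHypothesis) {c₁ c₂ B : ℝ}
    (h : PathParams c₁ c₂ B) : IsZetaRegion c₁ c₂ B (halfStrip c₁ c₂ B) := by
  have hopen : IsOpen (halfStrip c₁ c₂ B) :=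
    (isOpen_lt continuous_const continuous_re).inter
      (isOpen_lt (continuous_abs.comp continuous_im) continuous_const)
  have hre : ∀ s : ℂ, ∀ t, c₁ + s.re ≤ (pathL c₁ c₂ B t + s).re := fun s t => by
    rw [add_re]; linarith [(pathL_re_mem h.lt h.height t).1]
  have hne : ∀ s ∈ halfStrip c₁ c₂ B, ∀ t, pathL c₁ c₂ B t + s ≠ 1 := by
    rintro s ⟨h1, h2⟩ t heq
    rcases pathL_re_eq_or h.lt h.height t with h3 | h3
    · have h4 := congrArg re heq
      rw [add_re, h3, one_re] at h4
      linarith [(le_max_right (1 / 2 - c₁) (1 - c₂)).trans_lt h1]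
    · have h4 := congrArg im heq
      rw [add_im, one_im] at h4
      rw [eq_neg_of_add_eq_zero_left h4, abs_neg] at h3
      linarith
  have hz : ∀ s ∈ halfStrip c₁ c₂ B, ∀ t, riemannZeta (pathL c₁ c₂ B t + s) ≠ 0 := by
    intro s hs t
    refine riemannZeta_ne_zero_of_RH hRH ?_ (hne s hs t)
    linarith [hre s t, (le_max_left (1 / 2 - c₁) (1 - c₂)).trans_lt hs.1]
  refine ⟨hopen, hne, hz, fun s₀ hs₀ => ?_⟩
  obtain ⟨r, hr, hball⟩ := Metric.nhds_basis_closedBall.mem_iff.mp (hopen.mem_nhds hs₀)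
  set δ := (s₀.re - max (1 / 2 - c₁) (1 - c₂)) / 2 with hδ
  have hδ0 : 0 < δ := by have := hs₀.1; simp only [hδ]; linarith
  set d := c₂ - c₁ with hd
  have hd0 : 0 < d := by linarith [h.lt]
  have hε : 0 < -c₁ / 4 := by linarith [h.neg]
  obtain ⟨C, hC0, hC⟩ := exists_norm_zetaLogDeriv_le_of_RH hRH hδ0 hε
  set ρ := min r δ with hρ
  set R := B + d + 3 with hR
  have hcont : ContinuousOn (fun p : ℝ × ℂ => zetaLogDeriv (pathL c₁ c₂ B p.1 + p.2))
      (Icc (-R) R ×ˢ Metric.closedBall s₀ r) := by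
    rintro ⟨t, s⟩ ⟨ht, hs⟩
    have hc := h.continuous
    exact ((differentiableAt_zetaLogDeriv (hne s (hball hs) t)
      (hz s (hball hs) t)).continuousAt.comp (f := fun p : ℝ × ℂ => pathL c₁ c₂ B p.1 + p.2)
      (x := (t, s)) (by fun_prop)).continuousWithinAt
  -- compactness for bounded parameters, the bound for `ζ'/ζ` under the hypothesis for the others;
  -- beyond `R` the imaginary part on the translated path is at least `3`
  obtain ⟨C', hC'⟩ := (isCompact_Icc.prod (isCompact_closedBall s₀ r)).exists_bound_of_continuousOn
    hcont
  have hB := h.height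
  refine ⟨ρ, lt_min hr hδ0, max C' (C * (1 + d + B) ^ (-c₁ / 4)), ?_, fun s hs t => ?_⟩
  · exact le_max_of_le_right (by positivity)
  have a1 := one_add_abs_pos t
  have hsr : s ∈ Metric.closedBall s₀ r :=
    Metric.ball_subset_closedBall (Metric.ball_subset_ball (min_le_left _ _) hs)
  rcases le_or_gt |t| R with ht | ht
  · have h1 := hC' (t, s) ⟨abs_le.mp ht, hsr⟩
    have h3 : 1 ≤ (1 + |t|) ^ (-c₁ / 4) := one_le_one_add_abs_rpow t hε.le
    calc _ ≤ C' := h1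
      _ ≤ max C' (C * (1 + d + B) ^ (-c₁ / 4)) := le_max_left _ _
      _ ≤ _ := le_mul_of_one_le_right (le_max_of_le_right (by positivity)) h3
  · have h2 : |s.im| < B := (hball hsr).2
    have h3 := abs_pathL_im_sub_le h.lt h.height t
    set y := (pathL c₁ c₂ B t).im with hy
    have h4 : |t| ≤ |y + s.im| + d + |s.im| := by
      have e : t = (y + s.im) + (-(y - t) + -s.im) := by ring
      calc |t| ≤ |y + s.im| + |-(y - t) + -s.im| := by
            conv_lhs => rw [e]
            exact abs_add_le _ _
        _ ≤ |y + s.im| + (|-(y - t)| + |-s.im|) := by gcongr; exact abs_add_le _ _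
        _ ≤ _ := by rw [abs_neg, abs_neg]; linarith
    have h5 : |y + s.im| ≤ |t| + d + B := by
      have e : y + s.im = t + ((y - t) + s.im) := by ring
      calc |y + s.im| ≤ |t| + |(y - t) + s.im| := by rw [e]; exact abs_add_le _ _
        _ ≤ |t| + (|y - t| + |s.im|) := by gcongr; exact abs_add_le _ _
        _ ≤ _ := by linarith
    have h6 : |(s - s₀).re| < δ :=
      (abs_re_le_norm _).trans_lt ((mem_ball_iff_norm.mp hs).trans_le (min_le_right _ _))
    rw [sub_re, abs_lt] at h6
    have h7 := hC (pathL c₁ c₂ B t + s)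
      (by linarith [hre s t, h6.1, le_max_left (1 / 2 - c₁) (1 - c₂)])
      (by rw [add_im]; linarith)
    rw [add_im] at h7
    calc _ ≤ C * |y + s.im| ^ (-c₁ / 4) := h7
      _ ≤ C * ((1 + d + B) * (1 + |t|)) ^ (-c₁ / 4) := by
          gcongr
          nlinarith [abs_nonneg t]
      _ = C * (1 + d + B) ^ (-c₁ / 4) * (1 + |t|) ^ (-c₁ / 4) := by
          rw [Real.mul_rpow (by positivity) (by positivity), mul_assoc]
      _ ≤ _ := by
          gcongr
          exact le_max_right _ _

end

/-! ### Evaluation of the kernel against powers -/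

section

open Filter Topology Complex

/-- Powers of a point in the right half-plane given in polar coordinates. -/
theorem ofReal_mul_exp_cpow {x φ : ℝ} (hx : 0 < x) (hφ : |φ| < Real.pi / 2) (z : ℂ) :
    ((x : ℂ) * cexp (φ * I)) ^ z = (x : ℂ) ^ z * cexp (φ * I * z) := by
  have hpi := Real.pi_pos
  obtain ⟨h1, h2⟩ := abs_lt.mp hφ
  have hx' : (x : ℂ) ≠ 0 := ofReal_ne_zero.mpr hx.ne'
  have him : ((φ : ℂ) * I).im = φ := by simp
  rw [cpow_def_of_ne_zero (mul_ne_zero hx' (exp_ne_zero _)), cpow_def_of_ne_zero hx',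
    log_ofReal_mul hx (exp_ne_zero _), log_exp (by rw [him]; linarith) (by rw [him]; linarith),
    ← Complex.exp_add, add_mul, ofReal_log hx.le]

theorem re_ofReal_mul_exp_pos {x φ : ℝ} (hx : 0 < x) (hφ : |φ| < Real.pi / 2) :
    0 < ((x : ℂ) * cexp (φ * I)).re := by
  rw [re_ofReal_mul, exp_ofReal_mul_I_re]
  exact mul_pos hx (Real.cos_pos_of_mem_Ioo (abs_lt.mp hφ))

theorem integrable_Gamma_mul_rotated {c₁ c₂ B : ℝ} (h : PathParams c₁ c₂ B) {x φ : ℝ}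
    (hx : 0 < x) (hφ : |φ| < Real.pi / 2) :
    Integrable fun t => Gamma (pathL c₁ c₂ B t) * ((x : ℂ) ^ (-pathL c₁ c₂ B t) *
      cexp (φ * I * -pathL c₁ c₂ B t)) * deriv (pathL c₁ c₂ B) t := by
  have hl := h.lower
  have := Integrable.mul_deriv_pathL h.lt h.height (integrable_Gamma_mul_cpow_pathL (by linarith)
    h.lt h.pos h.height (re_ofReal_mul_exp_pos hx hφ))
  refine this.congr (Eventually.of_forall fun t => ?_)
  simp only [ofReal_mul_exp_cpow hx hφ]

theorem integral_Gamma_mul_rotated {c₁ c₂ B : ℝ} (h : PathParams c₁ c₂ B) {x φ : ℝ}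
    (hx : 0 < x) (hφ : |φ| < Real.pi / 2) :
    (1 / (2 * (Real.pi : ℂ) * I)) * ∫ t, Gamma (pathL c₁ c₂ B t) *
      ((x : ℂ) ^ (-pathL c₁ c₂ B t) * cexp (φ * I * -pathL c₁ c₂ B t)) *
        deriv (pathL c₁ c₂ B) t = cexp (-(x * cexp (φ * I))) := by
  have hl := h.lower
  rw [← contourL_Gamma_mul_cpow (by linarith) h.lt h.pos h.height (re_ofReal_mul_exp_pos hx hφ),
    contourL]
  simp only [ofReal_mul_exp_cpow hx hφ]

/-- For rotations by less than a right angle everything converges absolutely, and the double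
contour integral is evaluated by the inverse Mellin transform of `Γ` in each variable. -/
theorem integral_expKernel_mul_cpow_of_lt {E : ℝ → ℝ} (hE : IsSmoothSieve E) {lam : ℝ}
    (hlam : 0 < lam) {c₁ c₂ B : ℝ} (h : PathParams c₁ c₂ B) {x y θ : ℝ} (hx : 0 < x) (hy : 0 < y)
    (hθ : |θ| < Real.pi / 2) :
    (1 / (2 * (Real.pi : ℂ) * I)) ^ 2 * ∫ q, expKernel E lam c₁ c₂ B θ q *
      ((x : ℂ) ^ (-pathL c₁ c₂ B q.1) * (y : ℂ) ^ (-pathL c₁ c₂ B q.2)) =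
    (1 / (Real.pi : ℂ)) * ∫ t in Ioi (0 : ℝ), (fourierE E lam t : ℂ) *
      (cexp (-((x * t : ℝ) * cexp ((-θ : ℝ) * I))) * cexp (-((y * t : ℝ) * cexp (θ * I)))) := by
  have hneg := h.neg
  have hlow := h.lower
  have hpos := h.pos
  have hup := h.upper
  have hθ' : |-θ| < Real.pi / 2 := by rwa [abs_neg]
  have hcont := h.continuous
  set κ := 1 / (2 * (Real.pi : ℂ) * I) with hκ
  set f : ℝ → ℝ → ℂ := fun x t => Gamma (pathL c₁ c₂ B t) * ((x : ℂ) ^ (-pathL c₁ c₂ B t) *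
    cexp ((-θ : ℝ) * I * -pathL c₁ c₂ B t)) * deriv (pathL c₁ c₂ B) t with hf
  set g : ℝ → ℝ → ℂ := fun x t => Gamma (pathL c₁ c₂ B t) * ((x : ℂ) ^ (-pathL c₁ c₂ B t) *
    cexp (θ * I * -pathL c₁ c₂ B t)) * deriv (pathL c₁ c₂ B) t with hg
  have hfi : ∀ x, 0 < x → Integrable (f x) := fun x hx => integrable_Gamma_mul_rotated h hx hθ'
  have hgi : ∀ x, 0 < x → Integrable (g x) := fun x hx => integrable_Gamma_mul_rotated h hx hθ
  have hfv : ∀ x : ℝ, 0 < x → κ * ∫ t, f x t = cexp (-(x * cexp ((-θ : ℝ) * I))) :=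
    fun x hx => integral_Gamma_mul_rotated h hx hθ'
  have hgv : ∀ x : ℝ, 0 < x → κ * ∫ t, g x t = cexp (-(x * cexp (θ * I))) :=
    fun x hx => integral_Gamma_mul_rotated h hx hθ
  -- the integrand in all three variables, with `M^lam` written out as an integral
  set P : (ℝ × ℝ) → ℝ → ℂ := fun q t => f x q.1 * g y q.2 *
    ((fourierE E lam t : ℂ) * (t : ℂ) ^ (-(pathL c₁ c₂ B q.1 + pathL c₁ c₂ B q.2))) with hP
  have h1 : ∀ q, expKernel E lam c₁ c₂ B θ q *
      ((x : ℂ) ^ (-pathL c₁ c₂ B q.1) * (y : ℂ) ^ (-pathL c₁ c₂ B q.2)) =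
      (1 / (Real.pi : ℂ)) * ∫ t in Ioi (0 : ℝ), P q t := by
    intro q
    simp only [hP]
    rw [integral_const_mul, expKernel, mellinM, sub_eq_add_neg, mul_add, Complex.exp_add]
    simp only [hf, hg, ofReal_neg, neg_mul, mul_neg, neg_neg]
    ring
  have hPi : Integrable (Function.uncurry P) (volume.prod (volume.restrict (Ioi 0))) := by
    obtain ⟨C, hC0, hC⟩ := exists_abs_fourierE_le hE hlam
    obtain ⟨w, hw, hwb⟩ := exists_integrableOn_majorant (a := 2 * c₁) (b := 2 * c₂)
      (by linarith) (by linarith)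
    have hfg : Integrable fun q : ℝ × ℝ => f x q.1 * g y q.2 := (hfi x hx).mul_prod (hgi y hy)
    refine (hfg.norm.mul_prod (hw.const_mul C)).mono' ?_ ?_
    · refine (hfg.aestronglyMeasurable.comp_fst).mul (Measurable.aestronglyMeasurable ?_)
      refine ((continuous_ofReal.comp (continuous_fourierE hE hlam)).comp
        continuous_snd).measurable.mul ?_
      refine Measurable.pow (by fun_prop) (Continuous.measurable ?_)
      fun_prop
    · have h2 : ∀ᵐ p : (ℝ × ℝ) × ℝ ∂(volume.prod (volume.restrict (Ioi 0))), 0 < p.2 :=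
        Measure.quasiMeasurePreserving_snd.ae (ae_restrict_mem measurableSet_Ioi)
      filter_upwards [h2] with p hp
      simp only [hP, Function.uncurry]
      rw [norm_mul]
      gcongr
      have e1 := pathL_re_mem h.lt h.height p.1.1
      have e2 := pathL_re_mem h.lt h.height p.1.2
      have e3 : (pathL c₁ c₂ B p.1.1 + pathL c₁ c₂ B p.1.2).re ∈ Icc (2 * c₁) (2 * c₂) := by
        rw [add_re]
        exact ⟨by linarith [e1.1, e2.1], by linarith [e1.2, e2.2]⟩
      exact norm_mellin_integrand_le hC hC0 (fun t ht => hwb t ht _ e3) hp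
  simp only [h1]
  rw [integral_const_mul, integral_integral_swap hPi, mul_left_comm, ← integral_const_mul]
  congr 1
  refine setIntegral_congr_fun measurableSet_Ioi fun t ht => ?_
  have ht0 : (0 : ℝ) < t := ht
  have h3 : ∀ q, P q t = (fourierE E lam t : ℂ) * (f (x * t) q.1 * g (y * t) q.2) := by
    intro q
    have ht' : (t : ℂ) ≠ 0 := ofReal_ne_zero.mpr ht0.ne'
    simp only [hP, hf, hg]
    rw [ofReal_mul, ofReal_mul, mul_cpow_ofReal_nonneg hx.le ht0.le,
      mul_cpow_ofReal_nonneg hy.le ht0.le, neg_add, cpow_add _ _ ht']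
    ring
  simp only [h3]
  rw [integral_const_mul, Measure.volume_eq_prod, integral_prod_mul, ← hfv _ (mul_pos hx ht0),
    ← hgv _ (mul_pos hy ht0)]
  ring

theorem norm_ofReal_cpow_neg_pathL_le {c₁ c₂ B : ℝ} (h : PathParams c₁ c₂ B) {x : ℝ} (hx : 0 < x)
    (t : ℝ) : ‖(x : ℂ) ^ (-pathL c₁ c₂ B t)‖ ≤ x ^ (-c₂) + x ^ (-c₁) := by
  rw [norm_cpow_eq_rpow_re_of_pos hx, neg_re]
  have := pathL_re_mem h.lt h.height t
  exact rpow_le_rpow_add_rpow hx (neg_le_neg this.2) (neg_le_neg this.1)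

theorem continuous_ofReal_cpow_neg_pathL {c₁ c₂ B : ℝ} (h : PathParams c₁ c₂ B) {x : ℝ}
    (hx : 0 < x) : Continuous fun t => (x : ℂ) ^ (-pathL c₁ c₂ B t) :=
  h.continuous.neg.const_cpow (Or.inl (ofReal_ne_zero.mpr hx.ne'))

theorem aestronglyMeasurable_expKernel_mul_cpow {E : ℝ → ℝ} (hE : IsSmoothSieve E) {lam : ℝ}
    (hlam : 0 < lam) {c₁ c₂ B : ℝ} (h : PathParams c₁ c₂ B) {x y : ℝ} (hx : 0 < x) (hy : 0 < y)
    (θ : ℝ) : AEStronglyMeasurable fun q => expKernel E lam c₁ c₂ B θ q *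
      ((x : ℂ) ^ (-pathL c₁ c₂ B q.1) * (y : ℂ) ^ (-pathL c₁ c₂ B q.2)) :=
  ((measurable_expKernel hE hlam h θ).mul
    (((continuous_ofReal_cpow_neg_pathL h hx).comp continuous_fst).mul
      ((continuous_ofReal_cpow_neg_pathL h hy).comp
        continuous_snd)).measurable).aestronglyMeasurable

theorem exists_expKernel_mul_cpow_majorant {E : ℝ → ℝ} (hE : IsSmoothSieve E) {lam : ℝ}
    (hlam : 0 < lam) {c₁ c₂ B : ℝ} (h : PathParams c₁ c₂ B) {x y : ℝ} (hx : 0 < x) (hy : 0 < y) :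
    ∃ D : ℝ × ℝ → ℝ, Integrable D ∧ ∀ θ ∈ Icc (-(Real.pi / 2)) (Real.pi / 2), ∀ q : ℝ × ℝ,
      ‖expKernel E lam c₁ c₂ B θ q *
        ((x : ℂ) ^ (-pathL c₁ c₂ B q.1) * (y : ℂ) ^ (-pathL c₁ c₂ B q.2))‖ ≤ D q := by
  obtain ⟨D, hD, hDb⟩ := exists_expKernel_majorant hE hlam h
  refine ⟨fun q => D q * ((x ^ (-c₂) + x ^ (-c₁)) * (y ^ (-c₂) + y ^ (-c₁))), hD.mul_const _,
    fun θ hθ q => ?_⟩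
  have h1 := hDb θ (abs_le.mpr hθ) q
  have h2 := one_le_one_add_abs_rpow q.1 (r := -c₁ / 4) (by linarith [h.neg])
  have h3 := one_le_one_add_abs_rpow q.2 (r := -c₁ / 4) (by linarith [h.neg])
  have h4 : ‖expKernel E lam c₁ c₂ B θ q‖ ≤ D q :=
    (le_mul_of_one_le_left (norm_nonneg _) (one_le_mul_of_one_le_of_one_le h2 h3)).trans h1
  beta_reduce
  rw [norm_mul, norm_mul]
  gcongr ?_ * (?_ * ?_)
  · exact (norm_nonneg _).trans h4
  · exact norm_ofReal_cpow_neg_pathL_le h hx _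
  · exact norm_ofReal_cpow_neg_pathL_le h hy _

/-- The evaluation extends to rotations by a right angle, where the exponentials on the right-hand
side only oscillate and the left-hand side converges by the majorant uniform in `θ`. -/
theorem integral_expKernel_mul_cpow {E : ℝ → ℝ} (hE : IsSmoothSieve E) {lam : ℝ}
    (hlam : 0 < lam) {c₁ c₂ B : ℝ} (h : PathParams c₁ c₂ B) {x y θ : ℝ} (hx : 0 < x) (hy : 0 < y)
    (hθ : θ ∈ Icc (-(Real.pi / 2)) (Real.pi / 2)) :
    (1 / (2 * (Real.pi : ℂ) * I)) ^ 2 * ∫ q, expKernel E lam c₁ c₂ B θ q *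
      ((x : ℂ) ^ (-pathL c₁ c₂ B q.1) * (y : ℂ) ^ (-pathL c₁ c₂ B q.2)) =
    (1 / (Real.pi : ℂ)) * ∫ t in Ioi (0 : ℝ), (fourierE E lam t : ℂ) *
      (cexp (-((x * t : ℝ) * cexp ((-θ : ℝ) * I))) * cexp (-((y * t : ℝ) * cexp (θ * I)))) := by
  have hpi := Real.pi_pos
  -- both sides are continuous in `θ` on the closed interval by dominated convergence
  have hcl : Icc (-(Real.pi / 2)) (Real.pi / 2) ⊆ closure (Ioo (-(Real.pi / 2)) (Real.pi / 2)) := by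
    rw [closure_Ioo (by linarith)]
  refine EqOn.of_subset_closure (s := Ioo (-(Real.pi / 2)) (Real.pi / 2))
    (t := Icc (-(Real.pi / 2)) (Real.pi / 2))
    (f := fun θ : ℝ => (1 / (2 * (Real.pi : ℂ) * I)) ^ 2 * ∫ q, expKernel E lam c₁ c₂ B θ q *
      ((x : ℂ) ^ (-pathL c₁ c₂ B q.1) * (y : ℂ) ^ (-pathL c₁ c₂ B q.2)))
    (g := fun θ : ℝ => (1 / (Real.pi : ℂ)) * ∫ t in Ioi (0 : ℝ), (fourierE E lam t : ℂ) *
      (cexp (-((x * t : ℝ) * cexp ((-θ : ℝ) * I))) * cexp (-((y * t : ℝ) * cexp (θ * I)))))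
    (fun θ hθ => integral_expKernel_mul_cpow_of_lt hE hlam h hx hy (abs_lt.mpr hθ))
    ?_ ?_ Ioo_subset_Icc_self hcl hθ
  · obtain ⟨D, hD, hDb⟩ := exists_expKernel_mul_cpow_majorant hE hlam h hx hy
    refine continuousOn_const.mul (continuousOn_of_dominated
      (fun θ _ => aestronglyMeasurable_expKernel_mul_cpow hE hlam h hx hy θ)
      (fun θ hθ => Eventually.of_forall (hDb θ hθ)) hD (Eventually.of_forall fun q => ?_))
    simp only [expKernel]
    fun_prop
  · refine continuousOn_const.mul (continuousOn_of_dominated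
      (bound := fun t => ‖(fourierE E lam t : ℂ)‖) (fun θ _ => ?_) (fun θ hθ => ?_)
      (integrable_fourierE hE hlam).ofReal.norm.integrableOn
      (Eventually.of_forall fun t => ?_))
    · have := continuous_fourierE hE hlam
      exact Continuous.aestronglyMeasurable (by fun_prop)
    · filter_upwards [ae_restrict_mem measurableSet_Ioi] with t ht
      have ht0 : (0 : ℝ) < t := ht
      have h1 : ∀ a φ : ℝ, 0 < a → φ ∈ Icc (-(Real.pi / 2)) (Real.pi / 2) →
          ‖cexp (-((a * t : ℝ) * cexp (φ * I)))‖ ≤ 1 := by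
        intro a φ ha hφ
        rw [norm_exp, Real.exp_le_one_iff, neg_re, re_ofReal_mul, exp_ofReal_mul_I_re]
        have := Real.cos_nonneg_of_mem_Icc hφ
        have := mul_nonneg (mul_pos ha ht0).le this
        linarith
      rw [norm_mul, norm_mul]
      refine mul_le_of_le_one_right (norm_nonneg _) ?_
      exact mul_le_one₀ (h1 x (-θ) hx ⟨by linarith [hθ.2], by linarith [hθ.1]⟩) (norm_nonneg _)
        (h1 y θ hy hθ)
    · fun_prop

/-- The double contour integral of the kernel against `x^(-z) y^(-w)` is `E^lam(x - y)`. -/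
theorem integral_cosKernel_mul_cpow {E : ℝ → ℝ} (hE : IsSmoothSieve E) {lam : ℝ}
    (hlam : 0 < lam) {c₁ c₂ B : ℝ} (h : PathParams c₁ c₂ B) {x y : ℝ} (hx : 0 < x) (hy : 0 < y) :
    (1 / (2 * (Real.pi : ℂ) * I)) ^ 2 * ∫ q, cosKernel E lam c₁ c₂ B q *
      ((x : ℂ) ^ (-pathL c₁ c₂ B q.1) * (y : ℂ) ^ (-pathL c₁ c₂ B q.2)) =
    (scaled E lam (x - y) : ℂ) := by
  have hpi := Real.pi_pos
  have hmem₁ : Real.pi / 2 ∈ Icc (-(Real.pi / 2)) (Real.pi / 2) := ⟨by linarith, le_rfl⟩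
  have hmem₂ : -(Real.pi / 2) ∈ Icc (-(Real.pi / 2)) (Real.pi / 2) := ⟨le_rfl, by linarith⟩
  have h1 := integral_expKernel_mul_cpow hE hlam h hx hy hmem₁
  have h2 := integral_expKernel_mul_cpow hE hlam h hx hy hmem₂
  have e1 : cexp ((Real.pi / 2 : ℝ) * I) = I := by
    push_cast; exact exp_pi_div_two_mul_I
  have e2 : cexp ((-(Real.pi / 2) : ℝ) * I) = -I := by
    push_cast; rw [neg_mul, Complex.exp_neg, exp_pi_div_two_mul_I, inv_I]
  rw [neg_neg] at h2
  simp only [e1, e2] at h1 h2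
  obtain ⟨D, hD, hDb⟩ := exists_expKernel_mul_cpow_majorant hE hlam h hx hy
  have hi : ∀ θ ∈ Icc (-(Real.pi / 2)) (Real.pi / 2), Integrable fun q =>
      expKernel E lam c₁ c₂ B θ q *
        ((x : ℂ) ^ (-pathL c₁ c₂ B q.1) * (y : ℂ) ^ (-pathL c₁ c₂ B q.2)) := fun θ hθ =>
    hD.mono' (aestronglyMeasurable_expKernel_mul_cpow hE hlam h hx hy θ)
      (Eventually.of_forall (hDb θ hθ))
  have e3 : ∀ t : ℝ, cexp (-((x * t : ℝ) * -I)) * cexp (-((y * t : ℝ) * I)) =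
      cexp (((x - y) * t : ℝ) * I) := fun t => by
    rw [← Complex.exp_add]; congr 1; push_cast; ring
  have e4 : ∀ t : ℝ, cexp (-((x * t : ℝ) * I)) * cexp (-((y * t : ℝ) * -I)) =
      cexp ((-((x - y) * t) : ℝ) * I) := fun t => by
    rw [← Complex.exp_add]; congr 1; push_cast; ring
  simp only [e3, e4] at h1 h2
  have hj : ∀ φ : ℝ → ℝ, Continuous φ → IntegrableOn (fun t =>
      (fourierE E lam t : ℂ) * cexp (φ t * I)) (Ioi 0) := fun φ hφ =>
    ((integrable_fourierE hE hlam).ofReal.mul_bdd (c := 1)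
      (Continuous.aestronglyMeasurable (by fun_prop))
      (Eventually.of_forall fun t => (norm_exp_ofReal_mul_I _).le)).integrableOn
  calc _ = ((1 / (2 * (Real.pi : ℂ) * I)) ^ 2 * (∫ q, expKernel E lam c₁ c₂ B (Real.pi / 2) q *
        ((x : ℂ) ^ (-pathL c₁ c₂ B q.1) * (y : ℂ) ^ (-pathL c₁ c₂ B q.2))) +
        (1 / (2 * (Real.pi : ℂ) * I)) ^ 2 * ∫ q, expKernel E lam c₁ c₂ B (-(Real.pi / 2)) q *
        ((x : ℂ) ^ (-pathL c₁ c₂ B q.1) * (y : ℂ) ^ (-pathL c₁ c₂ B q.2))) / 2 := by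
        rw [← mul_add, ← integral_add (hi _ hmem₁) (hi _ hmem₂), mul_div_assoc, ← integral_div]
        congr 2 with q
        rw [cosKernel]
        ring
    _ = (1 / (Real.pi : ℂ)) * ∫ t in Ioi (0 : ℝ),
        ((fourierE E lam t * Real.cos ((x - y) * t) : ℝ) : ℂ) := by
        rw [h1, h2, ← mul_add, ← integral_add (hj _ (by fun_prop)) (hj _ (by fun_prop)),
          mul_div_assoc, ← integral_div]
        congr 2 with t
        push_cast
        rw [Complex.cos, neg_mul]
        ring
    _ = _ := by
        rw [integral_complex_ofReal, ← integral_fourierE_mul_cos hE hlam]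
        push_cast
        rfl

end

/-! ### The double series -/

section

open Filter Topology Complex

/-- A summable function of one variable, spread over a band about the diagonal. -/
theorem summable_ite_mem_Icc {f : ℕ → ℝ} (hf0 : ∀ k, 0 ≤ f k) (hf : Summable f) (N : ℕ) :
    Summable fun p : ℕ × ℕ => if p.2 ∈ Finset.Icc (p.1 - N) (p.1 + N) then f p.1 else 0 := by
  have hsum : ∀ k, HasSum (fun l => if l ∈ Finset.Icc (k - N) (k + N) then f k else 0)
      ((Finset.Icc (k - N) (k + N)).card * f k) := by
    intro k
    have h := hasSum_sum_of_ne_finset_zero (L := SummationFilter.unconditional ℕ)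
      (f := fun l => if l ∈ Finset.Icc (k - N) (k + N) then f k else 0)
      (s := Finset.Icc (k - N) (k + N)) fun l hl => if_neg hl
    rwa [Finset.sum_congr rfl fun l hl => if_pos hl, Finset.sum_const, nsmul_eq_mul] at h
  refine (summable_prod_of_nonneg fun p => ?_).mpr ⟨fun k => (hsum k).summable, ?_⟩
  · change 0 ≤ ite _ _ _
    split_ifs
    exacts [hf0 _, le_rfl]
  · refine Summable.of_nonneg_of_le (fun k => ?_) (fun k => ?_) (hf.mul_left (2 * N + 1 : ℝ))
    · rw [(hsum k).tsum_eq]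
      exact mul_nonneg (Nat.cast_nonneg _) (hf0 k)
    · rw [(hsum k).tsum_eq]
      refine mul_le_mul_of_nonneg_right ?_ (hf0 k)
      rw [Nat.card_Icc]
      have : k + N + 1 - (k - N) ≤ 2 * N + 1 := by omega
      exact_mod_cast this

theorem IsSmoothSieve.abs_le_one {E : ℝ → ℝ} (hE : IsSmoothSieve E) (x : ℝ) : |E x| ≤ 1 := by
  have h0 : E x = E |x| := by
    rcases abs_choice x with h | h <;> rw [h]
    rw [hE.even]
  have hx := abs_nonneg x
  have h1 : E |x| ≤ E 0 := hE.antitone (mem_Ici.mpr le_rfl) (mem_Ici.mpr hx) hx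
  have h2 : E (|x| + 2) ≤ E |x| :=
    hE.antitone (mem_Ici.mpr hx) (mem_Ici.mpr (by linarith)) (by linarith)
  rw [hE.zero] at h1
  rw [hE.zero_of_one_lt_abs _ (by rw [abs_of_nonneg (by linarith)]; linarith)] at h2
  rw [h0, abs_of_nonneg h2]
  exact h1

/-- The size `Λ(k) k^(-σ)` of the coefficients. -/
def mangoldtWeight (σ : ℝ) (k : ℕ) : ℝ := ArithmeticFunction.vonMangoldt k * (k : ℝ) ^ (-σ)

theorem mangoldtWeight_nonneg (σ : ℝ) (k : ℕ) : 0 ≤ mangoldtWeight σ k :=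
  mul_nonneg ArithmeticFunction.vonMangoldt_nonneg (by positivity)

theorem norm_vonMangoldt_mul_cpow_le {σ : ℝ} {z : ℂ} (hz : σ ≤ z.re) (k : ℕ) :
    ‖(ArithmeticFunction.vonMangoldt k : ℂ) * (k : ℂ) ^ (-z)‖ ≤ mangoldtWeight σ k := by
  rcases Nat.eq_zero_or_pos k with rfl | hk
  · simp [mangoldtWeight]
  rw [norm_mul, norm_natCast_cpow_of_pos hk, norm_real,
    Real.norm_of_nonneg ArithmeticFunction.vonMangoldt_nonneg, mangoldtWeight, neg_re]
  refine mul_le_mul_of_nonneg_left ?_ ArithmeticFunction.vonMangoldt_nonneg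
  exact Real.rpow_le_rpow_of_exponent_le (by exact_mod_cast hk) (by linarith)

theorem summable_mangoldtWeight_sq {σ : ℝ} (hσ : 1 / 2 < σ) :
    Summable fun k => mangoldtWeight σ k ^ 2 := by
  -- with `Λ(k) ≤ log k ≤ k ^ ε / ε` the exponent becomes `2 * ε - 2 * σ = - σ - 1 / 2 < -1`
  set ε := (2 * σ - 1) / 4 with hε
  have hε0 : 0 < ε := by linarith
  have h1 : Summable fun k : ℕ => (ε⁻¹) ^ 2 * (k : ℝ) ^ (-σ - 1 / 2) :=
    (Real.summable_nat_rpow.mpr (by linarith)).mul_left _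
  refine h1.of_nonneg_of_le (fun k => sq_nonneg _) fun k => ?_
  rcases Nat.eq_zero_or_pos k with rfl | hk
  · simp only [mangoldtWeight, ArithmeticFunction.map_zero, zero_mul, zero_pow two_ne_zero]
    positivity
  have hk0 : (0 : ℝ) < k := by exact_mod_cast hk
  have h2 : mangoldtWeight σ k ≤ ε⁻¹ * (k : ℝ) ^ (ε - σ) := by
    calc mangoldtWeight σ k ≤ ((k : ℝ) ^ ε / ε) * (k : ℝ) ^ (-σ) := by
          refine mul_le_mul_of_nonneg_right ?_ (by positivity)
          exact ArithmeticFunction.vonMangoldt_le_log.trans (Real.log_le_rpow_div hk0.le hε0)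
      _ = ε⁻¹ * ((k : ℝ) ^ ε * (k : ℝ) ^ (-σ)) := by ring
      _ = _ := by rw [← Real.rpow_add hk0, sub_eq_add_neg]
  calc mangoldtWeight σ k ^ 2 ≤ (ε⁻¹ * (k : ℝ) ^ (ε - σ)) ^ 2 :=
        pow_le_pow_left₀ (mangoldtWeight_nonneg σ k) h2 2
    _ = (ε⁻¹) ^ 2 * ((k : ℝ) ^ (ε - σ) * (k : ℝ) ^ (ε - σ)) := by ring
    _ = _ := by rw [← Real.rpow_add hk0]; congr 2; rw [hε]; ring

theorem summable_mangoldtWeight {σ : ℝ} (hσ : 1 < σ) : Summable (mangoldtWeight σ) := by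
  have h := (ArithmeticFunction.LSeriesSummable_vonMangoldt (s := (σ : ℂ)) (by simpa using hσ)).norm
  refine h.congr fun k => ?_
  rw [LSeries.norm_term_eq]
  split_ifs with hk
  · simp [hk, mangoldtWeight]
  · rw [mangoldtWeight, norm_real, Real.norm_of_nonneg ArithmeticFunction.vonMangoldt_nonneg,
      ofReal_re, Real.rpow_neg (Nat.cast_nonneg _), div_eq_mul_inv]

/-- Only the terms near the diagonal contribute to `T^lam`; by the inequality
`2ab ≤ a ^ 2 + b ^ 2` they converge absolutely for `σ > 1 / 2`. -/
theorem exists_termT_majorant {E : ℝ → ℝ} (hE : IsSmoothSieve E) {lam : ℝ} (hlam : 0 < lam)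
    {σ : ℝ} (hσ : 1 / 2 < σ) :
    ∃ u : ℕ × ℕ → ℝ, Summable u ∧ ∀ p, ∀ s : ℂ, σ ≤ s.re → ‖termT E lam s p‖ ≤ u p := by
  obtain ⟨N, hN⟩ := exists_nat_ge lam
  have h1 := summable_ite_mem_Icc (fun k => sq_nonneg (mangoldtWeight σ k))
    (summable_mangoldtWeight_sq hσ) N
  have h2 : Summable fun p : ℕ × ℕ =>
      if p.1 ∈ Finset.Icc (p.2 - N) (p.2 + N) then mangoldtWeight σ p.2 ^ 2 else 0 := by
    refine (h1.comp_injective Prod.swap_injective).congr fun p => ?_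
    by_cases hp : p.1 ∈ Finset.Icc (p.2 - N) (p.2 + N)
    · rw [if_pos hp]
      exact if_pos hp
    · rw [if_neg hp]
      exact if_neg hp
  refine ⟨fun p => (if p.2 ∈ Finset.Icc (p.1 - N) (p.1 + N) then mangoldtWeight σ p.1 ^ 2 else 0) +
    if p.1 ∈ Finset.Icc (p.2 - N) (p.2 + N) then mangoldtWeight σ p.2 ^ 2 else 0,
    h1.add h2, fun p s hs => ?_⟩
  beta_reduce
  have b1 := mangoldtWeight_nonneg σ p.1
  have b2 := mangoldtWeight_nonneg σ p.2
  by_cases hp : p.2 ∈ Finset.Icc (p.1 - N) (p.1 + N)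
  · have hp' : p.1 ∈ Finset.Icc (p.2 - N) (p.2 + N) := by
      rw [Finset.mem_Icc] at hp ⊢
      omega
    rw [if_pos hp, if_pos hp']
    have e : termT E lam s p = ((ArithmeticFunction.vonMangoldt p.1 : ℂ) * (p.1 : ℂ) ^ (-s)) *
        ((ArithmeticFunction.vonMangoldt p.2 : ℂ) * (p.2 : ℂ) ^ (-s)) *
        (scaled E lam ((p.1 : ℝ) - (p.2 : ℝ)) : ℂ) := by rw [termT]; ring
    rw [e, norm_mul, norm_mul, norm_real, Real.norm_eq_abs]
    calc _ ≤ mangoldtWeight σ p.1 * mangoldtWeight σ p.2 * 1 := by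
          gcongr ?_ * ?_ * ?_
          · exact norm_vonMangoldt_mul_cpow_le hs _
          · exact norm_vonMangoldt_mul_cpow_le hs _
          · exact hE.abs_le_one _
      _ ≤ _ := by nlinarith [sq_nonneg (mangoldtWeight σ p.1 - mangoldtWeight σ p.2)]
  · have h0 : scaled E lam ((p.1 : ℝ) - (p.2 : ℝ)) = 0 := by
      refine hE.zero_of_one_lt_abs _ ?_
      rw [abs_div, abs_of_pos hlam, one_lt_div hlam]
      by_contra! hcon
      refine hp ?_
      have h3 : |(p.1 : ℝ) - p.2| ≤ N := hcon.trans hN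
      rw [abs_le] at h3
      have h4 : p.1 ≤ p.2 + N := by
        have : (p.1 : ℝ) ≤ p.2 + N := by linarith [h3.2]
        exact_mod_cast this
      have h5 : p.2 ≤ p.1 + N := by
        have : (p.2 : ℝ) ≤ p.1 + N := by linarith [h3.1]
        exact_mod_cast this
      rw [Finset.mem_Icc]
      omega
    rw [termT, h0, ofReal_zero, mul_zero, norm_zero]
    refine add_nonneg ?_ ?_ <;> split_ifs <;> positivity

theorem summable_termT {E : ℝ → ℝ} (hE : IsSmoothSieve E) {lam : ℝ} (hlam : 0 < lam)
    {s : ℂ} (hs : 1 / 2 < s.re) : Summable (termT E lam s) := by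
  obtain ⟨u, hu, hub⟩ := exists_termT_majorant hE hlam hs
  exact hu.of_norm_bounded fun p => hub p s le_rfl

theorem differentiable_termT (E : ℝ → ℝ) (lam : ℝ) (p : ℕ × ℕ) :
    Differentiable ℂ fun s => termT E lam s p := by
  rcases eq_or_ne p.1 0 with h1 | h1
  · simp [termT, h1]
  rcases eq_or_ne p.2 0 with h2 | h2
  · simp [termT, h2]
  have d : ∀ k : ℕ, k ≠ 0 → Differentiable ℂ fun s : ℂ => (k : ℂ) ^ (-s) := fun k hk =>
    differentiable_neg.const_cpow (Or.inl (Nat.cast_ne_zero.mpr hk))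
  have d1 := d p.1 h1
  have d2 := d p.2 h2
  unfold termT
  fun_prop

theorem differentiableOn_tsum_termT {E : ℝ → ℝ} (hE : IsSmoothSieve E) {lam : ℝ}
    (hlam : 0 < lam) :
    DifferentiableOn ℂ (fun s => ∑' p, termT E lam s p) {s | 1 / 2 < s.re} := by
  intro s hs
  have hs' : 1 / 2 < s.re := hs
  obtain ⟨u, hu, hub⟩ := exists_termT_majorant hE hlam (σ := (1 / 2 + s.re) / 2) (by linarith)
  have hopen : IsOpen {z : ℂ | (1 / 2 + s.re) / 2 < z.re} :=
    isOpen_lt continuous_const continuous_re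
  have h := differentiableOn_tsum_of_summable_norm hu
    (fun p => (differentiable_termT E lam p).differentiableOn) hopen
    fun p w hw => hub p w (le_of_lt hw)
  exact (h.differentiableAt (hopen.mem_nhds
    (show (1 / 2 + s.re) / 2 < s.re by linarith))).differentiableWithinAt

theorem hasSum_neg_zetaLogDeriv {z : ℂ} (hz : 1 < z.re) :
    HasSum (fun k : ℕ => (ArithmeticFunction.vonMangoldt k : ℂ) * (k : ℂ) ^ (-z))
      (-zetaLogDeriv z) := by
  have h := (ArithmeticFunction.LSeriesSummable_vonMangoldt hz).hasSum
  have e : ∑' k, LSeries.term (fun n => (ArithmeticFunction.vonMangoldt n : ℂ)) z k =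
      -zetaLogDeriv z := by
    rw [zetaLogDeriv, ← neg_div,
      ← ArithmeticFunction.LSeries_vonMangoldt_eq_deriv_riemannZeta_div hz]
    rfl
  rw [e] at h
  refine h.congr_fun fun k => ?_
  rw [LSeries.term_def]
  split_ifs with hk
  · simp [hk]
  · rw [cpow_neg, div_eq_mul_inv]

/-- In the half-plane of absolute convergence the repeated integral is evaluated termwise. -/
theorem hasSum_termT_integralT {E : ℝ → ℝ} (hE : IsSmoothSieve E) {lam : ℝ} (hlam : 0 < lam)
    {c₁ c₂ B : ℝ} (h : PathParams c₁ c₂ B) {s : ℂ} (hs : s ∈ halfPlane c₁) :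
    HasSum (termT E lam s) (integralT E lam c₁ c₂ B s) := by
  have hs1 : 1 - c₁ < s.re := hs
  set σ := c₁ + s.re with hσ
  have hre : ∀ t, σ ≤ (pathL c₁ c₂ B t + s).re := fun t => by
    rw [add_re]; linarith [(pathL_re_mem h.lt h.height t).1]
  set a : ℕ → ℝ → ℂ := fun k t =>
    (ArithmeticFunction.vonMangoldt k : ℂ) * (k : ℂ) ^ (-(pathL c₁ c₂ B t + s)) with ha
  have hab : ∀ k t, ‖a k t‖ ≤ mangoldtWeight σ k := fun k t =>
    norm_vonMangoldt_mul_cpow_le (hre t) k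
  have hw := summable_mangoldtWeight (σ := σ) (by linarith)
  have han : ∀ t, Summable fun k => ‖a k t‖ := fun t =>
    hw.of_nonneg_of_le (fun k => norm_nonneg _) fun k => hab k t
  have hasum : ∀ t, HasSum (fun k => a k t) (-zetaLogDeriv (pathL c₁ c₂ B t + s)) := fun t =>
    hasSum_neg_zetaLogDeriv (by linarith [hre t])
  set F : ℕ × ℕ → ℝ × ℝ → ℂ := fun p q => a p.1 q.1 * a p.2 q.2 * cosKernel E lam c₁ c₂ B q with hF
  have hFsum : ∀ q, HasSum (fun p => F p q) (fullIntegrand E lam c₁ c₂ B s q) := by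
    intro q
    have h1 := (hasum q.1).mul (hasum q.2)
      (summable_mul_of_summable_norm (f := fun k => a k q.1) (g := fun k => a k q.2)
        (han q.1) (han q.2))
    rw [neg_mul_neg] at h1
    exact h1.mul_right _
  obtain ⟨D, hD, hDb⟩ := exists_cosKernel_majorant hE hlam h
  have hDk : ∀ q, ‖cosKernel E lam c₁ c₂ B q‖ ≤ D q := fun q => by
    have h2 := one_le_one_add_abs_rpow q.1 (r := -c₁ / 4) (by linarith [h.neg])
    have h3 := one_le_one_add_abs_rpow q.2 (r := -c₁ / 4) (by linarith [h.neg])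
    exact (le_mul_of_one_le_left (norm_nonneg _) (one_le_mul_of_one_le_of_one_le h2 h3)).trans
      (hDb q)
  have hFb : ∀ p q, ‖F p q‖ ≤ mangoldtWeight σ p.1 * mangoldtWeight σ p.2 * D q := fun p q => by
    rw [hF]
    beta_reduce
    rw [norm_mul, norm_mul]
    have := mangoldtWeight_nonneg σ p.1
    have := mangoldtWeight_nonneg σ p.2
    gcongr ?_ * ?_ * ?_
    · exact hab _ _
    · exact hab _ _
    · exact hDk q
  have hac : ∀ k, Continuous (a k) := fun k => by
    rcases eq_or_ne k 0 with rfl | hk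
    · simp only [ha, ArithmeticFunction.map_zero, ofReal_zero, zero_mul]
      exact continuous_const
    · exact continuous_const.mul ((h.continuous.add continuous_const).neg.const_cpow
        (Or.inl (Nat.cast_ne_zero.mpr hk)))
  have hFm : ∀ p, AEStronglyMeasurable (F p) := fun p =>
    ((((hac p.1).comp continuous_fst).mul ((hac p.2).comp continuous_snd)).measurable.mul
      (measurable_cosKernel hE hlam h)).aestronglyMeasurable
  have hFi : ∀ p, Integrable (F p) := fun p =>
    (hD.const_mul _).mono' (hFm p) (Eventually.of_forall (hFb p))
  have hFn : Summable fun p => ∫ q, ‖F p q‖ := by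
    have h1 : Summable fun p : ℕ × ℕ => mangoldtWeight σ p.1 * mangoldtWeight σ p.2 :=
      hw.mul_of_nonneg hw (mangoldtWeight_nonneg σ) (mangoldtWeight_nonneg σ)
    refine (h1.mul_right (∫ q, D q)).of_nonneg_of_le
      (fun p => integral_nonneg fun q => norm_nonneg _) fun p => ?_
    rw [← integral_const_mul]
    exact integral_mono (hFi p).norm (hD.const_mul _) (hFb p)
  have hmain := (hasSum_integral_of_summable_integral_norm hFi hFn).mul_left
    ((1 / (2 * (Real.pi : ℂ) * I)) ^ 2)
  simp only [fun q => (hFsum q).tsum_eq] at hmain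
  rw [← integralT_eq (integrable_fullIntegrand hE hlam h (isZetaRegion_halfPlane h) hs)] at hmain
  refine hmain.congr_fun fun p => ?_
  rcases eq_or_ne p.1 0 with h1 | h1
  · simp [termT, hF, ha, h1]
  rcases eq_or_ne p.2 0 with h2 | h2
  · simp [termT, hF, ha, h2]
  have h1' : (p.1 : ℂ) ≠ 0 := Nat.cast_ne_zero.mpr h1
  have h2' : (p.2 : ℂ) ≠ 0 := Nat.cast_ne_zero.mpr h2
  have hJ := integral_cosKernel_mul_cpow hE hlam h (x := p.1) (y := p.2)
    (by exact_mod_cast Nat.pos_of_ne_zero h1) (by exact_mod_cast Nat.pos_of_ne_zero h2)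
  rw [termT, ← hJ, mul_left_comm, ← integral_const_mul]
  congr 2 with q
  simp only [hF, ha, neg_add, cpow_add _ _ h1', cpow_add _ _ h2', ofReal_natCast]
  ring

theorem halfStrip_subset {c₁ c₂ B : ℝ} (h : PathParams c₁ c₂ B) :
    halfStrip c₁ c₂ B ⊆ {s | 1 / 2 < s.re} := fun s hs => by
  have h1 := (le_max_left (1 / 2 - c₁) (1 - c₂)).trans_lt hs.1
  have h2 := h.neg
  show 1 / 2 < s.re
  linarith

theorem convex_halfStrip (c₁ c₂ B : ℝ) : Convex ℝ (halfStrip c₁ c₂ B) := by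
  have h1 : Convex ℝ {s : ℂ | max (1 / 2 - c₁) (1 - c₂) < s.re} := convex_halfSpace_re_gt _
  have h2 : Convex ℝ {s : ℂ | s.im < B} := convex_halfSpace_im_lt _
  have h3 : Convex ℝ {s : ℂ | -B < s.im} := convex_halfSpace_im_gt _
  convert h1.inter (h3.inter h2) using 1
  ext s
  simp [halfStrip, abs_lt]

/-- By the identity theorem the evaluation of the repeated integral persists on the half-strip. -/
theorem eqOn_halfStrip (hRH : RiemannHypothesis) {E : ℝ → ℝ} (hE : IsSmoothSieve E) {lam : ℝ}
    (hlam : 0 < lam) {c₁ c₂ B : ℝ} (h : PathParams c₁ c₂ B) :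
    EqOn (integralT E lam c₁ c₂ B) (fun s => ∑' p, termT E lam s p) (halfStrip c₁ c₂ B) := by
  have hU := isZetaRegion_halfStrip hRH h
  have h1 := (hU.differentiableOn_integralT hE hlam h).analyticOnNhd hU.isOpen
  have h2 := ((differentiableOn_tsum_termT hE hlam).mono (halfStrip_subset h)).analyticOnNhd
    hU.isOpen
  set x : ℝ := max (max (1 / 2 - c₁) (1 - c₂)) (1 - c₁) + 1 with hx
  have hx1 : (x : ℂ) ∈ halfStrip c₁ c₂ B := by
    refine ⟨?_, by simpa using h.height⟩
    rw [ofReal_re]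
    exact (le_max_left _ _).trans_lt (lt_add_one _)
  have hx2 : (x : ℂ) ∈ halfPlane c₁ := by
    change 1 - c₁ < (x : ℂ).re
    rw [ofReal_re]
    exact (le_max_right _ _).trans_lt (lt_add_one _)
  refine h1.eqOn_of_preconnected_of_eventuallyEq h2 (convex_halfStrip c₁ c₂ B).isPreconnected hx1 ?_
  filter_upwards [(isZetaRegion_halfPlane h).isOpen.mem_nhds hx2] with s hs
  exact (hasSum_termT_integralT hE hlam h hs).tsum_eq.symm

end

end PrimePairs

end

theorem theorem5p1 (E : ℝ → ℝ) (hE : PrimePairs.IsSmoothSieve E) (lam : ℝ) (hlam : 0 < lam)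
    (c₁ c₂ B : ℝ) (hc₁ : -(3 / 2) < c₁) (hc₁0 : c₁ < 0) (hc₂0 : 0 < c₂) (hc₂ : c₂ < 1 / 2)
    (hB : 0 < B) :
    -- the integral converges absolutely and is holomorphic for `σ > 1 - c₁`
    ((∀ s ∈ PrimePairs.halfPlane c₁, PrimePairs.IntegralTConverges E lam c₁ c₂ B s) ∧
      DifferentiableOn ℂ (PrimePairs.integralT E lam c₁ c₂ B) (PrimePairs.halfPlane c₁)) ∧
    -- under RH the same holds for `σ > max {1/2 - c₁, 1 - c₂}`, `|τ| < B`
    (RiemannHypothesis →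
      (∀ s ∈ PrimePairs.halfStrip c₁ c₂ B, PrimePairs.IntegralTConverges E lam c₁ c₂ B s) ∧
      DifferentiableOn ℂ (PrimePairs.integralT E lam c₁ c₂ B)
        (PrimePairs.halfStrip c₁ c₂ B)) ∧
    -- the analytic continuation `T` to `σ > 1/2`, given by the double series
    ∃ T : ℂ → ℂ,
      DifferentiableOn ℂ T {s | 1 / 2 < s.re} ∧
      (∀ s : ℂ, 1 / 2 < s.re → HasSum (PrimePairs.termT E lam s) (T s)) ∧
      EqOn (PrimePairs.integralT E lam c₁ c₂ B) T (PrimePairs.halfPlane c₁) ∧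
      (RiemannHypothesis →
        EqOn (PrimePairs.integralT E lam c₁ c₂ B) T (PrimePairs.halfStrip c₁ c₂ B)) := by
  have h : PrimePairs.PathParams c₁ c₂ B := ⟨hc₁, hc₁0, hc₂0, hc₂, hB⟩
  have hP := PrimePairs.isZetaRegion_halfPlane h
  refine ⟨⟨fun s hs => hP.integralTConverges hE hlam h hs,
    hP.differentiableOn_integralT hE hlam h⟩, fun hRH => ?_, ?_⟩
  · have hS := PrimePairs.isZetaRegion_halfStrip hRH h
    exact ⟨fun s hs => hS.integralTConverges hE hlam h hs,
      hS.differentiableOn_integralT hE hlam h⟩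
  · exact ⟨fun s => ∑' p, PrimePairs.termT E lam s p,
      PrimePairs.differentiableOn_tsum_termT hE hlam,
      fun s hs => (PrimePairs.summable_termT hE hlam hs).hasSum,
      fun s hs => (PrimePairs.hasSum_termT_integralT hE hlam h hs).tsum_eq.symm,
      fun hRH => PrimePairs.eqOn_halfStrip hRH hE hlam h⟩
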